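/- **Theorem 4 (Ricci tensor and covariant derivative on $\Sigma$).** Let $(M,g_{ab})$ be a smooth spacetime of dimension $s\ge 2$ (a Hausdorff, second countable manifold with a smooth metric of signature $(-,+,\dots,+)$), let $u$ be a smooth function on $M$, and let $\Sigma=\{u=0\}$ be a smoothly embedded regular null hypersurface: $\nabla_a u\neq 0$ and $g^{ab}\nabla_a u\,\nabla_b u=0$ on $\Sigma$. Let $n^a=g^{ab}\nabla_b u$, which on $\Sigma$ is tangent to $\Sigma$, and let $q_{ab}$ be the pullback of $g_{ab}$ to $\Sigma$. Put $\Omega=u$ and, where $u\ne0$, $\widetilde g_{ab}=\Omega^{-2}g_{ab}$; let $R_{ab}$, $\widetilde R_{ab}$ be the Ricci tensors of $g_{ab}$, $\widetilde g_{ab}$. Suppose that the pullback to $\Sigma$ of (the continuous extension to $\Sigma$ of) $\Omega(R_{ab}-\widetilde R_{ab})$ equals $k\,q_{ab}$ for some function $k$ on $\Sigma$. Then: 1. $\pounds_n q_{ab}=f\,q_{ab}$ on $\Sigma$ for some smooth function $f$ on $\Sigma$. 2. The conformal pullback method leads to a well-defined connection on $\Sigma$, in the following sense. For an open set $U\subseteq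 M$ call a smooth function $\omega>0$ on $U$ *admissible* if, with $\overline g_{ab}=\omega^2 g_{ab}$, $\overline q_{ab}$ the pullback of $\overline g_{ab}$ to $\Sigma\cap U$ and $\overline n^a=\omega^{-1}n^a$, one has $\pounds_{\overline n}\,\overline q_{ab}=0$ on $\Sigma\cap U$. (a) Every point of $\Sigma$ has an open neighbourhood $U$ in $M$ with an admissible $\omega$. (b) If $\Sigma$ is a product along its null generators, that is, if there are a manifold $S$ and a diffeomorphism $\Phi:S\times\mathbb R\to\Sigma$ such that every curve $t\mapsto\Phi(p,t)$ is everywhere tangent to $n$, then there is an admissible $\omega$ on all of $M$. (c) For every open $U\subseteq M$ and every admissible $\omega$ on $U$ the pullback connection of $\overline g$ is well-defined on $\Sigma\cap U$: there is one and only one connection $D$ on the 1-forms of $\Sigma\cap U$ such that $D_a(\varphi^* w_b)=\varphi^*(\overline\nabla_a w_b)$ for all 1-forms $w_b$ on $M$, where $\overline\nabla$ is the Levi-Civita derivative of $\overline g$ and $\varphi^*$ is the pullback to $\Sigma$; $D$ is smooth. -/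

import Mathlib

open Manifold Bundle
open scoped ContDiff Topology

attribute [-instance] TopCat.of.chartedSpace

noncomputable section

namespace NullPullback

/-- The model space of an `n`-dimensional manifold. -/
abbrev Model (n : ℕ) : Type := EuclideanSpace ℝ (Fin n)

section Tensors

variable {n : ℕ} {M : Type*} [TopologicalSpace M] [ChartedSpace (Model n) M]

variable (n M) in
/-- Covariant 1-tensor fields (1-forms), without any regularity. -/
abbrev OneForm : Type _ := (p : M) → TangentSpace (𝓡 n) p →L[ℝ] ℝ

variable (n M) in
/-- Covariant 2-tensor fields, without any regularity. -/
abbrev TwoTensor : Type _ :=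
  (p : M) → TangentSpace (𝓡 n) p →L[ℝ] TangentSpace (𝓡 n) p →L[ℝ] ℝ

variable (n M) in
/-- Vector fields, without any regularity. -/
abbrev VField : Type _ := (p : M) → TangentSpace (𝓡 n) p

variable [IsManifold (𝓡 n) ∞ M]

/-- The vector field `X` is smooth. -/
def SmoothVField (X : VField n M) : Prop :=
  ContMDiff (𝓡 n) ((𝓡 n).prod 𝓘(ℝ, Model n)) ∞ (fun p => TotalSpace.mk' (Model n) p (X p))

/-- The vector field `X` is differentiable at `p`. -/
def VFieldDiffAt (X : VField n M) (p : M) : Prop :=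
  MDifferentiableAt (𝓡 n) ((𝓡 n).prod 𝓘(ℝ, Model n))
    (fun p => TotalSpace.mk' (Model n) p (X p)) p

/-- The 1-form `w` is differentiable at `p`. -/
def OneFormDiffAt (w : OneForm n M) (p : M) : Prop :=
  MDifferentiableAt (𝓡 n) ((𝓡 n).prod 𝓘(ℝ, Model n →L[ℝ] ℝ))
    (fun p => TotalSpace.mk' (Model n →L[ℝ] ℝ) p (w p)) p

/-- The 2-tensor field `T` is smooth. -/
def SmoothTwoTensor (T : TwoTensor n M) : Prop :=
  ContMDiff (𝓡 n) ((𝓡 n).prod 𝓘(ℝ, Model n →L[ℝ] Model n →L[ℝ] ℝ)) ∞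
    (fun p => TotalSpace.mk' (Model n →L[ℝ] Model n →L[ℝ] ℝ) p (T p))

/-- The 2-tensor field `T` is continuous. -/
def ContinuousTwoTensor (T : TwoTensor n M) : Prop :=
  Continuous (fun p => TotalSpace.mk' (Model n →L[ℝ] Model n →L[ℝ] ℝ) p (T p))

end Tensors

/-- A smooth metric of Lorentzian signature `(-, +, …, +)`: at every point there is a
timelike vector whose orthogonal complement is positive definite. -/
structure LorentzMetric (n : ℕ) (M : Type*) [TopologicalSpace M] [ChartedSpace (Model n) M]
    [IsManifold (𝓡 n) ∞ M] where
  /-- The metric tensor. -/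
  val : TwoTensor n M
  symm : ∀ p v w, val p v w = val p w v
  smooth : SmoothTwoTensor val
  lorentzian : ∀ p, ∃ v, val p v v < 0 ∧ ∀ w, val p v w = 0 → w ≠ 0 → 0 < val p w w

section Charts

/-! ### Levi-Civita derivative and Ricci tensor in local coordinates

All components are taken in the coordinates `extChartAt (𝓡 n) c` around a point `c`, as
functions of the coordinate vector `y`. -/

variable {n : ℕ} {M : Type*} [TopologicalSpace M] [ChartedSpace (Model n) M]

/-- The `i`-th coordinate vector field `∂ᵢ` at the point with coordinates `y`. -/
def coordVec (c : M) (y : Model n) (i : Fin n) :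
    TangentSpace (𝓡 n) ((extChartAt (𝓡 n) c).symm y) :=
  mfderiv 𝓘(ℝ, Model n) (𝓡 n) (extChartAt (𝓡 n) c).symm y
    ((NormedSpace.fromTangentSpace y).symm (EuclideanSpace.single i (1 : ℝ)))

/-- The `i`-th coordinate of a tangent vector at the centre `p` of the coordinates. -/
def coord (p : M) (X : TangentSpace (𝓡 n) p) (i : Fin n) : ℝ :=
  NormedSpace.fromTangentSpace (extChartAt (𝓡 n) p p)
    (mfderiv (𝓡 n) 𝓘(ℝ, Model n) (extChartAt (𝓡 n) p) p X) i

/-- The `i`-th partial derivative in the model space. -/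
def pd (i : Fin n) (f : Model n → ℝ) (y : Model n) : ℝ :=
  fderiv ℝ f y (EuclideanSpace.single i (1 : ℝ))

/-- The matrix `g_{ij}`. -/
def gram (g : TwoTensor n M) (c : M) (y : Model n) : Matrix (Fin n) (Fin n) ℝ :=
  Matrix.of fun i j => g ((extChartAt (𝓡 n) c).symm y) (coordVec c y i) (coordVec c y j)

/-- The Christoffel symbol `Γᵏ_{ij} = ½ gᵏˡ (∂ᵢ g_{lj} + ∂ⱼ g_{il} - ∂ₗ g_{ij})`. -/
def christoffel (g : TwoTensor n M) (c : M) (k i j : Fin n) (y : Model n) : ℝ :=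
  (1 / 2 : ℝ) * ∑ l, (gram g c y)⁻¹ k l *
    (pd i (fun z => gram g c z l j) y + pd j (fun z => gram g c z i l) y
      - pd l (fun z => gram g c z i j) y)

/-- The components
`R_{ij} = ∂ₖ Γᵏ_{ij} - ∂ⱼ Γᵏ_{ik} + Γᵏ_{kl} Γˡ_{ij} - Γᵏ_{jl} Γˡ_{ik}` of the Ricci tensor. -/
def ricciComp (g : TwoTensor n M) (c : M) (i j : Fin n) (y : Model n) : ℝ :=
  ∑ k, (pd k (christoffel g c k i j) y - pd j (christoffel g c k i k) y)
    + ∑ k, ∑ l, (christoffel g c k k l y * christoffel g c l i j y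
      - christoffel g c k j l y * christoffel g c l i k y)

/-- The Ricci tensor `Ric(X, Y)` of `g` at `p`. -/
def ricci (g : TwoTensor n M) (p : M) (X Y : TangentSpace (𝓡 n) p) : ℝ :=
  ∑ i, ∑ j, coord p X i * coord p Y j * ricciComp g p i j (extChartAt (𝓡 n) p p)

/-- The `j`-th component of a 1-form. -/
def formComp (W : OneForm n M) (c : M) (j : Fin n) (y : Model n) : ℝ :=
  W ((extChartAt (𝓡 n) c).symm y) (coordVec c y j)

/-- The Levi-Civita derivative `(∇_X W)(Y)`, with respect to `g`, of a 1-form `W` at `p`: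
its components are `∂ᵢ Wⱼ - Γᵏ_{ij} Wₖ`. -/
def nablaForm (g : TwoTensor n M) (W : OneForm n M) (p : M) (X Y : TangentSpace (𝓡 n) p) : ℝ :=
  let y := extChartAt (𝓡 n) p p
  ∑ i, ∑ j, coord p X i * coord p Y j *
    (pd i (formComp W p j) y - ∑ k, christoffel g p k i j y * formComp W p k y)

/-- The differential of a function. -/
def diff (u : M → ℝ) (p : M) : TangentSpace (𝓡 n) p →L[ℝ] ℝ :=
  mvfderiv (𝓡 n) u p

/-- The Lie derivative `(£_ν T)(X, Y) = ν (T(X, Y)) - T([ν, X], Y) - T(X, [ν, Y])` at `p`. -/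
def lieDeriv (ν : VField n M) (T : TwoTensor n M) (X Y : VField n M) (p : M) : ℝ :=
  diff (n := n) (fun y => T y (X y) (Y y)) p (ν p)
    - T p (VectorField.mlieBracket (𝓡 n) ν X p) (Y p)
    - T p (X p) (VectorField.mlieBracket (𝓡 n) ν Y p)

end Charts

namespace LorentzMetric

variable {n : ℕ} {M : Type*} [TopologicalSpace M] [ChartedSpace (Model n) M]
  [IsManifold (𝓡 n) ∞ M] (g : LorentzMetric n M)

theorem eq_zero_of_forall (p : M) (w : TangentSpace (𝓡 n) p) (h : ∀ v, g.val p w v = 0) :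
    w = 0 := by
  obtain ⟨v, -, hv⟩ := g.lorentzian p
  by_contra hw
  have h1 := hv w (by rw [g.symm]; exact h v) hw
  rw [h w] at h1
  exact lt_irrefl _ h1

/-- Lowering an index. -/
def flat (p : M) : TangentSpace (𝓡 n) p →ₗ[ℝ] Module.Dual ℝ (TangentSpace (𝓡 n) p) where
  toFun w := (g.val p w).toLinearMap
  map_add' a b := by ext v; simp
  map_smul' r a := by ext v; simp

instance (p : M) : FiniteDimensional ℝ (TangentSpace (𝓡 n) p) :=
  inferInstanceAs (FiniteDimensional ℝ (Model n))

theorem flat_injective (p : M) : Function.Injective (g.flat p) := by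
  rw [injective_iff_map_eq_zero]
  intro w hw
  exact g.eq_zero_of_forall p w fun v => LinearMap.congr_fun hw v

/-- The gradient `nᵃ = gᵃᵇ ∇_b u`. -/
def grad (u : M → ℝ) (p : M) : TangentSpace (𝓡 n) p :=
  (LinearMap.linearEquivOfInjective (g.flat p) (g.flat_injective p)
    Subspace.dual_finrank_eq.symm).symm (diff (n := n) u p).toLinearMap

/-- The defining property of the gradient: `g(grad u, v) = du(v)`. -/
theorem val_grad (u : M → ℝ) (p : M) (v : TangentSpace (𝓡 n) p) :
    g.val p (g.grad u p) v = diff (n := n) u p v := by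
  have h := (LinearMap.linearEquivOfInjective (g.flat p) (g.flat_injective p)
    Subspace.dual_finrank_eq.symm).apply_symm_apply (diff (n := n) u p).toLinearMap
  exact LinearMap.congr_fun h v

end LorentzMetric

section Submanifold

variable {n m : ℕ} {M : Type*} [TopologicalSpace M] [ChartedSpace (Model n) M]
  {N : Type*} [TopologicalSpace N] [ChartedSpace (Model m) N]

/-- The differential of a map `φ : N → M`. -/
def push (φ : N → M) (x : N) : TangentSpace (𝓡 m) x →L[ℝ] TangentSpace (𝓡 n) (φ x) :=
  mfderiv (𝓡 m) (𝓡 n) φ x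

/-- The pullback `φ^* W` of a 1-form. -/
def pullForm (φ : N → M) (W : OneForm n M) : OneForm m N :=
  fun x => (W (φ x)).comp (push φ x)

/-- The pullback `φ^* T` of a 2-tensor field. -/
def pullTensor (φ : N → M) (T : TwoTensor n M) : TwoTensor m N :=
  fun x => (ContinuousLinearMap.precomp ℝ (push φ x)).comp ((T (φ x)).comp (push φ x))

variable [IsManifold (𝓡 n) ∞ M] [IsManifold (𝓡 m) ∞ N]

/-- `D` is, on the open set `V ⊆ N`, a smooth covariant derivative on 1-forms of `N` that is
given by pulling back the Levi-Civita derivative of the metric `h`: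
`D_X (φ^* W) = φ^* (∇_X W)` for every 1-form `W` on `M`. In Mathlib's argument order
`D w x X` is `(D_X w)(x)`. -/
structure IsPullbackConnection (h : TwoTensor n M) (φ : N → M) (V : Set N)
    (D : OneForm m N →
      (x : N) → TangentSpace (𝓡 m) x →L[ℝ] TangentSpace (𝓡 m) x →L[ℝ] ℝ) : Prop where
  covariant : IsCovariantDerivativeOn (I := 𝓡 m) (Model m →L[ℝ] ℝ)
    (V := fun x : N => TangentSpace (𝓡 m) x →L[ℝ] ℝ) D V
  smooth : ContMDiffCovariantDerivativeOn (I := 𝓡 m) (Model m →L[ℝ] ℝ)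
    (V := fun x : N => TangentSpace (𝓡 m) x →L[ℝ] ℝ) ∞ D V
  pullback : ∀ x ∈ V, ∀ W : OneForm n M, OneFormDiffAt W (φ x) →
    ∀ X Y : TangentSpace (𝓡 m) x,
      D (pullForm φ W) x X Y = nablaForm h W (φ x) (push φ x X) (push φ x Y)

/-- The pullback connection of the metric `h` is well-defined on `V ⊆ N`: the rule
`D_X (φ^* W) = φ^* (∇_X W)` does give a connection `D` on `V`, and only one. -/
def PullbackConnectionWellDefined (h : TwoTensor n M) (φ : N → M) (V : Set N) : Prop :=
  ∃ D, IsPullbackConnection h φ V D ∧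
    ∀ D', IsPullbackConnection h φ V D' →
      ∀ x ∈ V, ∀ w : OneForm m N, OneFormDiffAt w x → D' w x = D w x

/-- The hypersurface `{u = 0}`, given as the image of the embedding `φ : N → M`, is a regular
null hypersurface: `du ≠ 0` and `g(n, n) = 0` on it, where `n = grad u`. -/
structure IsNullSurface (g : LorentzMetric n M) (u : M → ℝ) (φ : N → M) : Prop where
  embedding : IsSmoothEmbedding (𝓡 m) (𝓡 n) ∞ φ
  range_eq : Set.range φ = {p | u p = 0}
  diff_ne_zero : ∀ x, diff (n := n) u (φ x) ≠ 0
  null : ∀ x, g.val (φ x) (g.grad u (φ x)) (g.grad u (φ x)) = 0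

/-- The conformally rescaled metric `ρ² g`. -/
def conformal (ρ : M → ℝ) (g : TwoTensor n M) : TwoTensor n M := fun p => (ρ p) ^ 2 • g p

/-- `T` is the continuous extension to all of `M` of the tensor field `Ω (R_{ab} - R̃_{ab})`,
defined where `Ω ≠ 0`; here `R̃_{ab}` is the Ricci tensor of `g̃ = Ω⁻² g`. -/
structure IsRicciDifference (g : LorentzMetric n M) (Ω : M → ℝ) (T : TwoTensor n M) :
    Prop where
  continuous : ContinuousTwoTensor T
  eq : ∀ p, Ω p ≠ 0 → ∀ X Y : TangentSpace (𝓡 n) p,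
    T p X Y = Ω p * (ricci g.val p X Y - ricci (conformal (fun p' => (Ω p')⁻¹) g.val) p X Y)

/-- The vector field `ν` on `N` is the restriction of `n = grad u` to the hypersurface. -/
structure IsNormalField (g : LorentzMetric n M) (u : M → ℝ) (φ : N → M) (ν : VField m N) :
    Prop where
  smooth : SmoothVField ν
  push_eq : ∀ x, push (n := n) φ x (ν x) = g.grad u (φ x)

/-- `£_ν q = f q`. -/
def LieProportional (ν : VField m N) (q : TwoTensor m N) (f : N → ℝ) (V : Set N) : Prop :=
  ∀ x ∈ V, ∀ X Y : VField m N, VFieldDiffAt X x → VFieldDiffAt Y x →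
    lieDeriv ν q X Y x = f x * q x (X x) (Y x)

/-- `ρ` is a conformal factor on the open set `U ⊆ M` as used by the conformal pullback method:
a smooth positive function such that `£_n̄ q̄ = 0` on the hypersurface, where `n̄ = ρ⁻¹ n` and
`q̄ = φ^* (ρ² g)`. -/
structure IsKillingFactor (g : LorentzMetric n M) (φ : N → M) (ν : VField m N) (U : Set M)
    (ρ : M → ℝ) : Prop where
  smooth : ContMDiffOn (𝓡 n) 𝓘(ℝ, ℝ) ∞ ρ U
  pos : ∀ p ∈ U, 0 < ρ p
  killing : LieProportional (fun x => (ρ (φ x))⁻¹ • ν x) (pullTensor φ (conformal ρ g.val))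
    (fun _ => 0) (φ ⁻¹' U)

end Submanifold
end NullPullback
end

open NullPullback

/-! Write s = d + 2 for the dimension and ∇∇u for the Hessian of u. Where u ≠ 0, the conformal
transformation law of the Ricci tensor with factor 1/u gives u (R - R̃) = -(s - 2) ∇∇u + c g for an
uncontrolled function c (`ricF_conformal`, `ricF_conformal_inv`). Eliminating c by
cross-multiplication leaves an identity between continuous tensors. Points with u ≠ 0 accumulate at
the hypersurface because du ≠ 0 there, so the identity persists on it
(`IsRicciDifference.proportional`). By the hypothesis on the pullback, for s > 2 the pulled back
Hessian is then a multiple of q. For s = 2 the hypersurface is a null curve, q = 0, and the claim is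
trivial.

Since n is the gradient of u and is tangent to the hypersurface, £_n q is twice the pulled back
Hessian (`lieF_eq_hess`). Hence £_n q = f q, and f is smooth as a quotient by some q(Z, Z) > 0
(`IsNullSurface.exists_hess_eq`).

Because n lies in the kernel of q, only the factor of q is differentiated under rescaling:
£_{n/ω}(ω² q) = (ω f + 2 n(ω)) q. So ω = exp h is admissible as soon as n(h) = -f / 2 on the
hypersurface. Locally this is solved by integrating along integral curves that start on a
transversal hyperplane (`exists_transport`); the smooth dependence of the curves on the end point
comes from the inverse function theorem in a Banach space of paths. On a product one integrates
along the lines (`exists_log_of_product`) and extends ω to M by a partition of unity.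

For an admissible ω the vector ω⁻² n is the gradient of u for ω² g, so the same relation between Lie
derivative and Hessian shows that the Hessian of u for ω² g pulls back to 0. By a Gauss formula, the
pullback of ∇̄_X W evaluated on Y is the coordinate derivative of φ^*W minus W of a vector B(X, Y)
built from the second derivative of φ and the Christoffel symbols (`nablaForm_push`). For W = du
this reads Hessian = -du(B). The vanishing Hessian therefore makes B(X, Y) tangent, and the result
depends on W only through φ^*W (`IsNullSurface.exists_nablaForm_push`). Local retractions extend
forms from the hypersurface, which yields existence, smoothness and uniqueness of the connection. -/

noncomputable section

namespace NullPullback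

/-! ### Levi-Civita calculus for a metric given as a function on a normed space. -/

section Calculus

set_option synthInstance.maxHeartbeats 200000

variable {E F : Type*} [NormedAddCommGroup E] [NormedSpace ℝ E]
  [NormedAddCommGroup F] [NormedSpace ℝ F]

/-- The Christoffel symbols of the first kind (times two) as a linear form. -/
def koszul (G : E → E →L[ℝ] E →L[ℝ] ℝ) (y v w : E) : E →L[ℝ] ℝ :=
  fderiv ℝ G y v w + fderiv ℝ G y w v
    - ((ContinuousLinearMap.apply ℝ ℝ w).comp
      (ContinuousLinearMap.apply ℝ (E →L[ℝ] ℝ) v)).comp (fderiv ℝ G y)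

/-- The Christoffel symbols of the second kind as a vector valued bilinear map. -/
def gam (G : E → E →L[ℝ] E →L[ℝ] ℝ) (y v w : E) : E :=
  (G y).inverse ((1 / 2 : ℝ) • koszul G y v w)

/-- The covariant derivative of a 1-form in the model space. -/
def nab (G : E → E →L[ℝ] E →L[ℝ] ℝ) (W : E → E →L[ℝ] ℝ) (y v w : E) : ℝ :=
  fderiv ℝ W y v w - W y (gam G y v w)

/-- The Lie derivative of a 2-tensor in the model space, on constant vectors. -/
def lieF (ν : E → E) (q : E → E →L[ℝ] E →L[ℝ] ℝ) (y a b : E) : ℝ :=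
  fderiv ℝ q y (ν y) a b + q y (fderiv ℝ ν y a) b + q y a (fderiv ℝ ν y b)

theorem koszul_apply (G : E → E →L[ℝ] E →L[ℝ] ℝ) (y v w z : E) :
    koszul G y v w z = fderiv ℝ G y v w z + fderiv ℝ G y w v z - fderiv ℝ G y z v w := by
  simp [koszul]

theorem isInvertible_apply_inverse {A : E →L[ℝ] F} (h : A.IsInvertible) (x : F) :
    A (A.inverse x) = x := by
  obtain ⟨e, rfl⟩ := h
  simp

theorem isInvertible_inverse_apply {A : E →L[ℝ] F} (h : A.IsInvertible) (x : E) :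
    A.inverse (A x) = x := by
  obtain ⟨e, rfl⟩ := h
  simp

theorem gam_spec {G : E → E →L[ℝ] E →L[ℝ] ℝ} {y : E} (h : (G y).IsInvertible) (v w z : E) :
    2 * G y (gam G y v w) z
      = fderiv ℝ G y v w z + fderiv ℝ G y w v z - fderiv ℝ G y z v w := by
  rw [gam, isInvertible_apply_inverse h, ← koszul_apply]
  simp

/-- Nondegeneracy turns the Koszul formula into a characterisation. Symmetry, the transformation law
and the conformal law of the Christoffel symbols are all proved by verifying this formula, not by
manipulating inverse metrics. -/
theorem eq_gam {G : E → E →L[ℝ] E →L[ℝ] ℝ} {y : E} (h : (G y).IsInvertible) {v w x : E}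
    (hx : ∀ z, 2 * G y x z
      = fderiv ℝ G y v w z + fderiv ℝ G y w v z - fderiv ℝ G y z v w) : x = gam G y v w := by
  rw [← isInvertible_inverse_apply h x, gam]
  congr 1
  ext z
  have := hx z
  simp only [smul_apply, koszul_apply, smul_eq_mul]
  linarith

theorem fderiv_apply₁ {W : E → F →L[ℝ] ℝ} {y : E} (h : DifferentiableAt ℝ W y) (a : E) (v : F) :
    fderiv ℝ (fun x => W x v) y a = fderiv ℝ W y a v := by
  simp [fderiv_clm_apply h (differentiableAt_const v)]

theorem fderiv_apply₂ {G : E → F →L[ℝ] F →L[ℝ] ℝ} {y : E} (h : DifferentiableAt ℝ G y)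
    (a : E) (v w : F) : fderiv ℝ (fun x => G x v w) y a = fderiv ℝ G y a v w := by
  have h1 : DifferentiableAt ℝ (fun x => G x v) y := h.clm_apply (differentiableAt_const v)
  rw [fderiv_clm_apply h1 (differentiableAt_const w), fderiv_clm_apply h (differentiableAt_const v)]
  simp

theorem fderiv_symm₂ {G : E → E →L[ℝ] E →L[ℝ] ℝ} {y : E} (h : DifferentiableAt ℝ G y)
    (hs : ∀ᶠ x in 𝓝 y, ∀ v w, G x v w = G x w v) (a v w : E) :
    fderiv ℝ G y a v w = fderiv ℝ G y a w v := by
  rw [← fderiv_apply₂ h, ← fderiv_apply₂ h]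
  have : (fun x => G x v w) =ᶠ[𝓝 y] fun x => G x w v := hs.mono fun x hx => hx v w
  rw [this.fderiv_eq]

theorem gam_symm {G : E → E →L[ℝ] E →L[ℝ] ℝ} {y : E} (h : DifferentiableAt ℝ G y)
    (hi : (G y).IsInvertible)
    (hs : ∀ᶠ x in 𝓝 y, ∀ v w, G x v w = G x w v) (v w : E) : gam G y v w = gam G y w v := by
  refine eq_gam hi fun z => ?_
  rw [gam_spec hi, fderiv_symm₂ h hs z v w]
  ring

/-- Metric compatibility. -/
theorem fderiv_eq_gam {G : E → E →L[ℝ] E →L[ℝ] ℝ} {y : E} (h : DifferentiableAt ℝ G y)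
    (hi : (G y).IsInvertible)
    (hs : ∀ᶠ x in 𝓝 y, ∀ v w, G x v w = G x w v) (a v w : E) :
    fderiv ℝ G y a v w = G y (gam G y a v) w + G y v (gam G y a w) := by
  have h1 := gam_spec hi a v w
  have h2 := gam_spec hi a w v
  have h3 := fderiv_symm₂ h hs
  have h4 := hs.self_of_nhds
  rw [h3 a w v, h3 w a v] at h2
  rw [h4 v]
  linarith [h3 v a w, h3 w a v]

/-- Product and chain rule. The map ψ need not be a diffeomorphism, since the lemma serves both for
coordinate changes and for the embedding of the hypersurface. -/
theorem fderiv_pull {G : F → F →L[ℝ] F →L[ℝ] ℝ} {G' : E → E →L[ℝ] E →L[ℝ] ℝ} {ψ : E → F} {y : E}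
    (hG : DifferentiableAt ℝ G (ψ y)) (hG' : DifferentiableAt ℝ G' y) (hψ : ContDiffAt ℝ 2 ψ y)
    (h : ∀ᶠ x in 𝓝 y, ∀ v w, G' x v w = G (ψ x) (fderiv ℝ ψ x v) (fderiv ℝ ψ x w)) (a v w : E) :
    fderiv ℝ G' y a v w = fderiv ℝ G (ψ y) (fderiv ℝ ψ y a) (fderiv ℝ ψ y v) (fderiv ℝ ψ y w)
      + G (ψ y) (fderiv ℝ (fderiv ℝ ψ) y a v) (fderiv ℝ ψ y w)
      + G (ψ y) (fderiv ℝ ψ y v) (fderiv ℝ (fderiv ℝ ψ) y a w) := by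
  rw [← fderiv_apply₂ hG']
  have e : (fun x => G' x v w) =ᶠ[𝓝 y]
    fun x => G (ψ x) (fderiv ℝ ψ x v) (fderiv ℝ ψ x w) := h.mono fun x hx => hx v w
  rw [e.fderiv_eq]
  have h1 : DifferentiableAt ℝ ψ y := hψ.differentiableAt (by norm_num)
  have h2 : DifferentiableAt ℝ (fderiv ℝ ψ) y :=
    (hψ.fderiv_right (m := 1) (by norm_num)).differentiableAt (by norm_num)
  have h3 : DifferentiableAt ℝ (fun x => G (ψ x)) y := DifferentiableAt.comp (g := G) y hG h1
  have h4 : ∀ v, DifferentiableAt ℝ (fun x => fderiv ℝ ψ x v) y := fun v =>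
    h2.clm_apply (differentiableAt_const v)
  have h5 : fderiv ℝ (fun x => G (ψ x)) y = (fderiv ℝ G (ψ y)).comp (fderiv ℝ ψ y) :=
    fderiv_comp (g := G) y hG h1
  rw [fderiv_clm_apply (h3.clm_apply (h4 v)) (h4 w), fderiv_clm_apply h3 (h4 v),
    fderiv_clm_apply h2 (differentiableAt_const v), fderiv_clm_apply h2 (differentiableAt_const w),
    h5]
  simp
  ring

theorem fderiv_pull₁ {W : F → F →L[ℝ] ℝ} {W' : E → E →L[ℝ] ℝ} {ψ : E → F} {y : E}
    (hW : DifferentiableAt ℝ W (ψ y)) (hW' : DifferentiableAt ℝ W' y) (hψ : ContDiffAt ℝ 2 ψ y)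
    (h : ∀ᶠ x in 𝓝 y, ∀ v, W' x v = W (ψ x) (fderiv ℝ ψ x v)) (a v : E) :
    fderiv ℝ W' y a v = fderiv ℝ W (ψ y) (fderiv ℝ ψ y a) (fderiv ℝ ψ y v)
      + W (ψ y) (fderiv ℝ (fderiv ℝ ψ) y a v) := by
  rw [← fderiv_apply₁ hW']
  have e : (fun x => W' x v) =ᶠ[𝓝 y]
    fun x => W (ψ x) (fderiv ℝ ψ x v) := h.mono fun x hx => hx v
  rw [e.fderiv_eq]
  have h1 : DifferentiableAt ℝ ψ y := hψ.differentiableAt (by norm_num)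
  have h2 : DifferentiableAt ℝ (fderiv ℝ ψ) y :=
    (hψ.fderiv_right (m := 1) (by norm_num)).differentiableAt (by norm_num)
  have h3 : DifferentiableAt ℝ (fun x => W (ψ x)) y := hW.comp y h1
  have h4 : ∀ v, DifferentiableAt ℝ (fun x => fderiv ℝ ψ x v) y := fun v =>
    h2.clm_apply (differentiableAt_const v)
  have h5 : fderiv ℝ (fun x => W (ψ x)) y = (fderiv ℝ W (ψ y)).comp (fderiv ℝ ψ y) :=
    fderiv_comp y hW h1
  rw [fderiv_clm_apply h3 (h4 v),
    fderiv_clm_apply h2 (differentiableAt_const v), h5]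
  simp
  ring

theorem sndFDeriv_symm {ψ : E → F} {y : E} (hψ : ContDiffAt ℝ 2 ψ y) (a v : E) :
    fderiv ℝ (fderiv ℝ ψ) y a v = fderiv ℝ (fderiv ℝ ψ) y v a :=
  hψ.isSymmSndFDerivAt (by simp) a v

/-- The transformation law of the Christoffel symbols. -/
theorem gam_pull {G : F → F →L[ℝ] F →L[ℝ] ℝ} {G' : E → E →L[ℝ] E →L[ℝ] ℝ} {ψ : E → F} {y : E}
    (hG : DifferentiableAt ℝ G (ψ y)) (hG' : DifferentiableAt ℝ G' y) (hψ : ContDiffAt ℝ 2 ψ y)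
    (h : ∀ᶠ x in 𝓝 y, ∀ v w, G' x v w = G (ψ x) (fderiv ℝ ψ x v) (fderiv ℝ ψ x w))
    (hi : (G (ψ y)).IsInvertible) (hi' : (G' y).IsInvertible)
    (hs : ∀ v w, G (ψ y) v w = G (ψ y) w v)
    (hsurj : Function.Surjective (fderiv ℝ ψ y)) (v w : E) :
    fderiv ℝ ψ y (gam G' y v w)
      = gam G (ψ y) (fderiv ℝ ψ y v) (fderiv ℝ ψ y w) + fderiv ℝ (fderiv ℝ ψ) y v w := by
  rw [← sub_eq_iff_eq_add]
  refine eq_gam hi fun z' => ?_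
  -- Surjectivity allows testing against images only. On these the Koszul formula upstairs applies,
  -- and symmetry of the second derivative of ψ cancels all but one of the second-order terms.
  obtain ⟨z, rfl⟩ := hsurj z'
  have h1 := gam_spec hi' v w z
  rw [h.self_of_nhds, fderiv_pull hG hG' hψ h, fderiv_pull hG hG' hψ h,
    fderiv_pull hG hG' hψ h] at h1
  have h2 := sndFDeriv_symm hψ
  rw [h2 w v, h2 z v, h2 z w, hs (fderiv ℝ ψ y w) (fderiv ℝ (fderiv ℝ ψ) y v z)] at h1
  rw [map_sub, sub_apply]
  linarith

/-- The second derivative of ψ enters once through the derivative of the form and once through the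
Christoffel symbols, with opposite signs. This makes the covariant derivative independent of the
chart. -/
theorem nab_pull {G : F → F →L[ℝ] F →L[ℝ] ℝ} {G' : E → E →L[ℝ] E →L[ℝ] ℝ} {ψ : E → F} {y : E}
    {W : F → F →L[ℝ] ℝ} {W' : E → E →L[ℝ] ℝ}
    (hG : DifferentiableAt ℝ G (ψ y)) (hG' : DifferentiableAt ℝ G' y) (hψ : ContDiffAt ℝ 2 ψ y)
    (h : ∀ᶠ x in 𝓝 y, ∀ v w, G' x v w = G (ψ x) (fderiv ℝ ψ x v) (fderiv ℝ ψ x w))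
    (hi : (G (ψ y)).IsInvertible) (hi' : (G' y).IsInvertible)
    (hs : ∀ v w, G (ψ y) v w = G (ψ y) w v)
    (hsurj : Function.Surjective (fderiv ℝ ψ y))
    (hW : DifferentiableAt ℝ W (ψ y)) (hW' : DifferentiableAt ℝ W' y)
    (hWW : ∀ᶠ x in 𝓝 y, ∀ v, W' x v = W (ψ x) (fderiv ℝ ψ x v)) (v w : E) :
    nab G' W' y v w = nab G W (ψ y) (fderiv ℝ ψ y v) (fderiv ℝ ψ y w) := by
  rw [nab, nab, hWW.self_of_nhds, gam_pull hG hG' hψ h hi hi' hs hsurj,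
    fderiv_pull₁ hW hW' hψ hWW, map_add]
  ring

/-- Differentiates the relation "W is V with its index lowered". The vector field V is only given
along ψ, as is the normal of a hypersurface. -/
theorem fderiv_lowered {G : F → F →L[ℝ] F →L[ℝ] ℝ} {ψ : E → F} {y : E} {V : E → F}
    {W : F → F →L[ℝ] ℝ}
    (hG : DifferentiableAt ℝ G (ψ y)) (hψ : DifferentiableAt ℝ ψ y)
    (hV : DifferentiableAt ℝ V y) (hW : DifferentiableAt ℝ W (ψ y))
    (hVW : ∀ᶠ x in 𝓝 y, G (ψ x) (V x) = W (ψ x)) (a : E) (c : F) :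
    fderiv ℝ G (ψ y) (fderiv ℝ ψ y a) (V y) c + G (ψ y) (fderiv ℝ V y a) c
      = fderiv ℝ W (ψ y) (fderiv ℝ ψ y a) c := by
  have h3 : DifferentiableAt ℝ (fun x => G (ψ x)) y := DifferentiableAt.comp (g := G) y hG hψ
  have h5 : fderiv ℝ (fun x => G (ψ x)) y = (fderiv ℝ G (ψ y)).comp (fderiv ℝ ψ y) :=
    fderiv_comp (g := G) y hG hψ
  have h5' : fderiv ℝ (fun x => W (ψ x)) y = (fderiv ℝ W (ψ y)).comp (fderiv ℝ ψ y) :=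
    fderiv_comp y hW hψ
  have e : (fun x => G (ψ x) (V x)) =ᶠ[𝓝 y] fun x => W (ψ x) := hVW
  have e2 := e.fderiv_eq (𝕜 := ℝ)
  rw [fderiv_clm_apply h3 hV, h5, h5'] at e2
  have e3 := congrArg (fun L => L a c) e2
  simp at e3
  linarith

/-- The Lie derivative of an induced metric along the null normal is twice the Hessian. -/
theorem lieF_eq_hess {G : F → F →L[ℝ] F →L[ℝ] ℝ} {q : E → E →L[ℝ] E →L[ℝ] ℝ} {ψ : E → F} {y : E}
    {ν : E → E} {W : F → F →L[ℝ] ℝ}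
    (hG : DifferentiableAt ℝ G (ψ y)) (hq : DifferentiableAt ℝ q y) (hψ : ContDiffAt ℝ 2 ψ y)
    (h : ∀ᶠ x in 𝓝 y, ∀ v w, q x v w = G (ψ x) (fderiv ℝ ψ x v) (fderiv ℝ ψ x w))
    (hi : (G (ψ y)).IsInvertible)
    (hs : ∀ᶠ x in 𝓝 (ψ y), ∀ v w, G x v w = G x w v)
    (hν : DifferentiableAt ℝ ν y) (hW : DifferentiableAt ℝ W (ψ y))
    (hWs : ∀ a b, fderiv ℝ W (ψ y) a b = fderiv ℝ W (ψ y) b a)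
    (hνW : ∀ᶠ x in 𝓝 y, G (ψ x) (fderiv ℝ ψ x (ν x)) = W (ψ x)) (a b : E) :
    lieF ν q y a b = 2 * nab G W (ψ y) (fderiv ℝ ψ y a) (fderiv ℝ ψ y b) := by
  have h1 : DifferentiableAt ℝ ψ y := hψ.differentiableAt (by norm_num)
  have h2 : DifferentiableAt ℝ (fderiv ℝ ψ) y :=
    (hψ.fderiv_right (m := 1) (by norm_num)).differentiableAt (by norm_num)
  -- This is `fderiv_lowered` for the field Dψ(ν) along ψ. Its derivative has a second-order term,
  -- whose arguments are swapped to match those produced by `fderiv_pull`.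
  have key : ∀ a c, fderiv ℝ G (ψ y) (fderiv ℝ ψ y a) (fderiv ℝ ψ y (ν y)) c
      + (G (ψ y) (fderiv ℝ ψ y (fderiv ℝ ν y a)) c
      + G (ψ y) (fderiv ℝ (fderiv ℝ ψ) y (ν y) a) c) = fderiv ℝ W (ψ y) (fderiv ℝ ψ y a) c := by
    intro a c
    rw [← fderiv_lowered hG h1 (h2.clm_apply hν) hW hνW a c, fderiv_clm_apply h2 hν,
      sndFDeriv_symm hψ (ν y) a]
    simp
  have hsy := hs.self_of_nhds
  have e := fderiv_pull hG hq hψ h (ν y) a b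
  have e1 := h.self_of_nhds (fderiv ℝ ν y a) b
  have e2 := h.self_of_nhds a (fderiv ℝ ν y b)
  have g5 := DFunLike.congr_fun hνW.self_of_nhds
    (gam G (ψ y) (fderiv ℝ ψ y a) (fderiv ℝ ψ y b))
  have k1 := key a (fderiv ℝ ψ y b)
  have k2 := key b (fderiv ℝ ψ y a)
  rw [lieF, nab]
  -- With every vector named, the claim is linear: the second-order terms cancel, and the remaining
  -- three derivatives of G form the Koszul expression for the pairing of Γ(A, B) with N.
  generalize fderiv ℝ ψ y (fderiv ℝ ν y a) = A1 at *
  generalize fderiv ℝ ψ y (fderiv ℝ ν y b) = B1 at *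
  generalize fderiv ℝ (fderiv ℝ ψ) y (ν y) a = A2 at *
  generalize fderiv ℝ (fderiv ℝ ψ) y (ν y) b = B2 at *
  generalize fderiv ℝ ψ y a = A at *
  generalize fderiv ℝ ψ y b = B at *
  generalize fderiv ℝ ψ y (ν y) = N at *
  have g1 := gam_spec hi A B N
  have g3 := fderiv_symm₂ hG hs B A N
  have g2 := fderiv_symm₂ hG hs A B N
  have g4 := hWs A B
  have s1 := hsy N (gam G (ψ y) A B)
  have s2 := hsy A B1
  have s3 := hsy A B2
  linarith

theorem fderiv_smul_apply {s : E → ℝ} {f : E → F} {y : E} (hs : DifferentiableAt ℝ s y)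
    (hf : DifferentiableAt ℝ f y) (a : E) :
    fderiv ℝ (fun x => s x • f x) y a = s y • fderiv ℝ f y a + fderiv ℝ s y a • f y := by
  simp [fderiv_fun_smul hs hf]

/-- Rescaling of the Lie derivative of a degenerate tensor along its kernel. -/
theorem lieF_rescale {q : E → E →L[ℝ] E →L[ℝ] ℝ} {ν : E → E} {y : E} {s t : E → ℝ}
    (hq : DifferentiableAt ℝ q y) (hν : DifferentiableAt ℝ ν y) (hs : DifferentiableAt ℝ s y)
    (ht : DifferentiableAt ℝ t y) (h0 : ∀ a, q y (ν y) a = 0) (h0' : ∀ a, q y a (ν y) = 0)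
    (a b : E) :
    lieF (fun x => s x • ν x) (fun x => t x • q x) y a b
      = s y * t y * lieF ν q y a b + s y * fderiv ℝ t y (ν y) * q y a b := by
  have e1 : fderiv ℝ (fun x => t x • q x) y (s y • ν y)
      = t y • fderiv ℝ q y (s y • ν y) + fderiv ℝ t y (s y • ν y) • q y :=
    fderiv_smul_apply (f := q) ht hq _
  rw [lieF, lieF, e1, fderiv_smul_apply hs hν, fderiv_smul_apply hs hν]
  simp only [smul_apply, add_apply, map_add, map_smul, smul_eq_mul, h0, h0']
  ring

end Calculus

end NullPullback
end

noncomputable section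

namespace NullPullback

theorem two_le_infty : (2 : WithTop ℕ∞) ≤ ∞ := by
  change ((2 : ℕ∞) : WithTop ℕ∞) ≤ ((⊤ : ℕ∞) : WithTop ℕ∞)
  exact WithTop.coe_le_coe.2 le_top

/-! ### Smoothness of the Christoffel symbols and their conformal rescaling. -/

section Conformal

set_option synthInstance.maxHeartbeats 200000

variable {E : Type*} [NormedAddCommGroup E] [NormedSpace ℝ E]

theorem koszul_add_right (G : E → E →L[ℝ] E →L[ℝ] ℝ) (y v w w' : E) :
    koszul G y v (w + w') = koszul G y v w + koszul G y v w' := by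
  ext z; simp only [koszul_apply, map_add, add_apply]; ring

theorem koszul_smul_right (G : E → E →L[ℝ] E →L[ℝ] ℝ) (y v w : E) (c : ℝ) :
    koszul G y v (c • w) = c • koszul G y v w := by
  ext z; simp only [koszul_apply, map_smul, smul_apply, smul_eq_mul]; ring

theorem koszul_add_left (G : E → E →L[ℝ] E →L[ℝ] ℝ) (y v v' w : E) :
    koszul G y (v + v') w = koszul G y v w + koszul G y v' w := by
  ext z; simp only [koszul_apply, map_add, add_apply]; ring

theorem koszul_smul_left (G : E → E →L[ℝ] E →L[ℝ] ℝ) (y v w : E) (c : ℝ) :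
    koszul G y (c • v) w = c • koszul G y v w := by
  ext z; simp only [koszul_apply, map_smul, smul_apply, smul_eq_mul]; ring

/-- The Christoffel symbols at a point as a bilinear map. -/
def gamL (G : E → E →L[ℝ] E →L[ℝ] ℝ) (y : E) : E →ₗ[ℝ] E →ₗ[ℝ] E :=
  LinearMap.mk₂ ℝ (gam G y)
    (fun v v' w => by simp only [gam, koszul_add_left, smul_add, map_add])
    (fun c v w => by
      simp only [gam, koszul_smul_left]
      rw [smul_comm, map_smul])
    (fun v w w' => by simp only [gam, koszul_add_right, smul_add, map_add])
    (fun c v w => by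
      simp only [gam, koszul_smul_right]
      rw [smul_comm, map_smul])

theorem gamL_apply (G : E → E →L[ℝ] E →L[ℝ] ℝ) (y v w : E) : gamL G y v w = gam G y v w := rfl

theorem isInvertible_of_injective [FiniteDimensional ℝ E] {A : E →L[ℝ] E →L[ℝ] ℝ}
    (h : ∀ v, A v = 0 → v = 0) : A.IsInvertible := by
  have hinj : Function.Injective A.toLinearMap :=
    (injective_iff_map_eq_zero A.toLinearMap).2 fun v hv => h v hv
  have hd : Module.finrank ℝ E = Module.finrank ℝ (E →L[ℝ] ℝ) := by
    rw [← LinearMap.toContinuousLinearMap.finrank_eq (R := ℝ) (M := E →ₗ[ℝ] ℝ)]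
    exact Subspace.dual_finrank_eq.symm
  refine ⟨(LinearMap.linearEquivOfInjective A.toLinearMap hinj hd).toContinuousLinearEquiv, ?_⟩
  ext; rfl

theorem injective_of_isInvertible {A : E →L[ℝ] E →L[ℝ] ℝ} (h : A.IsInvertible) {v : E}
    (hv : A v = 0) : v = 0 := by
  obtain ⟨e, rfl⟩ := h
  simpa using hv

theorem isInvertible_smul [FiniteDimensional ℝ E] {A : E →L[ℝ] E →L[ℝ] ℝ} (h : A.IsInvertible)
    {c : ℝ} (hc : c ≠ 0) : (c • A).IsInvertible := by
  refine isInvertible_of_injective fun v hv => injective_of_isInvertible h ?_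
  ext w
  have := DFunLike.congr_fun hv w
  simpa [hc] using this

theorem eventually_isInvertible [CompleteSpace E] {G : E → E →L[ℝ] E →L[ℝ] ℝ} {y : E}
    (hG : ContinuousAt G y) (h : (G y).IsInvertible) : ∀ᶠ x in 𝓝 y, (G x).IsInvertible := by
  obtain ⟨e, he⟩ := h
  have : Set.range ((↑) : (E ≃L[ℝ] E →L[ℝ] ℝ) → E →L[ℝ] E →L[ℝ] ℝ) ∈ 𝓝 (G y) := by
    rw [← he]; exact ContinuousLinearEquiv.nhds e
  exact hG.eventually this

theorem contDiffAt_inverse [CompleteSpace E] {G : E → E →L[ℝ] E →L[ℝ] ℝ} {y : E}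
    (hG : ContDiffAt ℝ ∞ G y) (h : (G y).IsInvertible) :
    ContDiffAt ℝ ∞ (fun x => (G x).inverse) y := by
  obtain ⟨e, he⟩ := h
  have h1 : ContDiffAt ℝ ∞ (ContinuousLinearMap.inverse (R := ℝ) (M := E) (M₂ := E →L[ℝ] ℝ)) (G y) := by
    rw [← he]; exact contDiffAt_map_inverse e
  exact ContDiffAt.comp (g := ContinuousLinearMap.inverse) y h1 hG

theorem contDiffAt_comp_fderiv {H H' : Type*} [NormedAddCommGroup H] [NormedSpace ℝ H]
    [NormedAddCommGroup H'] [NormedSpace ℝ H'] (L : H →L[ℝ] H') {f : E → H} {y : E}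
    (hf : ContDiffAt ℝ ∞ f y) : ContDiffAt ℝ ∞ (fun x => L.comp (fderiv ℝ f x)) y :=
  contDiffAt_const.clm_comp (hf.fderiv_right (by simp))

theorem contDiffAt_fderiv_apply {H : Type*} [NormedAddCommGroup H] [NormedSpace ℝ H]
    {f : E → H} {y : E} (hf : ContDiffAt ℝ ∞ f y) (v : E) :
    ContDiffAt ℝ ∞ (fun x => fderiv ℝ f x v) y :=
  (hf.fderiv_right (m := ∞) (by simp)).clm_apply contDiffAt_const

theorem contDiffAt_koszul {G : E → E →L[ℝ] E →L[ℝ] ℝ} {y : E}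
    (hG : ContDiffAt ℝ ∞ G y) (v w : E) : ContDiffAt ℝ ∞ (fun x => koszul G x v w) y :=
  (((contDiffAt_fderiv_apply hG v).clm_apply contDiffAt_const).add
    ((contDiffAt_fderiv_apply hG w).clm_apply contDiffAt_const)).sub
    (contDiffAt_comp_fderiv _ hG)

theorem contDiffAt_gam [CompleteSpace E] {G : E → E →L[ℝ] E →L[ℝ] ℝ} {y : E}
    (hG : ContDiffAt ℝ ∞ G y) (h : (G y).IsInvertible) (v w : E) :
    ContDiffAt ℝ ∞ (fun x => gam G x v w) y :=
  (contDiffAt_inverse hG h).clm_apply ((contDiffAt_koszul hG v w).const_smul (1 / 2 : ℝ))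

theorem contDiffAt_nab [CompleteSpace E] {G : E → E →L[ℝ] E →L[ℝ] ℝ} {W : E → E →L[ℝ] ℝ} {y : E}
    (hG : ContDiffAt ℝ ∞ G y) (h : (G y).IsInvertible) (hW : ContDiffAt ℝ ∞ W y) (v w : E) :
    ContDiffAt ℝ ∞ (fun x => nab G W x v w) y :=
  ((((hW.fderiv_right (m := ∞) (by simp)).clm_apply contDiffAt_const).clm_apply
    contDiffAt_const)).sub (hW.clm_apply (contDiffAt_gam hG h v w))

/-- The rescaling of the Christoffel symbols under a conformal change of metric. -/
theorem gam_conformal [FiniteDimensional ℝ E] {G : E → E →L[ℝ] E →L[ℝ] ℝ} {ρ : E → ℝ} {y : E}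
    (hG : DifferentiableAt ℝ G y) (hi : (G y).IsInvertible) (hs : ∀ v w, G y v w = G y w v)
    (hρ : DifferentiableAt ℝ ρ y) (h0 : ρ y ≠ 0) (v w : E) :
    gam (fun x => ρ x ^ 2 • G x) y v w = gam G y v w
      + (((ρ y)⁻¹ * fderiv ℝ ρ y v) • w + ((ρ y)⁻¹ * fderiv ℝ ρ y w) • v
        - G y v w • (G y).inverse ((ρ y)⁻¹ • fderiv ℝ ρ y)) := by
  symm
  have hi' : ((fun x => ρ x ^ 2 • G x) y).IsInvertible :=
    isInvertible_smul hi (pow_ne_zero 2 h0)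
  refine eq_gam hi' fun z => ?_
  have e1 : ∀ a, fderiv ℝ (fun x => ρ x ^ 2 • G x) y a
      = ρ y ^ 2 • fderiv ℝ G y a + fderiv ℝ (fun x => ρ x ^ 2) y a • G y := fun a =>
    fderiv_smul_apply (f := G) (hρ.pow 2) hG a
  have e2 : ∀ a, fderiv ℝ (fun x => ρ x ^ 2) y a = 2 * ρ y * fderiv ℝ ρ y a := fun a => by
    rw [fderiv_fun_pow 2 hρ]; simp
  have g := gam_spec hi v w z
  have g2 : G y ((G y).inverse (fderiv ℝ ρ y)) z = fderiv ℝ ρ y z := by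
    rw [isInvertible_apply_inverse hi]
  simp only [e1, e2, smul_apply, add_apply, smul_eq_mul, map_add, map_sub, map_smul, sub_apply, g2]
  rw [hs w z]
  field_simp
  linear_combination ρ y * g

end Conformal

/-! ### The Ricci tensor under a conformal change. -/

section Ricci

set_option synthInstance.maxHeartbeats 200000

variable {n : ℕ}

/-- The trace of a map of the model space. -/
def trc (f : Model n → Model n) : ℝ := ∑ k, f (EuclideanSpace.single k (1 : ℝ)) k

theorem trc_add (f g : Model n → Model n) : trc (fun v => f v + g v) = trc f + trc g := by
  simp [trc, Finset.sum_add_distrib]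

theorem trc_smul (c : ℝ) (f : Model n → Model n) : trc (fun v => c • f v) = c * trc f := by
  simp [trc, Finset.mul_sum]

theorem trc_id : trc (fun v : Model n => v) = n := by
  simp [trc]

theorem fderiv_conf {E F : Type*} [NormedAddCommGroup E] [NormedSpace ℝ E]
    [NormedAddCommGroup F] [NormedSpace ℝ F] {f s : E → F} {α β γ : E → ℝ} {a b : F} {y v : E}
    (hf : DifferentiableAt ℝ f y) (hα : DifferentiableAt ℝ α y) (hβ : DifferentiableAt ℝ β y)
    (hγ : DifferentiableAt ℝ γ y) (hs : DifferentiableAt ℝ s y) :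
    fderiv ℝ (fun x => f x + (α x • b + β x • a - γ x • s x)) y v
      = fderiv ℝ f y v + (fderiv ℝ α y v • b + fderiv ℝ β y v • a
        - (γ y • fderiv ℝ s y v + fderiv ℝ γ y v • s y)) := by
  have h := hf.hasFDerivAt.add (((hα.hasFDerivAt.smul_const b).add
    (hβ.hasFDerivAt.smul_const a)).sub (hγ.hasFDerivAt.smul hs.hasFDerivAt))
  have := congrArg (fun L => L v) h.fderiv
  simp only [add_apply, sub_apply, ContinuousLinearMap.smulRight_apply, smul_apply] at this
  exact this

/-- Every contraction in the conformal Ricci formula is the trace of a rank-one map, apart from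
those of the identity and of the covariant derivative of the gradient s. -/
theorem trc_smulRight {f : Model n → ℝ} (hf : IsLinearMap ℝ f) (x : Model n) :
    trc (fun v => f v • x) = f x := by
  obtain ⟨l, rfl⟩ : ∃ l : Model n →ₗ[ℝ] ℝ, ⇑l = f := ⟨hf.mk' f, rfl⟩
  have hx : x = ∑ k, x k • EuclideanSpace.single k (1 : ℝ) := by
    ext i
    simp [Pi.single_apply]
  conv_rhs => rw [hx]
  simp [trc, map_sum, mul_comm]

/-- The Ricci tensor of a connection in the model space. -/
def ricF (Γ : Model n → Model n → Model n → Model n) (y a b : Model n) : ℝ :=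
  trc fun v => fderiv ℝ (fun x => Γ x a b) y v - fderiv ℝ (fun x => Γ x a v) y b
    + Γ y v (Γ y a b) - Γ y b (Γ y a v)

/-- The Ricci tensor under a conformal change of metric, up to multiples of the metric. -/
theorem ricF_conformal {G : Model n → Model n →L[ℝ] Model n →L[ℝ] ℝ} {ρ : Model n → ℝ}
    {y : Model n}
    (hG : ContDiffAt ℝ ∞ G y) (hi : (G y).IsInvertible)
    (hs : ∀ᶠ x in 𝓝 y, ∀ v w, G x v w = G x w v)
    (hρ : ContDiffAt ℝ ∞ ρ y) (h0 : ρ y ≠ 0) : ∃ c : ℝ, ∀ a b,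
    ricF (gam fun x => ρ x ^ 2 • G x) y a b = ricF (gam G) y a b
      + (n - 2) * ((ρ y)⁻¹ * fderiv ℝ ρ y a * ((ρ y)⁻¹ * fderiv ℝ ρ y b)
        - nab G (fun x => (ρ x)⁻¹ • fderiv ℝ ρ x) y b a) + c * G y a b := by
  -- σ is the differential of log |ρ| and s is its gradient. The change of Γ is then σ ⊗ id + id ⊗ σ
  -- - G ⊗ s.
  set σ : Model n → Model n →L[ℝ] ℝ := fun x => (ρ x)⁻¹ • fderiv ℝ ρ x with hσ
  set s : Model n → Model n := fun x => (G x).inverse (σ x) with hs_def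
  have dG : DifferentiableAt ℝ G y := hG.differentiableAt (by simp)
  have cσ : ContDiffAt ℝ ∞ σ y := (hρ.inv h0).smul (hρ.fderiv_right (by simp))
  have dσ : DifferentiableAt ℝ σ y := cσ.differentiableAt (by simp)
  have ds : DifferentiableAt ℝ s y :=
    ((contDiffAt_inverse hG hi).clm_apply cσ).differentiableAt (by simp)
  -- The law is needed on a neighbourhood, because the Ricci tensor differentiates Γ.
  have ev : ∀ᶠ x in 𝓝 y, ∀ a b, gam (fun x => ρ x ^ 2 • G x) x a b
      = gam G x a b + (σ x a • b + σ x b • a - G x a b • s x) := by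
    filter_upwards [eventually_isInvertible hG.continuousAt hi, hs,
      hρ.continuousAt.eventually_ne h0,
      (hG.of_le (m := 1) (by simp)).eventually (by simp),
      (hρ.of_le (m := 1) (by simp)).eventually (by simp)] with x h1 h2 h3 h4 h5 a b
    exact gam_conformal (h4.differentiableAt (by simp)) h1 h2 (h5.differentiableAt (by simp)) h3 a b
  have dC : ∀ a b v, fderiv ℝ (fun x => gam (fun x => ρ x ^ 2 • G x) x a b) y v
      = fderiv ℝ (fun x => gam G x a b) y v + (fderiv ℝ σ y v a • b + fderiv ℝ σ y v b • a
        - (G y a b • fderiv ℝ s y v + fderiv ℝ G y v a b • s y)) := by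
    intro a b v
    have e : (fun x => gam (fun x => ρ x ^ 2 • G x) x a b) =ᶠ[𝓝 y]
      fun x => gam G x a b + (σ x a • b + σ x b • a - G x a b • s x) := ev.mono fun x hx => hx a b
    have d1 : DifferentiableAt ℝ (fun x => gam G x a b) y :=
      (contDiffAt_gam hG hi a b).differentiableAt (by simp)
    have d2 : ∀ a, DifferentiableAt ℝ (fun x => σ x a) y := fun a =>
      dσ.clm_apply (differentiableAt_const a)
    have d3 : DifferentiableAt ℝ (fun x => G x a b) y :=
      (dG.clm_apply (differentiableAt_const a)).clm_apply (differentiableAt_const b)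
    rw [e.fderiv_eq, fderiv_conf d1 (d2 a) (d2 b) d3 ds, fderiv_apply₁ dσ, fderiv_apply₁ dσ,
      fderiv_apply₂ dG]
  have hsy := hs.self_of_nhds
  have hgs := gam_symm dG hi hs
  have hGs : ∀ z, G y (s y) z = σ y z := fun z => by
    rw [hs_def, isInvertible_apply_inverse hi]
  have hDs : ∀ b a, fderiv ℝ G y b (s y) a + G y (fderiv ℝ s y b) a = fderiv ℝ σ y b a := by
    intro b a
    have e := fderiv_lowered (ψ := fun x : Model n => x) (V := s) (W := σ) dG
      differentiableAt_fun_id ds dσ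
      ((eventually_isInvertible hG.continuousAt hi).mono fun x hx =>
        isInvertible_apply_inverse hx _) b a
    simpa using e
  have hDσ : ∀ a b, fderiv ℝ σ y a b = fderiv ℝ σ y b a := by
    intro a b
    have h2 : DifferentiableAt ℝ (fderiv ℝ ρ) y :=
      (hρ.fderiv_right (m := ∞) (by simp)).differentiableAt (by simp)
    have h3 : DifferentiableAt ℝ (fun x => (ρ x)⁻¹) y :=
      (hρ.inv h0).differentiableAt (by simp)
    have h4 : DifferentiableAt ℝ ρ y := hρ.differentiableAt (by simp)
    have h5 := ((hasDerivAt_inv h0).comp_hasFDerivAt y h4.hasFDerivAt).fderiv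
    change fderiv ℝ (fun x => (ρ x)⁻¹) y = _ at h5
    rw [hσ, fderiv_smul_apply h3 h2, fderiv_smul_apply h3 h2, h5]
    have := sndFDeriv_symm (hρ.of_le (m := 2) two_le_infty) a b
    simp only [add_apply, smul_apply, this, smul_eq_mul]
    ring
  have hc := fderiv_eq_gam dG hi hs
  have hbil := gamL_apply G y
  -- The coefficient of G in the classical formula: minus the divergence of s, minus (n - 2) times
  -- the squared length of σ.
  refine ⟨trc (fun v => fderiv ℝ s y v + gam G y v (s y)) * (-1) - (n - 2) * σ y (s y),
    fun a b => ?_⟩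
  have hC := ev.self_of_nhds
  -- The endomorphism whose trace is the new Ricci tensor is sorted into the old one, maps with a
  -- fixed direction b, s or ∇_b s, a multiple of the identity, and a multiple of ∇s. Each piece has
  -- a known trace or goes into c.
  have key : ∀ v, (fderiv ℝ (fun x => gam (fun x => ρ x ^ 2 • G x) x a b) y v
      - fderiv ℝ (fun x => gam (fun x => ρ x ^ 2 • G x) x a v) y b
      + gam (fun x => ρ x ^ 2 • G x) y v (gam (fun x => ρ x ^ 2 • G x) y a b)
      - gam (fun x => ρ x ^ 2 • G x) y b (gam (fun x => ρ x ^ 2 • G x) y a v))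
      = (fderiv ℝ (fun x => gam G x a b) y v - fderiv ℝ (fun x => gam G x a v) y b
        + gam G y v (gam G y a b) - gam G y b (gam G y a v))
      + ((fderiv ℝ σ y v a - σ y (gam G y a v) - σ y a * σ y v + G y a v * σ y (s y)) • b
      + ((σ y v * G y a b - σ y b * G y a v) • s y
      + ((- fderiv ℝ σ y b a + σ y (gam G y a b) + σ y a * σ y b - G y a b * σ y (s y)) • v
      + (G y a v • (fderiv ℝ s y b + gam G y b (s y))
      + (-G y a b) • (fderiv ℝ s y v + gam G y v (s y)))))) := by
    intro v
    -- This is the coefficient of s coming from the derivative of G. It vanishes because G is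
    -- parallel, which makes ∇_b G (a, v) and ∇_v G (a, b) equal.
    have L : -fderiv ℝ G y v a b + fderiv ℝ G y b a v - G y v (gam G y a b)
        + G y b (gam G y a v) = 0 := by
      rw [hc v a b, hc b a v, hgs v a, hgs b a, hgs v b, hsy (gam G y a v) b,
        hsy (gam G y a b) v]
      ring
    rw [dC, dC, hC, hC, hC, hC]
    simp only [← hbil, map_add, map_sub, map_smul]
    simp only [hbil]
    rw [hgs v b, hgs v a, hgs b a, hDσ v b, hsy v b, hsy b a, hsy v a, hsy v (s y), hsy b (s y),
      hGs v, hGs b]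
    linear_combination (norm := module) L • s y
  have l1 : trc (fun v => (fderiv ℝ σ y v a - σ y (gam G y a v) - σ y a * σ y v
      + G y a v * σ y (s y)) • b) = fderiv ℝ σ y b a - σ y (gam G y a b) - σ y a * σ y b
      + G y a b * σ y (s y) :=
    trc_smulRight ⟨fun v w => by simp only [← hbil, map_add, add_apply]; ring,
      fun c v => by simp only [← hbil, map_smul, smul_apply, smul_eq_mul]; ring⟩ b
  have l2 : trc (fun v => (σ y v * G y a b - σ y b * G y a v) • s y)
      = σ y (s y) * G y a b - σ y b * G y a (s y) :=
    trc_smulRight ⟨fun v w => by simp only [map_add]; ring,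
      fun c v => by simp only [map_smul, smul_eq_mul]; ring⟩ (s y)
  have l3 : trc (fun v => G y a v • (fderiv ℝ s y b + gam G y b (s y)))
      = G y a (fderiv ℝ s y b + gam G y b (s y)) :=
    trc_smulRight ⟨fun v w => by simp only [map_add],
      fun c v => by simp only [map_smul]⟩ _
  rw [ricF, ricF, funext key, trc_add, trc_add, trc_add, trc_add, trc_add, l1, l2, l3, trc_smul,
    trc_smul, trc_id, nab, hgs b a, map_add]
  have m1 := hDs b a
  have m2 := hc b (s y) a
  rw [hGs, hgs b a] at m2
  rw [hsy a (s y), hGs, hsy a (fderiv ℝ s y b), hsy a (gam G y b (s y))]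
  have m3 : ∀ a, σ y a = (ρ y)⁻¹ * fderiv ℝ ρ y a := fun a => by simp [hσ]
  rw [← m3, ← m3]
  linear_combination m1 - m2

end Ricci

end NullPullback
end

noncomputable section

namespace NullPullback

/-! ### Tensor fields, forms and vector fields read in a chart. -/

section Coordinates

set_option synthInstance.maxHeartbeats 200000

variable {n : ℕ} {M : Type*} [TopologicalSpace M] [ChartedSpace (Model n) M]

/-- The coordinate frame at the point with coordinates `y`. -/
def fr (c : M) (y : Model n) : Model n →L[ℝ] TangentSpace (𝓡 n) ((extChartAt (𝓡 n) c).symm y) :=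
  (mfderiv 𝓘(ℝ, Model n) (𝓡 n) (extChartAt (𝓡 n) c).symm y).comp
    (NormedSpace.fromTangentSpace y).symm.toContinuousLinearMap

/-- The coordinates of a tangent vector. -/
def cofr (c p : M) : TangentSpace (𝓡 n) p →L[ℝ] Model n :=
  (NormedSpace.fromTangentSpace (extChartAt (𝓡 n) c p)).toContinuousLinearMap.comp
    (mfderiv (𝓡 n) 𝓘(ℝ, Model n) (extChartAt (𝓡 n) c) p)

/-- The coordinate expression of a 2-tensor field. -/
def tens (T : TwoTensor n M) (c : M) (y : Model n) : Model n →L[ℝ] Model n →L[ℝ] ℝ :=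
  (ContinuousLinearMap.precomp ℝ (fr c y)).comp ((T ((extChartAt (𝓡 n) c).symm y)).comp (fr c y))

/-- The coordinate expression of a 1-form. -/
def form (W : OneForm n M) (c : M) (y : Model n) : Model n →L[ℝ] ℝ :=
  (W ((extChartAt (𝓡 n) c).symm y)).comp (fr c y)

/-- The coordinate expression of a vector field. -/
def vec (X : VField n M) (c : M) (y : Model n) : Model n :=
  cofr c ((extChartAt (𝓡 n) c).symm y) (X ((extChartAt (𝓡 n) c).symm y))

theorem tens_apply (T : TwoTensor n M) (c : M) (y v w : Model n) :
    tens T c y v w = T ((extChartAt (𝓡 n) c).symm y) (fr c y v) (fr c y w) := rfl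

theorem form_apply (W : OneForm n M) (c : M) (y v : Model n) :
    form W c y v = W ((extChartAt (𝓡 n) c).symm y) (fr c y v) := rfl

/-- Presenting a point as `symm y` and substituting avoids rewriting the base point inside tangent
space types. -/
theorem exists_coord {c p : M} (hp : p ∈ (extChartAt (𝓡 n) c).source) :
    ∃ y ∈ (extChartAt (𝓡 n) c).target, (extChartAt (𝓡 n) c).symm y = p :=
  ⟨_, (extChartAt (𝓡 n) c).map_source hp, (extChartAt (𝓡 n) c).left_inv hp⟩

theorem target_mem_nhds' {c : M} {y : Model n} (hy : y ∈ (extChartAt (𝓡 n) c).target) :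
    (extChartAt (𝓡 n) c).target ∈ 𝓝 y :=
  (isOpen_extChartAt_target c).mem_nhds hy

theorem source_mem_nhds' {c p : M} (hp : p ∈ (extChartAt (𝓡 n) c).source) :
    (extChartAt (𝓡 n) c).source ∈ 𝓝 p :=
  (isOpen_extChartAt_source c).mem_nhds hp

theorem nhds_eq_map_symm {c : M} {y : Model n} (hy : y ∈ (extChartAt (𝓡 n) c).target) :
    Filter.map (extChartAt (𝓡 n) c).symm (𝓝 y) = 𝓝 ((extChartAt (𝓡 n) c).symm y) := by
  have h1 := (extChartAt (𝓡 n) c).map_target hy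
  have h := map_extChartAt_symm_nhdsWithin_range' (I := 𝓡 n) h1
  rwa [(extChartAt (𝓡 n) c).right_inv hy, ModelWithCorners.range_eq_univ, nhdsWithin_univ] at h

theorem tendsto_symm' {c : M} {y : Model n} (hy : y ∈ (extChartAt (𝓡 n) c).target) :
    Filter.Tendsto (extChartAt (𝓡 n) c).symm (𝓝 y) (𝓝 ((extChartAt (𝓡 n) c).symm y)) :=
  (nhds_eq_map_symm hy).le

theorem continuousAt_iff_coord {H : Type*} [TopologicalSpace H] {f : M → H} {c : M} {y : Model n}
    (hy : y ∈ (extChartAt (𝓡 n) c).target) :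
    ContinuousAt f ((extChartAt (𝓡 n) c).symm y)
      ↔ ContinuousAt (fun z => f ((extChartAt (𝓡 n) c).symm z)) y := by
  rw [ContinuousAt, ← nhds_eq_map_symm hy, Filter.tendsto_map'_iff]
  rfl

variable [IsManifold (𝓡 n) ∞ M]

theorem contMDiffAt_iff_coord {H : Type*} [NormedAddCommGroup H] [NormedSpace ℝ H] {f : M → H}
    {c : M} {y : Model n} (hy : y ∈ (extChartAt (𝓡 n) c).target) :
    ContMDiffAt (𝓡 n) 𝓘(ℝ, H) ∞ f ((extChartAt (𝓡 n) c).symm y)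
      ↔ ContDiffAt ℝ ∞ (fun z => f ((extChartAt (𝓡 n) c).symm z)) y := by
  have h1 := (extChartAt (𝓡 n) c).map_target hy
  rw [extChartAt_source] at h1
  rw [contMDiffAt_iff_source_of_mem_source h1, (extChartAt (𝓡 n) c).right_inv hy,
    ModelWithCorners.range_eq_univ, contMDiffWithinAt_univ, contMDiffAt_iff_contDiffAt]
  rfl

theorem mdifferentiableAt_iff_coord {H : Type*} [NormedAddCommGroup H] [NormedSpace ℝ H]
    {f : M → H} {c : M} {y : Model n} (hy : y ∈ (extChartAt (𝓡 n) c).target) :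
    MDifferentiableAt (𝓡 n) 𝓘(ℝ, H) f ((extChartAt (𝓡 n) c).symm y)
      ↔ DifferentiableAt ℝ (fun z => f ((extChartAt (𝓡 n) c).symm z)) y := by
  have : IsManifold (𝓡 n) 1 M := IsManifold.of_le (n := ∞) (by simp)
  have h1 := (extChartAt (𝓡 n) c).map_target hy
  rw [extChartAt_source] at h1
  rw [mdifferentiableAt_iff_source_of_mem_source h1, (extChartAt (𝓡 n) c).right_inv hy,
    ModelWithCorners.range_eq_univ, mdifferentiableWithinAt_univ,
    mdifferentiableAt_iff_differentiableAt]
  rfl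

theorem cofr_fr {c : M} {y : Model n} (hy : y ∈ (extChartAt (𝓡 n) c).target) (v : Model n) :
    cofr c ((extChartAt (𝓡 n) c).symm y) (fr c y v) = v := by
  have : IsManifold (𝓡 n) 1 M := IsManifold.of_le (n := ∞) (by simp)
  have h := mfderiv_extChartAt_comp_mfderivWithin_extChartAt_symm (I := 𝓡 n) hy
  rw [ModelWithCorners.range_eq_univ, mfderivWithin_univ] at h
  exact DFunLike.congr_fun h v

theorem fr_cofr {c : M} {y : Model n} (hy : y ∈ (extChartAt (𝓡 n) c).target)
    (X : TangentSpace (𝓡 n) ((extChartAt (𝓡 n) c).symm y)) :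
    fr c y (cofr c ((extChartAt (𝓡 n) c).symm y) X) = X := by
  have : IsManifold (𝓡 n) 1 M := IsManifold.of_le (n := ∞) (by simp)
  have h := mfderivWithin_extChartAt_symm_comp_mfderiv_extChartAt (I := 𝓡 n) hy
  rw [ModelWithCorners.range_eq_univ, mfderivWithin_univ] at h
  exact DFunLike.congr_fun h X

theorem trivializationAt_tangent {c p : M} (hp : p ∈ (extChartAt (𝓡 n) c).source)
    (X : TangentSpace (𝓡 n) p) :
    (trivializationAt (Model n) (TangentSpace (𝓡 n)) c ⟨p, X⟩).2 = cofr c p X := by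
  rw [extChartAt_source] at hp
  have h := TangentBundle.continuousLinearMapAt_trivializationAt (I := 𝓡 n) hp
  have h2 := DFunLike.congr_fun h X
  rw [Trivialization.continuousLinearMapAt_apply, Trivialization.coe_linearMapAt_of_mem _ hp] at h2
  exact h2

theorem symmL_eq_fr {c : M} {y : Model n} (hy : y ∈ (extChartAt (𝓡 n) c).target) (v : Model n) :
    (trivializationAt (Model n) (TangentSpace (𝓡 n)) c).symmL ℝ ((extChartAt (𝓡 n) c).symm y) v
      = fr c y v := by
  have h1 := (extChartAt (𝓡 n) c).map_target hy
  rw [extChartAt_source] at h1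
  have h3 := TangentBundle.symmL_trivializationAt (I := 𝓡 n) h1
  rw [ModelWithCorners.range_eq_univ, mfderivWithin_univ, (extChartAt (𝓡 n) c).right_inv hy] at h3
  exact DFunLike.congr_fun h3 v

/-- A hom bundle is trivialised by composing with the inverse of the tangent trivialisation, which
is the coordinate frame. So regularity of a section means regularity of its components. -/
theorem trivializationAt_form {c : M} {y : Model n} (hy : y ∈ (extChartAt (𝓡 n) c).target)
    (w : TangentSpace (𝓡 n) ((extChartAt (𝓡 n) c).symm y) →L[ℝ] ℝ) (v : Model n) :
    (trivializationAt (Model n →L[ℝ] ℝ) (fun p : M => TangentSpace (𝓡 n) p →L[ℝ] ℝ) c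
      ⟨(extChartAt (𝓡 n) c).symm y, w⟩).2 v = w (fr c y v) := by
  rw [hom_trivializationAt_apply, ContinuousLinearMap.inCoordinates, ← symmL_eq_fr hy]
  change Trivialization.continuousLinearMapAt ℝ (Bundle.Trivial.trivialization M ℝ) _ _ = _
  rw [Bundle.Trivial.continuousLinearMapAt_trivialization]
  rfl

theorem trivializationAt_tensor {c : M} {y : Model n} (hy : y ∈ (extChartAt (𝓡 n) c).target)
    (w : TangentSpace (𝓡 n) ((extChartAt (𝓡 n) c).symm y) →L[ℝ]
      TangentSpace (𝓡 n) ((extChartAt (𝓡 n) c).symm y) →L[ℝ] ℝ) (v v' : Model n) :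
    (trivializationAt (Model n →L[ℝ] Model n →L[ℝ] ℝ)
      (fun p : M => TangentSpace (𝓡 n) p →L[ℝ] TangentSpace (𝓡 n) p →L[ℝ] ℝ) c
      ⟨(extChartAt (𝓡 n) c).symm y, w⟩).2 v v' = w (fr c y v) (fr c y v') := by
  have h1 := (extChartAt (𝓡 n) c).map_target hy
  rw [extChartAt_source] at h1
  have h2 : (extChartAt (𝓡 n) c).symm y ∈ (trivializationAt (Model n →L[ℝ] ℝ)
    (fun p : M => TangentSpace (𝓡 n) p →L[ℝ] ℝ) c).baseSet := by
    rw [hom_trivializationAt_baseSet]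
    exact ⟨h1, by simp⟩
  rw [hom_trivializationAt_apply, ContinuousLinearMap.inCoordinates]
  simp only [ContinuousLinearMap.comp_apply]
  rw [symmL_eq_fr hy, ← trivializationAt_form hy]
  rw [Trivialization.continuousLinearMapAt_apply, Trivialization.coe_linearMapAt_of_mem _ h2]

theorem mem_baseSet_tangent {c p : M} (hp : p ∈ (extChartAt (𝓡 n) c).source) :
    p ∈ (trivializationAt (Model n) (TangentSpace (𝓡 n)) c).baseSet := by
  rwa [extChartAt_source] at hp

theorem mem_baseSet_form {c p : M} (hp : p ∈ (extChartAt (𝓡 n) c).source) :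
    p ∈ (trivializationAt (Model n →L[ℝ] ℝ)
      (fun p : M => TangentSpace (𝓡 n) p →L[ℝ] ℝ) c).baseSet := by
  rw [hom_trivializationAt_baseSet]
  exact ⟨mem_baseSet_tangent hp, by simp⟩

theorem mem_baseSet_tensor {c p : M} (hp : p ∈ (extChartAt (𝓡 n) c).source) :
    p ∈ (trivializationAt (Model n →L[ℝ] Model n →L[ℝ] ℝ)
      (fun p : M => TangentSpace (𝓡 n) p →L[ℝ] TangentSpace (𝓡 n) p →L[ℝ] ℝ) c).baseSet := by
  rw [hom_trivializationAt_baseSet]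
  exact ⟨mem_baseSet_tangent hp, mem_baseSet_form hp⟩

theorem trivializationAt_tensor_eq (T : TwoTensor n M) {c : M} {y : Model n}
    (hy : y ∈ (extChartAt (𝓡 n) c).target) :
    (fun z => (trivializationAt (Model n →L[ℝ] Model n →L[ℝ] ℝ)
      (fun p : M => TangentSpace (𝓡 n) p →L[ℝ] TangentSpace (𝓡 n) p →L[ℝ] ℝ) c
      ⟨(extChartAt (𝓡 n) c).symm z, T ((extChartAt (𝓡 n) c).symm z)⟩).2) =ᶠ[𝓝 y] tens T c := by
  filter_upwards [target_mem_nhds' hy] with z hz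
  ext v w
  exact trivializationAt_tensor hz _ v w

theorem trivializationAt_form_eq (W : OneForm n M) {c : M} {y : Model n}
    (hy : y ∈ (extChartAt (𝓡 n) c).target) :
    (fun z => (trivializationAt (Model n →L[ℝ] ℝ)
      (fun p : M => TangentSpace (𝓡 n) p →L[ℝ] ℝ) c
      ⟨(extChartAt (𝓡 n) c).symm z, W ((extChartAt (𝓡 n) c).symm z)⟩).2) =ᶠ[𝓝 y] form W c := by
  filter_upwards [target_mem_nhds' hy] with z hz
  ext v
  exact trivializationAt_form hz _ v

theorem trivializationAt_vec_eq (X : VField n M) {c : M} {y : Model n}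
    (hy : y ∈ (extChartAt (𝓡 n) c).target) :
    (fun z => (trivializationAt (Model n) (TangentSpace (𝓡 n)) c
      ⟨(extChartAt (𝓡 n) c).symm z, X ((extChartAt (𝓡 n) c).symm z)⟩).2) =ᶠ[𝓝 y] vec X c := by
  filter_upwards [target_mem_nhds' hy] with z hz
  exact trivializationAt_tangent ((extChartAt (𝓡 n) c).map_target hz) _

theorem contMDiffAt_tensor_iff (T : TwoTensor n M) {c : M} {y : Model n}
    (hy : y ∈ (extChartAt (𝓡 n) c).target) :
    ContMDiffAt (𝓡 n) ((𝓡 n).prod 𝓘(ℝ, Model n →L[ℝ] Model n →L[ℝ] ℝ)) ∞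
      (fun p => TotalSpace.mk' (Model n →L[ℝ] Model n →L[ℝ] ℝ) p (T p))
      ((extChartAt (𝓡 n) c).symm y) ↔ ContDiffAt ℝ ∞ (tens T c) y := by
  refine ((trivializationAt (Model n →L[ℝ] Model n →L[ℝ] ℝ)
      (fun p : M => TangentSpace (𝓡 n) p →L[ℝ] TangentSpace (𝓡 n) p →L[ℝ] ℝ)
      c).contMDiffAt_section_iff
    (mem_baseSet_tensor ((extChartAt (𝓡 n) c).map_target hy))).trans ?_
  rw [contMDiffAt_iff_coord hy]
  exact ⟨fun h => h.congr_of_eventuallyEq (trivializationAt_tensor_eq T hy).symm,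
    fun h => h.congr_of_eventuallyEq (trivializationAt_tensor_eq T hy)⟩

theorem contMDiffAt_form_iff (W : OneForm n M) {c : M} {y : Model n}
    (hy : y ∈ (extChartAt (𝓡 n) c).target) :
    ContMDiffAt (𝓡 n) ((𝓡 n).prod 𝓘(ℝ, Model n →L[ℝ] ℝ)) ∞
      (fun p => TotalSpace.mk' (Model n →L[ℝ] ℝ) p (W p))
      ((extChartAt (𝓡 n) c).symm y) ↔ ContDiffAt ℝ ∞ (form W c) y := by
  rw [Bundle.Trivialization.contMDiffAt_section_iff _
    (mem_baseSet_form ((extChartAt (𝓡 n) c).map_target hy)), contMDiffAt_iff_coord hy]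
  exact ⟨fun h => h.congr_of_eventuallyEq (trivializationAt_form_eq W hy).symm,
    fun h => h.congr_of_eventuallyEq (trivializationAt_form_eq W hy)⟩

theorem contMDiffAt_vec_iff (X : VField n M) {c : M} {y : Model n}
    (hy : y ∈ (extChartAt (𝓡 n) c).target) :
    ContMDiffAt (𝓡 n) ((𝓡 n).prod 𝓘(ℝ, Model n)) ∞
      (fun p => TotalSpace.mk' (Model n) p (X p))
      ((extChartAt (𝓡 n) c).symm y) ↔ ContDiffAt ℝ ∞ (vec X c) y := by
  rw [Bundle.Trivialization.contMDiffAt_section_iff _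
    (mem_baseSet_tangent ((extChartAt (𝓡 n) c).map_target hy)), contMDiffAt_iff_coord hy]
  exact ⟨fun h => h.congr_of_eventuallyEq (trivializationAt_vec_eq X hy).symm,
    fun h => h.congr_of_eventuallyEq (trivializationAt_vec_eq X hy)⟩

theorem oneFormDiffAt_iff (W : OneForm n M) {c : M} {y : Model n}
    (hy : y ∈ (extChartAt (𝓡 n) c).target) :
    OneFormDiffAt W ((extChartAt (𝓡 n) c).symm y) ↔ DifferentiableAt ℝ (form W c) y := by
  have : IsManifold (𝓡 n) 1 M := IsManifold.of_le (n := ∞) (by simp)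
  rw [OneFormDiffAt, Bundle.Trivialization.mdifferentiableAt_section_iff (𝓡 n) _ _
    (mem_baseSet_form ((extChartAt (𝓡 n) c).map_target hy)), mdifferentiableAt_iff_coord hy]
  exact (trivializationAt_form_eq W hy).differentiableAt_iff

theorem vFieldDiffAt_iff (X : VField n M) {c : M} {y : Model n}
    (hy : y ∈ (extChartAt (𝓡 n) c).target) :
    VFieldDiffAt X ((extChartAt (𝓡 n) c).symm y) ↔ DifferentiableAt ℝ (vec X c) y := by
  have : IsManifold (𝓡 n) 1 M := IsManifold.of_le (n := ∞) (by simp)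
  rw [VFieldDiffAt, Bundle.Trivialization.mdifferentiableAt_section_iff (𝓡 n) _ _
    (mem_baseSet_tangent ((extChartAt (𝓡 n) c).map_target hy)), mdifferentiableAt_iff_coord hy]
  exact (trivializationAt_vec_eq X hy).differentiableAt_iff

theorem continuousAt_tens {T : TwoTensor n M} (hT : ContinuousTwoTensor T) {c : M} {y : Model n}
    (hy : y ∈ (extChartAt (𝓡 n) c).target) : ContinuousAt (tens T c) y := by
  set e := trivializationAt (Model n →L[ℝ] Model n →L[ℝ] ℝ)
      (fun p : M => TangentSpace (𝓡 n) p →L[ℝ] TangentSpace (𝓡 n) p →L[ℝ] ℝ) c with he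
  have h1 : ContinuousAt (fun p => e ⟨p, T p⟩) ((extChartAt (𝓡 n) c).symm y) := by
    refine ContinuousAt.comp (f := fun p => TotalSpace.mk' (Model n →L[ℝ] Model n →L[ℝ] ℝ) p (T p))
      (g := e) (e.toOpenPartialHomeomorph.continuousAt ?_) hT.continuousAt
    exact e.mem_source.2 (mem_baseSet_tensor ((extChartAt (𝓡 n) c).map_target hy))
  have h2 := (continuousAt_iff_coord hy).1 (continuousAt_snd.comp h1)
  exact h2.congr (trivializationAt_tensor_eq T hy)

theorem tens_cofr (T : TwoTensor n M) {c p : M} (hp : p ∈ (extChartAt (𝓡 n) c).source)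
    (X Y : TangentSpace (𝓡 n) p) :
    tens T c (extChartAt (𝓡 n) c p) (cofr c p X) (cofr c p Y) = T p X Y := by
  obtain ⟨y, hy, rfl⟩ := exists_coord hp
  rw [(extChartAt (𝓡 n) c).right_inv hy, tens_apply, fr_cofr hy, fr_cofr hy]

theorem form_cofr (W : OneForm n M) {c p : M} (hp : p ∈ (extChartAt (𝓡 n) c).source)
    (X : TangentSpace (𝓡 n) p) :
    form W c (extChartAt (𝓡 n) c p) (cofr c p X) = W p X := by
  obtain ⟨y, hy, rfl⟩ := exists_coord hp
  rw [(extChartAt (𝓡 n) c).right_inv hy, form_apply, fr_cofr hy]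

omit [IsManifold (𝓡 n) ∞ M] in
theorem vec_apply (X : VField n M) {c p : M} (hp : p ∈ (extChartAt (𝓡 n) c).source) :
    vec X c (extChartAt (𝓡 n) c p) = cofr c p (X p) := by
  obtain ⟨y, hy, rfl⟩ := exists_coord hp
  rw [(extChartAt (𝓡 n) c).right_inv hy, vec]

theorem fr_vec (X : VField n M) {c : M} {y : Model n} (hy : y ∈ (extChartAt (𝓡 n) c).target) :
    fr c y (vec X c y) = X ((extChartAt (𝓡 n) c).symm y) := by
  rw [vec, fr_cofr hy]

theorem cofr_injective {c p : M} (hp : p ∈ (extChartAt (𝓡 n) c).source) :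
    Function.Injective (cofr (n := n) c p) := by
  obtain ⟨y, hy, rfl⟩ := exists_coord hp
  exact Function.LeftInverse.injective (g := fr c y) fun X => fr_cofr hy X

theorem cofr_surjective {c p : M} (hp : p ∈ (extChartAt (𝓡 n) c).source) :
    Function.Surjective (cofr (n := n) c p) := by
  obtain ⟨y, hy, rfl⟩ := exists_coord hp
  exact Function.RightInverse.surjective (g := fr c y) fun X => cofr_fr hy X

omit [IsManifold (𝓡 n) ∞ M] in
theorem mdifferentiableAt_symm' [IsManifold (𝓡 n) ∞ M] {c : M} {y : Model n}
    (hy : y ∈ (extChartAt (𝓡 n) c).target) :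
    MDifferentiableAt 𝓘(ℝ, Model n) (𝓡 n) (extChartAt (𝓡 n) c).symm y := by
  have : IsManifold (𝓡 n) 1 M := IsManifold.of_le (n := ∞) (by simp)
  have h := mdifferentiableWithinAt_extChartAt_symm (I := 𝓡 n) hy
  rwa [ModelWithCorners.range_eq_univ, mdifferentiableWithinAt_univ] at h

theorem mvfderiv_fr {H : Type*} [NormedAddCommGroup H] [NormedSpace ℝ H]
    {f : M → H} {c : M} {y : Model n} (hy : y ∈ (extChartAt (𝓡 n) c).target)
    (hf : MDifferentiableAt (𝓡 n) 𝓘(ℝ, H) f ((extChartAt (𝓡 n) c).symm y)) (v : Model n) :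
    mvfderiv (𝓡 n) f ((extChartAt (𝓡 n) c).symm y) (fr c y v)
      = fderiv ℝ (fun z => f ((extChartAt (𝓡 n) c).symm z)) y v := by
  have h := mfderiv_comp y hf (mdifferentiableAt_symm' hy)
  rw [mfderiv_eq_fderiv] at h
  exact (DFunLike.congr_fun h v).symm

end Coordinates

/-! ### Maps between manifolds read in charts. -/

section Maps

set_option synthInstance.maxHeartbeats 200000

variable {n m : ℕ} {M : Type*} [TopologicalSpace M] [ChartedSpace (Model n) M]
  {N : Type*} [TopologicalSpace N] [ChartedSpace (Model m) N]

/-- A map in coordinates. -/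
def loc (φ : N → M) (b : N) (c : M) (z : Model m) : Model n :=
  extChartAt (𝓡 n) c (φ ((extChartAt (𝓡 m) b).symm z))

variable [IsManifold (𝓡 n) ∞ M] [IsManifold (𝓡 m) ∞ N]

theorem contDiffAt_loc {φ : N → M} {b : N} {c : M} {z : Model m}
    (hz : z ∈ (extChartAt (𝓡 m) b).target)
    (hφ : ContMDiffAt (𝓡 m) (𝓡 n) ∞ φ ((extChartAt (𝓡 m) b).symm z))
    (hc : φ ((extChartAt (𝓡 m) b).symm z) ∈ (extChartAt (𝓡 n) c).source) :
    ContDiffAt ℝ ∞ (loc (n := n) (m := m) φ b c) z := by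
  rw [extChartAt_source] at hc
  have h := (contMDiffAt_extChartAt' (I := 𝓡 n) (n := ∞) hc).comp _ hφ
  exact (contMDiffAt_iff_coord hz).1 h

theorem cofr_push {φ : N → M} {b : N} {c : M} {z : Model m}
    (hz : z ∈ (extChartAt (𝓡 m) b).target)
    (hφ : MDifferentiableAt (𝓡 m) (𝓡 n) φ ((extChartAt (𝓡 m) b).symm z))
    (hc : φ ((extChartAt (𝓡 m) b).symm z) ∈ (extChartAt (𝓡 n) c).source) (v : Model m) :
    cofr (n := n) c (φ ((extChartAt (𝓡 m) b).symm z))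
        (push (n := n) (m := m) φ ((extChartAt (𝓡 m) b).symm z) (fr b z v))
      = fderiv ℝ (loc (n := n) (m := m) φ b c) z v := by
  have : IsManifold (𝓡 n) 1 M := IsManifold.of_le (n := ∞) (by simp)
  have hc' := hc
  rw [extChartAt_source] at hc'
  have h1 := mdifferentiableAt_extChartAt (I := 𝓡 n) hc'
  have h2 := mfderiv_comp _ h1 hφ
  have h3 := mvfderiv_fr (f := fun x => extChartAt (𝓡 n) c (φ x)) hz (h1.comp _ hφ) v
  refine Eq.trans ?_ h3
  exact (DFunLike.congr_fun h2 (fr b z v)).symm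

theorem tens_pullTensor {φ : N → M} (T : TwoTensor n M) {b : N} {c : M} {z : Model m}
    (hz : z ∈ (extChartAt (𝓡 m) b).target)
    (hφ : MDifferentiableAt (𝓡 m) (𝓡 n) φ ((extChartAt (𝓡 m) b).symm z))
    (hc : φ ((extChartAt (𝓡 m) b).symm z) ∈ (extChartAt (𝓡 n) c).source) (v w : Model m) :
    tens (pullTensor φ T) b z v w = tens T c (loc (n := n) (m := m) φ b c z)
      (fderiv ℝ (loc (n := n) (m := m) φ b c) z v) (fderiv ℝ (loc (n := n) (m := m) φ b c) z w) := by
  rw [← cofr_push hz hφ hc, ← cofr_push hz hφ hc, loc, tens_cofr (n := n) T hc]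
  rfl

theorem form_pullForm {φ : N → M} (W : OneForm n M) {b : N} {c : M} {z : Model m}
    (hz : z ∈ (extChartAt (𝓡 m) b).target)
    (hφ : MDifferentiableAt (𝓡 m) (𝓡 n) φ ((extChartAt (𝓡 m) b).symm z))
    (hc : φ ((extChartAt (𝓡 m) b).symm z) ∈ (extChartAt (𝓡 n) c).source) (v : Model m) :
    form (pullForm φ W) b z v = form W c (loc (n := n) (m := m) φ b c z)
      (fderiv ℝ (loc (n := n) (m := m) φ b c) z v) := by
  rw [← cofr_push hz hφ hc, loc, form_cofr (n := n) W hc]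
  rfl

end Maps

end NullPullback
end

noncomputable section

namespace NullPullback

/-! ### The component definitions of ∇ and Ricci agree with the calculus on the model space. -/

section Metric

set_option synthInstance.maxHeartbeats 200000

variable {n : ℕ} {M : Type*} [TopologicalSpace M] [ChartedSpace (Model n) M]
  [IsManifold (𝓡 n) ∞ M]

/-- `h` is symmetric, smooth and nondegenerate on `U`. -/
structure IsMetricOn (h : TwoTensor n M) (U : Set M) : Prop where
  symm : ∀ p ∈ U, ∀ v w, h p v w = h p w v
  smooth : ∀ p ∈ U, ContMDiffAt (𝓡 n) ((𝓡 n).prod 𝓘(ℝ, Model n →L[ℝ] Model n →L[ℝ] ℝ)) ∞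
    (fun p => TotalSpace.mk' (Model n →L[ℝ] Model n →L[ℝ] ℝ) p (h p)) p
  nondegenerate : ∀ p ∈ U, ∀ w, (∀ v, h p w v = 0) → w = 0

variable {h : TwoTensor n M} {U : Set M} {c : M} {y : Model n}

theorem IsMetricOn.contDiffAt (hh : IsMetricOn h U) (hy : y ∈ (extChartAt (𝓡 n) c).target)
    (hU : (extChartAt (𝓡 n) c).symm y ∈ U) : ContDiffAt ℝ ∞ (tens h c) y :=
  (contMDiffAt_tensor_iff h hy).1 (hh.smooth _ hU)

theorem IsMetricOn.differentiableAt (hh : IsMetricOn h U)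
    (hy : y ∈ (extChartAt (𝓡 n) c).target)
    (hU : (extChartAt (𝓡 n) c).symm y ∈ U) : DifferentiableAt ℝ (tens h c) y :=
  (hh.contDiffAt hy hU).differentiableAt (by simp)

theorem IsMetricOn.isInvertible (hh : IsMetricOn h U) (hy : y ∈ (extChartAt (𝓡 n) c).target)
    (hU : (extChartAt (𝓡 n) c).symm y ∈ U) : (tens h c y).IsInvertible := by
  refine isInvertible_of_injective fun v hv => ?_
  have h1 : fr c y v = 0 := by
    refine hh.nondegenerate _ hU _ fun X => ?_
    rw [← fr_cofr hy X, ← tens_apply, hv]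
    rfl
  rw [← cofr_fr hy v, h1, map_zero]

omit [IsManifold (𝓡 n) ∞ M] in
theorem eventually_mem_of_symm (hUo : IsOpen U) (hy : y ∈ (extChartAt (𝓡 n) c).target)
    (hU : (extChartAt (𝓡 n) c).symm y ∈ U) :
    ∀ᶠ z in 𝓝 y, z ∈ (extChartAt (𝓡 n) c).target ∧ (extChartAt (𝓡 n) c).symm z ∈ U :=
  Filter.Eventually.and (target_mem_nhds' hy) ((tendsto_symm' hy).eventually (hUo.mem_nhds hU))

theorem IsMetricOn.tens_symm (hh : IsMetricOn h U)
    (hU : (extChartAt (𝓡 n) c).symm y ∈ U) (v w : Model n) :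
    tens h c y v w = tens h c y w v :=
  hh.symm _ hU _ _

theorem IsMetricOn.eventually_symm (hh : IsMetricOn h U) (hUo : IsOpen U)
    (hy : y ∈ (extChartAt (𝓡 n) c).target) (hU : (extChartAt (𝓡 n) c).symm y ∈ U) :
    ∀ᶠ z in 𝓝 y, ∀ v w, tens h c z v w = tens h c z w v :=
  (eventually_mem_of_symm hUo hy hU).mono fun _ hz => hh.tens_symm hz.2

theorem IsMetricOn.mono {V : Set M} (hh : IsMetricOn h U) (hV : V ⊆ U) : IsMetricOn h V :=
  ⟨fun p hp => hh.symm p (hV hp), fun p hp => hh.smooth p (hV hp),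
    fun p hp => hh.nondegenerate p (hV hp)⟩

theorem LorentzMetric.isMetricOn (g : LorentzMetric n M) : IsMetricOn g.val Set.univ :=
  ⟨fun p _ => g.symm p, fun p _ => g.smooth p, fun p _ => g.eq_zero_of_forall p⟩

theorem sum_single (a : Model n) : a = ∑ k, a k • EuclideanSpace.single k (1 : ℝ) := by
  ext i
  simp [Pi.single_apply]

theorem bilin_sum (B : Model n →ₗ[ℝ] Model n →ₗ[ℝ] ℝ) (a b : Model n) :
    B a b = ∑ i, ∑ j, a i * b j
      * B (EuclideanSpace.single i (1 : ℝ)) (EuclideanSpace.single j (1 : ℝ)) := by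
  conv_lhs => rw [sum_single a, sum_single b]
  simp only [map_sum, map_smul, LinearMap.sum_apply, LinearMap.smul_apply, smul_eq_mul]
  simp only [Finset.mul_sum]
  rw [Finset.sum_comm]
  exact Finset.sum_congr rfl fun i _ => Finset.sum_congr rfl fun j _ => by ring

/-- Both sides solve the same linear system with the Gram matrix as coefficients, so it suffices
that this matrix is invertible. -/
theorem christoffel_eq (hh : IsMetricOn h U) (hUo : IsOpen U)
    (hy : y ∈ (extChartAt (𝓡 n) c).target)
    (hU : (extChartAt (𝓡 n) c).symm y ∈ U) (k i j : Fin n) :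
    christoffel h c k i j y = gam (tens h c) y (EuclideanSpace.single i (1 : ℝ))
      (EuclideanSpace.single j (1 : ℝ)) k := by
  have hd := hh.differentiableAt hy hU
  have hi := hh.isInvertible hy hU
  set x := gam (tens h c) y (EuclideanSpace.single i (1 : ℝ)) (EuclideanSpace.single j (1 : ℝ))
    with hx
  have hg : ∀ a b : Fin n, ∀ l, pd l (fun z => gram h c z a b) y
      = fderiv ℝ (tens h c) y (EuclideanSpace.single l (1 : ℝ)) (EuclideanSpace.single a (1 : ℝ))
        (EuclideanSpace.single b (1 : ℝ)) := fun a b l =>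
    fderiv_apply₂ hd _ _ _
  have hG : ∀ a b, gram h c y a b = tens h c y (EuclideanSpace.single a (1 : ℝ))
    (EuclideanSpace.single b (1 : ℝ)) := fun a b => rfl
  -- A kernel vector of the Gram matrix is orthogonal to all basis vectors, hence zero by
  -- nondegeneracy.
  have hdet : IsUnit (gram h c y).det := by
    rw [← Matrix.isUnit_iff_isUnit_det, ← Matrix.mulVec_injective_iff_isUnit]
    rw [← Matrix.coe_mulVecLin, injective_iff_map_eq_zero]
    intro a ha
    have h1 : (WithLp.toLp 2 a : Model n) = 0 := by
      refine injective_of_isInvertible hi ?_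
      ext w
      rw [hh.tens_symm hU, sum_single w, map_sum, sum_apply]
      refine Finset.sum_eq_zero fun l _ => ?_
      have h2 := congrFun ha l
      rw [sum_single (WithLp.toLp 2 a : Model n)]
      simp only [Matrix.mulVecLin_apply, Matrix.mulVec, dotProduct, hG, Pi.zero_apply] at h2
      simp only [map_smul, smul_apply, map_sum, smul_eq_mul]
      have h3 : ∑ m, a m * tens h c y (EuclideanSpace.single l (1 : ℝ))
          (EuclideanSpace.single m (1 : ℝ)) = 0 := by
        rw [← h2]
        exact Finset.sum_congr rfl fun m _ => mul_comm _ _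
      rw [← mul_zero (w l), ← h3, Finset.mul_sum]
      exact Finset.sum_congr rfl fun m _ => mul_left_comm _ _ _
    exact congrArg (WithLp.ofLp) h1
  have hs := fderiv_symm₂ hd (hh.eventually_symm hUo hy hU)
  have hxl : ∀ l, pd i (fun z => gram h c z l j) y + pd j (fun z => gram h c z i l) y
      - pd l (fun z => gram h c z i j) y = 2 * (gram h c y).mulVec (fun m => x m) l := by
    intro l
    have h1 := gam_spec hi (EuclideanSpace.single i (1 : ℝ)) (EuclideanSpace.single j (1 : ℝ))
      (EuclideanSpace.single l (1 : ℝ))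
    rw [← hx] at h1
    rw [hg, hg, hg, hs, ← h1, hh.tens_symm hU]
    conv_lhs => rw [sum_single x]
    simp only [Matrix.mulVec, dotProduct, hG, map_sum, map_smul, smul_eq_mul]
    congr 1
    exact Finset.sum_congr rfl fun m _ => mul_comm _ _
  rw [christoffel]
  simp only [hxl]
  have h3 : (gram h c y)⁻¹.mulVec ((gram h c y).mulVec (fun m => x m)) = fun m => x m := by
    rw [Matrix.mulVec_mulVec, Matrix.nonsing_inv_mul _ hdet, Matrix.one_mulVec]
  have h4 := congrFun h3 k
  rw [← h4, Matrix.mulVec, dotProduct, Finset.mul_sum]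
  exact Finset.sum_congr rfl fun l _ => by ring

/-- Both sides are bilinear and agree on basis vectors. Only the chart centred at p occurs here;
`nablaForm_eq` removes this restriction. -/
theorem nablaForm_center (hh : IsMetricOn h U) (hUo : IsOpen U) {p : M} (hp : p ∈ U)
    {W : OneForm n M} (hW : OneFormDiffAt W p) (X Y : TangentSpace (𝓡 n) p) :
    nablaForm h W p X Y
      = nab (tens h p) (form W p) (extChartAt (𝓡 n) p p) (cofr p p X) (cofr p p Y) := by
  have hy := mem_extChartAt_target (I := 𝓡 n) p
  have hsy : (extChartAt (𝓡 n) p).symm (extChartAt (𝓡 n) p p) = p := by simp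
  have hU : (extChartAt (𝓡 n) p).symm (extChartAt (𝓡 n) p p) ∈ U := by rwa [hsy]
  have hW' : DifferentiableAt ℝ (form W p) (extChartAt (𝓡 n) p p) := by
    rw [← oneFormDiffAt_iff W hy, hsy]; exact hW
  set y := extChartAt (𝓡 n) p p
  let B : Model n →ₗ[ℝ] Model n →ₗ[ℝ] ℝ := LinearMap.mk₂ ℝ (nab (tens h p) (form W p) y)
    (fun a b c => by simp only [nab, ← gamL_apply, map_add, LinearMap.add_apply, add_apply]; ring)
    (fun r a b => by
      simp only [nab, ← gamL_apply, map_smul, LinearMap.smul_apply, smul_apply, smul_eq_mul]; ring)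
    (fun a b c => by simp only [nab, ← gamL_apply, map_add]; ring)
    (fun r a b => by simp only [nab, ← gamL_apply, map_smul, smul_eq_mul]; ring)
  change _ = B (cofr p p X) (cofr p p Y)
  rw [bilin_sum]
  refine Finset.sum_congr rfl fun i _ => Finset.sum_congr rfl fun j _ => ?_
  have h1 : pd i (formComp W p j) y = fderiv ℝ (form W p) y (EuclideanSpace.single i (1 : ℝ))
      (EuclideanSpace.single j (1 : ℝ)) := fderiv_apply₁ hW' _ _
  have h2 : ∑ k, christoffel h p k i j y * formComp W p k y
      = form W p y (gam (tens h p) y (EuclideanSpace.single i (1 : ℝ))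
        (EuclideanSpace.single j (1 : ℝ))) := by
    conv_rhs => rw [sum_single (gam _ _ _ _)]
    rw [map_sum]
    refine Finset.sum_congr rfl fun k _ => ?_
    rw [christoffel_eq hh hUo hy hU, map_smul]
    rfl
  rw [h1, h2]
  rfl

omit [IsManifold (𝓡 n) ∞ M] in
theorem push_id (p : M) (X : TangentSpace (𝓡 n) p) : push (n := n) (m := n) (id : M → M) p X = X := by
  rw [push, mfderiv_id]; rfl

/-- A coordinate change is `loc` of the identity map, so what is known about pullbacks along maps
applies to it. -/
theorem cofr_change {b : M} (hz : y ∈ (extChartAt (𝓡 n) b).target)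
    (hc : (extChartAt (𝓡 n) b).symm y ∈ (extChartAt (𝓡 n) c).source)
    (X : TangentSpace (𝓡 n) ((extChartAt (𝓡 n) b).symm y)) :
    fderiv ℝ (loc (n := n) (m := n) (id : M → M) b c) y
      (cofr b ((extChartAt (𝓡 n) b).symm y) X) = cofr c ((extChartAt (𝓡 n) b).symm y) X := by
  rw [← cofr_push hz mdifferentiableAt_id hc, fr_cofr hz, push_id]
  rfl

omit [IsManifold (𝓡 n) ∞ M] in
theorem eventually_mem_source {b : M} (hz : y ∈ (extChartAt (𝓡 n) b).target)
    (hc : (extChartAt (𝓡 n) b).symm y ∈ (extChartAt (𝓡 n) c).source) :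
    ∀ᶠ z in 𝓝 y, z ∈ (extChartAt (𝓡 n) b).target ∧
      (extChartAt (𝓡 n) b).symm z ∈ (extChartAt (𝓡 n) c).source :=
  eventually_mem_of_symm (isOpen_extChartAt_source c) hz hc

/-- The Levi-Civita derivative in the coordinates around an arbitrary point. -/
theorem nablaForm_eq (hh : IsMetricOn h U) (hUo : IsOpen U) {p : M} (hp : p ∈ U)
    (hpc : p ∈ (extChartAt (𝓡 n) c).source)
    {W : OneForm n M} (hW : OneFormDiffAt W p) (X Y : TangentSpace (𝓡 n) p) :
    nablaForm h W p X Y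
      = nab (tens h c) (form W c) (extChartAt (𝓡 n) c p) (cofr c p X) (cofr c p Y) := by
  rw [nablaForm_center hh hUo hp hW]
  have hy := mem_extChartAt_target (I := 𝓡 n) p
  have hsy : (extChartAt (𝓡 n) p).symm (extChartAt (𝓡 n) p p) = p := by simp
  have hU : (extChartAt (𝓡 n) p).symm (extChartAt (𝓡 n) p p) ∈ U := by rwa [hsy]
  have hc : (extChartAt (𝓡 n) p).symm (extChartAt (𝓡 n) p p) ∈ (extChartAt (𝓡 n) c).source := by
    rwa [hsy]
  have hyc : extChartAt (𝓡 n) c p ∈ (extChartAt (𝓡 n) c).target :=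
    (extChartAt (𝓡 n) c).map_source hpc
  have hsc : (extChartAt (𝓡 n) c).symm (extChartAt (𝓡 n) c p) = p :=
    (extChartAt (𝓡 n) c).left_inv hpc
  have hUc : (extChartAt (𝓡 n) c).symm (extChartAt (𝓡 n) c p) ∈ U := by rwa [hsc]
  have hWp : DifferentiableAt ℝ (form W p) (extChartAt (𝓡 n) p p) := by
    rw [← oneFormDiffAt_iff W hy, hsy]; exact hW
  have hWc : DifferentiableAt ℝ (form W c) (extChartAt (𝓡 n) c p) := by
    rw [← oneFormDiffAt_iff W hyc, hsc]; exact hW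
  have hloc : loc (n := n) (m := n) (id : M → M) p c (extChartAt (𝓡 n) p p)
      = extChartAt (𝓡 n) c p := by rw [loc, hsy]; rfl
  have hcof : ∀ X : TangentSpace (𝓡 n) p,
      fderiv ℝ (loc (n := n) (m := n) (id : M → M) p c) (extChartAt (𝓡 n) p p) (cofr p p X)
        = cofr c p X := by
    intro X
    have := cofr_change (c := c) hy hc
    rw [hsy] at this
    exact this X
  rw [← hcof, ← hcof, ← hloc]
  have hev := eventually_mem_source (c := c) hy hc
  refine nab_pull ?_ (hh.differentiableAt hy hU)
    ((contDiffAt_loc hy contMDiffAt_id hc).of_le two_le_infty) ?_ ?_ (hh.isInvertible hy hU) ?_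
    ?_ ?_ hWp ?_ _ _
  · rw [hloc]; exact hh.differentiableAt hyc hUc
  · filter_upwards [hev] with z hz v w
    rw [← tens_pullTensor h hz.1 mdifferentiableAt_id hz.2, tens_apply, tens_apply]
    change _ = h _ (push (n := n) (m := n) (id : M → M) _ _) (push (n := n) (m := n) (id : M → M) _ _)
    rw [push_id, push_id]
    rfl
  · rw [hloc]; exact hh.isInvertible hyc hUc
  · rw [hloc]; exact hh.tens_symm hUc
  · intro v
    obtain ⟨X, hX⟩ := cofr_surjective (n := n) hpc v
    exact ⟨cofr p p X, by rw [hcof, hX]⟩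
  · rw [hloc]; exact hWc
  · filter_upwards [hev] with z hz v
    rw [← form_pullForm W hz.1 mdifferentiableAt_id hz.2, form_apply, form_apply]
    change _ = W _ (push (n := n) (m := n) (id : M → M) _ _)
    rw [push_id]
    rfl

/-- By bilinearity it is enough to compare basis vectors. The chart centred at p suffices: Ricci
tensors are only ever compared pointwise, and independence of the chart is needed for the Hessian
alone. -/
theorem ricci_eq (hh : IsMetricOn h U) (hUo : IsOpen U) {p : M} (hp : p ∈ U)
    (X Y : TangentSpace (𝓡 n) p) :
    ricci h p X Y
      = ricF (gam (tens h p)) (extChartAt (𝓡 n) p p) (cofr p p X) (cofr p p Y) := by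
  have hy := mem_extChartAt_target (I := 𝓡 n) p
  have hsy : (extChartAt (𝓡 n) p).symm (extChartAt (𝓡 n) p p) = p := by simp
  have hU : (extChartAt (𝓡 n) p).symm (extChartAt (𝓡 n) p p) ∈ U := by rwa [hsy]
  set y := extChartAt (𝓡 n) p p
  have hd : ∀ a b, DifferentiableAt ℝ (fun x => gam (tens h p) x a b) y := fun a b =>
    (contDiffAt_gam (hh.contDiffAt hy hU) (hh.isInvertible hy hU) a b).differentiableAt (by simp)
  let D : Model n → Model n →ₗ[ℝ] Model n →ₗ[ℝ] Model n := fun v => LinearMap.mk₂ ℝ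
    (fun a b => fderiv ℝ (fun x => gam (tens h p) x a b) y v)
    (fun a a' b => by
      simp only [← gamL_apply, map_add, LinearMap.add_apply]
      exact congrArg (fun L => L v) ((hd a b).hasFDerivAt.add (hd a' b).hasFDerivAt).fderiv)
    (fun r a b => by
      simp only [← gamL_apply, map_smul, LinearMap.smul_apply]
      exact congrArg (fun L => L v) ((hd a b).hasFDerivAt.const_smul r).fderiv)
    (fun a b b' => by
      simp only [← gamL_apply, map_add]
      exact congrArg (fun L => L v) ((hd a b).hasFDerivAt.add (hd a b').hasFDerivAt).fderiv)
    (fun r a b => by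
      simp only [← gamL_apply, map_smul]
      exact congrArg (fun L => L v) ((hd a b).hasFDerivAt.const_smul r).fderiv)
  have hD : ∀ v a b, D v a b = fderiv ℝ (fun x => gam (tens h p) x a b) y v := fun _ _ _ => rfl
  have hDadd : ∀ v v' a b, D (v + v') a b = D v a b + D v' a b := fun v v' a b =>
    map_add (fderiv ℝ (fun x => gam (tens h p) x a b) y) v v'
  have hDsmul : ∀ (r : ℝ) v a b, D (r • v) a b = r • D v a b := fun r v a b =>
    map_smul (fderiv ℝ (fun x => gam (tens h p) x a b) y) r v
  have hric : ∀ a b, ricF (gam (tens h p)) y a b = ∑ k,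
      (D (EuclideanSpace.single k (1 : ℝ)) a b k - D b a (EuclideanSpace.single k (1 : ℝ)) k
      + gamL (tens h p) y (EuclideanSpace.single k (1 : ℝ)) (gamL (tens h p) y a b) k
      - gamL (tens h p) y b (gamL (tens h p) y a (EuclideanSpace.single k (1 : ℝ))) k) :=
    fun _ _ => rfl
  let B : Model n →ₗ[ℝ] Model n →ₗ[ℝ] ℝ := LinearMap.mk₂ ℝ (ricF (gam (tens h p)) y)
    (fun a a' b => by
      simp only [hric, ← Finset.sum_add_distrib]
      refine Finset.sum_congr rfl fun k _ => ?_
      simp only [map_add, LinearMap.add_apply, PiLp.add_apply]; ring)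
    (fun r a b => by
      simp only [hric, smul_eq_mul, Finset.mul_sum]
      refine Finset.sum_congr rfl fun k _ => ?_
      simp only [map_smul, LinearMap.smul_apply, PiLp.smul_apply, smul_eq_mul]; ring)
    (fun a b b' => by
      simp only [hric, ← Finset.sum_add_distrib]
      refine Finset.sum_congr rfl fun k _ => ?_
      simp only [map_add, hDadd, LinearMap.add_apply, PiLp.add_apply]; ring)
    (fun r a b => by
      simp only [hric, smul_eq_mul, Finset.mul_sum]
      refine Finset.sum_congr rfl fun k _ => ?_
      simp only [map_smul, hDsmul, LinearMap.smul_apply, PiLp.smul_apply, smul_eq_mul]; ring)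
  change _ = B (cofr p p X) (cofr p p Y)
  rw [bilin_sum]
  refine Finset.sum_congr rfl fun i _ => Finset.sum_congr rfl fun j _ => ?_
  congr 1
  have hpd : ∀ k i j l, pd l (christoffel h p k i j) y
      = fderiv ℝ (fun x => gam (tens h p) x (EuclideanSpace.single i (1 : ℝ))
        (EuclideanSpace.single j (1 : ℝ))) y (EuclideanSpace.single l (1 : ℝ)) k := by
    intro k i j l
    have e : christoffel h p k i j =ᶠ[𝓝 y] fun x =>
        gam (tens h p) x (EuclideanSpace.single i (1 : ℝ)) (EuclideanSpace.single j (1 : ℝ)) k :=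
      (eventually_mem_of_symm hUo hy hU).mono fun z hz => christoffel_eq hh hUo hz.1 hz.2 k i j
    rw [pd, e.fderiv_eq]
    have h1 := ((EuclideanSpace.proj k : Model n →L[ℝ] ℝ).hasFDerivAt.comp y
      (hd (EuclideanSpace.single i (1 : ℝ)) (EuclideanSpace.single j (1 : ℝ))).hasFDerivAt).fderiv
    exact congrArg (fun L => L (EuclideanSpace.single l (1 : ℝ))) h1
  change ricciComp h p i j y = ricF (gam (tens h p)) y (EuclideanSpace.single i (1 : ℝ))
    (EuclideanSpace.single j (1 : ℝ))
  have hquad : ∀ k a b c : Fin n, gam (tens h p) y (EuclideanSpace.single a (1 : ℝ))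
      (gam (tens h p) y (EuclideanSpace.single b (1 : ℝ)) (EuclideanSpace.single c (1 : ℝ))) k
      = ∑ l, christoffel h p k a l y * christoffel h p l b c y := by
    intro k a b c
    rw [sum_single (gam (tens h p) y (EuclideanSpace.single b (1 : ℝ))
      (EuclideanSpace.single c (1 : ℝ))), ← gamL_apply, map_sum]
    rw [WithLp.ofLp_sum, Finset.sum_apply]
    refine Finset.sum_congr rfl fun l _ => ?_
    rw [christoffel_eq hh hUo hy hU, christoffel_eq hh hUo hy hU, map_smul, gamL_apply]
    simp [mul_comm]
  rw [ricciComp, ricF, trc, ← Finset.sum_add_distrib]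
  refine Finset.sum_congr rfl fun k _ => ?_
  simp only [PiLp.add_apply, PiLp.sub_apply, hquad, hpd, Finset.sum_sub_distrib]
  ring

end Metric

end NullPullback
end

noncomputable section

namespace NullPullback

/-! ### The Lie derivative in coordinates. -/

section Lie

set_option synthInstance.maxHeartbeats 200000

variable {n : ℕ} {M : Type*} [TopologicalSpace M] [ChartedSpace (Model n) M]
  [IsManifold (𝓡 n) ∞ M]

theorem inverse_fr {c : M} {y : Model n} (hy : y ∈ (extChartAt (𝓡 n) c).target) :
    (fr c y).inverse = cofr c ((extChartAt (𝓡 n) c).symm y) :=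
  ContinuousLinearMap.inverse_eq (by ext1 X; exact fr_cofr hy X)
    (by ext1 v; exact cofr_fr hy v)

theorem isInvertible_cofr {c p : M} (hp : p ∈ (extChartAt (𝓡 n) c).source) :
    (cofr (n := n) c p).IsInvertible := by
  obtain ⟨y, hy, rfl⟩ := exists_coord hp
  exact ⟨ContinuousLinearEquiv.equivOfInverse' _ (fr c y) (by ext1 v; exact cofr_fr hy v)
    (by ext1 X; exact fr_cofr hy X), rfl⟩

/-- The set is a variable because unfolding the manifold bracket produces an intersection that
equals the whole space only after rewriting. -/
theorem lieBracketWithin_eq {V V' W W' : Model n → Model n} {s : Set (Model n)} {y : Model n}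
    (hs : s = Set.univ) (hV : V =ᶠ[𝓝 y] V') (hW : W =ᶠ[𝓝 y] W') :
    VectorField.lieBracketWithin ℝ V W s y = fderiv ℝ W' y (V' y) - fderiv ℝ V' y (W' y) := by
  rw [hs, VectorField.lieBracketWithin_univ, VectorField.lieBracket, hV.fderiv_eq, hW.fderiv_eq,
    hV.self_of_nhds, hW.self_of_nhds]

theorem cofr_mlieBracket (V W : VField n M) (p : M) :
    cofr p p (VectorField.mlieBracket (𝓡 n) V W p)
      = fderiv ℝ (vec W p) (extChartAt (𝓡 n) p p) (vec V p (extChartAt (𝓡 n) p p))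
        - fderiv ℝ (vec V p) (extChartAt (𝓡 n) p p) (vec W p (extChartAt (𝓡 n) p p)) := by
  have hy := mem_extChartAt_target (I := 𝓡 n) p
  have hsy : (extChartAt (𝓡 n) p).symm (extChartAt (𝓡 n) p p) = p := by simp
  have key : ∀ V : VField n M,
      (VectorField.mpullbackWithin 𝓘(ℝ, Model n) (𝓡 n) (extChartAt (𝓡 n) p).symm V
        (Set.range (𝓡 n)) : Model n → Model n) =ᶠ[𝓝 (extChartAt (𝓡 n) p p)] vec V p := by
    intro V
    filter_upwards [target_mem_nhds' hy] with z hz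
    have := inverse_fr hz
    rw [VectorField.mpullbackWithin_apply, ModelWithCorners.range_eq_univ, mfderivWithin_univ, vec,
      ← this]
    rfl
  have h1 : VectorField.mlieBracket (𝓡 n) V W p
      = (cofr p p).inverse (VectorField.lieBracketWithin ℝ
        (VectorField.mpullbackWithin 𝓘(ℝ, Model n) (𝓡 n) (extChartAt (𝓡 n) p).symm V
          (Set.range (𝓡 n)) : Model n → Model n)
        (VectorField.mpullbackWithin 𝓘(ℝ, Model n) (𝓡 n) (extChartAt (𝓡 n) p).symm W
          (Set.range (𝓡 n)) : Model n → Model n)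
        ((extChartAt (𝓡 n) p).symm ⁻¹' Set.univ ∩ Set.range (𝓡 n)) (extChartAt (𝓡 n) p p)) := rfl
  have h2 := isInvertible_cofr (n := n) (c := p) (p := p) (mem_extChartAt_source p)
  rw [h1]
  obtain ⟨e, he⟩ := h2
  rw [← he, ContinuousLinearMap.inverse_equiv]
  change e (e.symm _) = _
  rw [e.apply_symm_apply]
  exact lieBracketWithin_eq (by rw [ModelWithCorners.range_eq_univ, Set.preimage_univ,
    Set.univ_inter]) (key V) (key W)

/-- The derivatives of X and Y from the product rule cancel against those in the two brackets, so
only their values at p survive. -/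
theorem lieDeriv_eq {T : TwoTensor n M} {ν X Y : VField n M} {p : M}
    (hT : DifferentiableAt ℝ (tens T p) (extChartAt (𝓡 n) p p))
    (hX : VFieldDiffAt X p) (hY : VFieldDiffAt Y p) :
    lieDeriv ν T X Y p = lieF (vec ν p) (tens T p) (extChartAt (𝓡 n) p p)
      (cofr p p (X p)) (cofr p p (Y p)) := by
  have hy := mem_extChartAt_target (I := 𝓡 n) p
  have hsy : (extChartAt (𝓡 n) p).symm (extChartAt (𝓡 n) p p) = p := by simp
  have hp := mem_extChartAt_source (I := 𝓡 n) p
  have hX' : DifferentiableAt ℝ (vec X p) (extChartAt (𝓡 n) p p) := by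
    rw [← vFieldDiffAt_iff X hy, hsy]; exact hX
  have hY' : DifferentiableAt ℝ (vec Y p) (extChartAt (𝓡 n) p p) := by
    rw [← vFieldDiffAt_iff Y hy, hsy]; exact hY
  have hvX : vec X p (extChartAt (𝓡 n) p p) = cofr p p (X p) := vec_apply X hp
  have hvY : vec Y p (extChartAt (𝓡 n) p p) = cofr p p (Y p) := vec_apply Y hp
  have hvν : vec ν p (extChartAt (𝓡 n) p p) = cofr p p (ν p) := vec_apply ν hp
  have e : (fun z => T ((extChartAt (𝓡 n) p).symm z) (X ((extChartAt (𝓡 n) p).symm z))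
      (Y ((extChartAt (𝓡 n) p).symm z))) =ᶠ[𝓝 (extChartAt (𝓡 n) p p)]
      fun z => tens T p z (vec X p z) (vec Y p z) := by
    filter_upwards [target_mem_nhds' hy] with z hz
    rw [tens_apply, fr_vec X hz, fr_vec Y hz]
  have hTX : DifferentiableAt ℝ (fun z => tens T p z (vec X p z)) (extChartAt (𝓡 n) p p) :=
    DifferentiableAt.clm_apply hT hX'
  have hdiff : MDifferentiableAt (𝓡 n) 𝓘(ℝ, ℝ) (fun x => T x (X x) (Y x))
      ((extChartAt (𝓡 n) p).symm (extChartAt (𝓡 n) p p)) := by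
    rw [mdifferentiableAt_iff_coord hy, e.differentiableAt_iff]
    exact hTX.clm_apply hY'
  have h1 := mvfderiv_fr hy hdiff (cofr p p (ν p))
  have h2 : diff (n := n) (fun y => T y (X y) (Y y)) p (ν p)
      = fderiv ℝ (fun z => tens T p z (vec X p z) (vec Y p z)) (extChartAt (𝓡 n) p p)
        (cofr p p (ν p)) := by
    rw [← e.fderiv_eq, ← h1]
    have h3 := fr_cofr hy
    rw [hsy] at h3
    have h4 := h3 (ν p)
    rw [hsy]
    rw [h4]
    rfl
  rw [lieDeriv, h2, ← tens_cofr T hp, ← tens_cofr T hp, cofr_mlieBracket, cofr_mlieBracket,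
    fderiv_clm_apply hTX hY']
  simp only [add_apply, ContinuousLinearMap.comp_apply, ContinuousLinearMap.flip_apply]
  rw [fderiv_clm_apply hT hX']
  simp only [add_apply, ContinuousLinearMap.comp_apply, ContinuousLinearMap.flip_apply]
  rw [lieF, hvX, hvY, hvν]
  simp only [map_sub, sub_apply]
  ring

theorem exists_vField (p : M) (X : TangentSpace (𝓡 n) p) :
    ∃ V : VField n M, VFieldDiffAt V p ∧ V p = X := by
  have : IsManifold (𝓡 n) 1 M := IsManifold.of_le (n := ∞) (by simp)
  exact ⟨FiberBundle.extend (Model n) X, FiberBundle.mdifferentiableAt_extend (𝓡 n) (Model n) X, by simp⟩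

/-- The Lie derivative is tensorial in X and Y, and every tangent vector extends to a field
differentiable at the point. The condition on fields thus becomes one on constant vectors in the
chart. -/
theorem lieProportional_iff {ν : VField n M} {T : TwoTensor n M} {f : M → ℝ} {V : Set M}
    (hT : ∀ p ∈ V, DifferentiableAt ℝ (tens T p) (extChartAt (𝓡 n) p p)) :
    LieProportional ν T f V ↔ ∀ p ∈ V, ∀ a b,
      lieF (vec ν p) (tens T p) (extChartAt (𝓡 n) p p) a b
        = f p * tens T p (extChartAt (𝓡 n) p p) a b := by
  refine forall₂_congr fun p hp => ⟨fun h a b => ?_, fun h X Y hX hY => ?_⟩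
  · have hp' := mem_extChartAt_source (I := 𝓡 n) p
    obtain ⟨a', rfl⟩ := cofr_surjective (n := n) hp' a
    obtain ⟨b', rfl⟩ := cofr_surjective (n := n) hp' b
    obtain ⟨X, hX, rfl⟩ := exists_vField p a'
    obtain ⟨Y, hY, rfl⟩ := exists_vField p b'
    rw [← lieDeriv_eq (hT p hp) hX hY, h X Y hX hY, tens_cofr T hp']
  · rw [lieDeriv_eq (hT p hp) hX hY, h, tens_cofr T (mem_extChartAt_source p)]

end Lie

end NullPullback
end

noncomputable section

namespace NullPullback

/-! ### Smoothness of pullbacks, and local retractions onto an embedded submanifold. -/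

section ClmApply

theorem contDiffAt_of_apply {m : ℕ} {E F : Type*} [NormedAddCommGroup E] [NormedSpace ℝ E]
    [NormedAddCommGroup F] [NormedSpace ℝ F] {f : E → Model m →L[ℝ] F} {x : E}
    (h : ∀ v, ContDiffAt ℝ ∞ (fun y => f y v) x) : ContDiffAt ℝ ∞ f x := by
  have e : f = fun y => ∑ i, ContinuousLinearMap.smulRightL ℝ (Model m) F (EuclideanSpace.proj i)
      (f y (EuclideanSpace.single i (1 : ℝ))) := by
    funext y
    ext v
    conv_lhs => rw [sum_single v]
    simp
  rw [e]
  exact ContDiffAt.sum fun i _ =>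
    (ContinuousLinearMap.contDiff _).contDiffAt.comp x (h (EuclideanSpace.single i (1 : ℝ)))

end ClmApply

section Pullback

set_option synthInstance.maxHeartbeats 200000

variable {n m : ℕ} {M : Type*} [TopologicalSpace M] [ChartedSpace (Model n) M]
  {N : Type*} [TopologicalSpace N] [ChartedSpace (Model m) N]

variable [IsManifold (𝓡 n) ∞ M] [IsManifold (𝓡 m) ∞ N]

omit [IsManifold (𝓡 n) ∞ M] [IsManifold (𝓡 m) ∞ N] in
theorem eventually_loc {φ : N → M} {V : Set N} (hV : IsOpen V)
    (hφ : ContMDiffOn (𝓡 m) (𝓡 n) ∞ φ V) {b : N} {c : M} {z : Model m}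
    (hz : z ∈ (extChartAt (𝓡 m) b).target) (hzV : (extChartAt (𝓡 m) b).symm z ∈ V)
    (hc : φ ((extChartAt (𝓡 m) b).symm z) ∈ (extChartAt (𝓡 n) c).source) :
    ∀ᶠ x in 𝓝 z, x ∈ (extChartAt (𝓡 m) b).target ∧
      ContMDiffAt (𝓡 m) (𝓡 n) ∞ φ ((extChartAt (𝓡 m) b).symm x) ∧
      φ ((extChartAt (𝓡 m) b).symm x) ∈ (extChartAt (𝓡 n) c).source := by
  have h1 := eventually_mem_of_symm hV hz hzV
  have h2 : ContinuousAt φ ((extChartAt (𝓡 m) b).symm z) :=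
    (hφ.contMDiffAt (hV.mem_nhds hzV)).continuousAt
  have h3 : ContinuousAt (fun x => φ ((extChartAt (𝓡 m) b).symm x)) z :=
    (continuousAt_iff_coord hz).1 h2
  filter_upwards [h1, h3.eventually (source_mem_nhds' hc)] with x hx hx'
  exact ⟨hx.1, hφ.contMDiffAt (hV.mem_nhds hx.2), hx'⟩

theorem tens_pullTensor_eventuallyEq {φ : N → M} {V : Set N} (hV : IsOpen V)
    (hφ : ContMDiffOn (𝓡 m) (𝓡 n) ∞ φ V) (T : TwoTensor n M) {b : N} {c : M} {z : Model m}
    (hz : z ∈ (extChartAt (𝓡 m) b).target) (hzV : (extChartAt (𝓡 m) b).symm z ∈ V)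
    (hc : φ ((extChartAt (𝓡 m) b).symm z) ∈ (extChartAt (𝓡 n) c).source) :
    ∀ᶠ x in 𝓝 z, ∀ v w, tens (pullTensor φ T) b x v w
      = tens T c (loc (n := n) (m := m) φ b c x) (fderiv ℝ (loc (n := n) (m := m) φ b c) x v)
        (fderiv ℝ (loc (n := n) (m := m) φ b c) x w) :=
  (eventually_loc hV hφ hz hzV hc).mono fun _ hx v w =>
    tens_pullTensor T hx.1 (hx.2.1.mdifferentiableAt (by simp)) hx.2.2 v w

theorem form_pullForm_eventuallyEq {φ : N → M} {V : Set N} (hV : IsOpen V)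
    (hφ : ContMDiffOn (𝓡 m) (𝓡 n) ∞ φ V) (W : OneForm n M) {b : N} {c : M} {z : Model m}
    (hz : z ∈ (extChartAt (𝓡 m) b).target) (hzV : (extChartAt (𝓡 m) b).symm z ∈ V)
    (hc : φ ((extChartAt (𝓡 m) b).symm z) ∈ (extChartAt (𝓡 n) c).source) :
    ∀ᶠ x in 𝓝 z, ∀ v, form (pullForm φ W) b x v
      = form W c (loc (n := n) (m := m) φ b c x) (fderiv ℝ (loc (n := n) (m := m) φ b c) x v) :=
  (eventually_loc hV hφ hz hzV hc).mono fun _ hx v =>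
    form_pullForm W hx.1 (hx.2.1.mdifferentiableAt (by simp)) hx.2.2 v

theorem contDiffAt_tens_pullTensor {φ : N → M} {V : Set N} (hV : IsOpen V)
    (hφ : ContMDiffOn (𝓡 m) (𝓡 n) ∞ φ V) {T : TwoTensor n M} {b : N} {c : M} {z : Model m}
    (hz : z ∈ (extChartAt (𝓡 m) b).target) (hzV : (extChartAt (𝓡 m) b).symm z ∈ V)
    (hc : φ ((extChartAt (𝓡 m) b).symm z) ∈ (extChartAt (𝓡 n) c).source)
    (hT : ContDiffAt ℝ ∞ (tens T c) (loc (n := n) (m := m) φ b c z)) :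
    ContDiffAt ℝ ∞ (tens (pullTensor φ T) b) z := by
  have hψ := contDiffAt_loc hz (hφ.contMDiffAt (hV.mem_nhds hzV)) hc
  have hD := hψ.fderiv_right (m := ∞) (by simp)
  have h2 : ContDiffAt ℝ ∞ (fun x => tens T c (loc (n := n) (m := m) φ b c x)) z :=
    ContDiffAt.comp (g := tens T c) z hT hψ
  refine contDiffAt_of_apply fun v => contDiffAt_of_apply fun w => ?_
  refine ((h2.clm_apply (hD.clm_apply (contDiffAt_const (c := v)))).clm_apply
    (hD.clm_apply (contDiffAt_const (c := w)))).congr_of_eventuallyEq ?_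
  filter_upwards [tens_pullTensor_eventuallyEq hV hφ T hz hzV hc] with x hx
  exact hx v w

theorem contDiffAt_form_pullForm {φ : N → M} {V : Set N} (hV : IsOpen V)
    (hφ : ContMDiffOn (𝓡 m) (𝓡 n) ∞ φ V) {W : OneForm n M} {b : N} {c : M} {z : Model m}
    (hz : z ∈ (extChartAt (𝓡 m) b).target) (hzV : (extChartAt (𝓡 m) b).symm z ∈ V)
    (hc : φ ((extChartAt (𝓡 m) b).symm z) ∈ (extChartAt (𝓡 n) c).source)
    (hW : ContDiffAt ℝ ∞ (form W c) (loc (n := n) (m := m) φ b c z)) :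
    ContDiffAt ℝ ∞ (form (pullForm φ W) b) z := by
  have hψ := contDiffAt_loc hz (hφ.contMDiffAt (hV.mem_nhds hzV)) hc
  have hD := hψ.fderiv_right (m := ∞) (by simp)
  have h2 : ContDiffAt ℝ ∞ (fun x => form W c (loc (n := n) (m := m) φ b c x)) z :=
    ContDiffAt.comp (g := form W c) z hW hψ
  refine (h2.clm_comp hD).congr_of_eventuallyEq ?_
  filter_upwards [form_pullForm_eventuallyEq hV hφ W hz hzV hc] with x hx
  ext v
  exact hx v

theorem differentiableAt_form_pullForm {φ : N → M} {V : Set N} (hV : IsOpen V)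
    (hφ : ContMDiffOn (𝓡 m) (𝓡 n) ∞ φ V) {W : OneForm n M} {b : N} {c : M} {z : Model m}
    (hz : z ∈ (extChartAt (𝓡 m) b).target) (hzV : (extChartAt (𝓡 m) b).symm z ∈ V)
    (hc : φ ((extChartAt (𝓡 m) b).symm z) ∈ (extChartAt (𝓡 n) c).source)
    (hW : DifferentiableAt ℝ (form W c) (loc (n := n) (m := m) φ b c z)) :
    DifferentiableAt ℝ (form (pullForm φ W) b) z := by
  have hψ := contDiffAt_loc hz (hφ.contMDiffAt (hV.mem_nhds hzV)) hc
  have hD := (hψ.fderiv_right (m := ∞) (by simp)).differentiableAt (by simp)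
  have h2 : DifferentiableAt ℝ (fun x => form W c (loc (n := n) (m := m) φ b c x)) z :=
    DifferentiableAt.comp (g := form W c) z hW (hψ.differentiableAt (by simp))
  refine (h2.clm_comp hD).congr_of_eventuallyEq ?_
  filter_upwards [form_pullForm_eventuallyEq hV hφ W hz hzV hc] with x hx
  ext v
  exact hx v

omit [IsManifold (𝓡 n) ∞ M] [IsManifold (𝓡 m) ∞ N] in
theorem loc_center (φ : N → M) (x : N) (c : M) :
    loc (n := n) (m := m) φ x c (extChartAt (𝓡 m) x x) = extChartAt (𝓡 n) c (φ x) := by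
  rw [loc, extChartAt_to_inv]

theorem oneFormDiffAt_pullForm {φ : N → M} {V : Set N} (hV : IsOpen V)
    (hφ : ContMDiffOn (𝓡 m) (𝓡 n) ∞ φ V) {W : OneForm n M} {x : N} (hx : x ∈ V)
    (hW : OneFormDiffAt W (φ x)) : OneFormDiffAt (n := m) (pullForm φ W) x := by
  have hz := mem_extChartAt_target (I := 𝓡 m) x
  have hsz : (extChartAt (𝓡 m) x).symm (extChartAt (𝓡 m) x x) = x := by simp
  have hc := mem_extChartAt_source (I := 𝓡 n) (φ x)
  have hy := mem_extChartAt_target (I := 𝓡 n) (φ x)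
  have h := oneFormDiffAt_iff (pullForm φ W) hz
  rw [hsz] at h
  rw [h]
  refine differentiableAt_form_pullForm (c := φ x) hV hφ hz (by rwa [hsz]) (by rwa [hsz]) ?_
  rw [loc_center, ← oneFormDiffAt_iff W hy]
  simpa using hW

/-- The Levi-Civita derivative of a 1-form is smooth. -/
theorem contDiffAt_nab_loc {φ : N → M} {V : Set N} (hV : IsOpen V)
    (hφ : ContMDiffOn (𝓡 m) (𝓡 n) ∞ φ V) {h : TwoTensor n M} {U : Set M} (hh : IsMetricOn h U)
    {W : OneForm n M} {b : N} {c : M} {z : Model m}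
    (hz : z ∈ (extChartAt (𝓡 m) b).target) (hzV : (extChartAt (𝓡 m) b).symm z ∈ V)
    (hU : φ ((extChartAt (𝓡 m) b).symm z) ∈ U)
    (hc : φ ((extChartAt (𝓡 m) b).symm z) ∈ (extChartAt (𝓡 n) c).source)
    (hW : ContDiffAt ℝ ∞ (form W c) (loc (n := n) (m := m) φ b c z)) (v w : Model m) :
    ContDiffAt ℝ ∞ (fun x => nab (tens h c) (form W c) (loc (n := n) (m := m) φ b c x)
      (fderiv ℝ (loc (n := n) (m := m) φ b c) x v)
      (fderiv ℝ (loc (n := n) (m := m) φ b c) x w)) z := by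
  have hψ := contDiffAt_loc hz (hφ.contMDiffAt (hV.mem_nhds hzV)) hc
  have hy : loc (n := n) (m := m) φ b c z ∈ (extChartAt (𝓡 n) c).target :=
    (extChartAt (𝓡 n) c).map_source hc
  have hsy : (extChartAt (𝓡 n) c).symm (loc (n := n) (m := m) φ b c z)
      = φ ((extChartAt (𝓡 m) b).symm z) := (extChartAt (𝓡 n) c).left_inv hc
  have hG := hh.contDiffAt hy (by rwa [hsy])
  have hi := hh.isInvertible hy (by rwa [hsy])
  -- Expanding in the basis leaves fixed vectors inside `nab`, where smoothness in the base point is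
  -- known.
  have hexp : ∀ x, nab (tens h c) (form W c) (loc (n := n) (m := m) φ b c x)
      (fderiv ℝ (loc (n := n) (m := m) φ b c) x v) (fderiv ℝ (loc (n := n) (m := m) φ b c) x w)
      = ∑ i, ∑ j, fderiv ℝ (loc (n := n) (m := m) φ b c) x v i
        * fderiv ℝ (loc (n := n) (m := m) φ b c) x w j
        * nab (tens h c) (form W c) (loc (n := n) (m := m) φ b c x)
          (EuclideanSpace.single i (1 : ℝ)) (EuclideanSpace.single j (1 : ℝ)) := by
    intro x
    exact bilin_sum (LinearMap.mk₂ ℝ (nab (tens h c) (form W c) (loc (n := n) (m := m) φ b c x))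
      (fun a b c => by simp only [nab, ← gamL_apply, map_add, LinearMap.add_apply, add_apply]; ring)
      (fun r a b => by
        simp only [nab, ← gamL_apply, map_smul, LinearMap.smul_apply, smul_apply, smul_eq_mul]
        ring)
      (fun a b c => by simp only [nab, ← gamL_apply, map_add]; ring)
      (fun r a b => by simp only [nab, ← gamL_apply, map_smul, smul_eq_mul]; ring)) _ _
  simp only [hexp]
  have hcoord : ∀ (v : Model m) i, ContDiffAt ℝ ∞
      (fun x => fderiv ℝ (loc (n := n) (m := m) φ b c) x v i) z := fun v i =>
    (EuclideanSpace.proj i : Model n →L[ℝ] ℝ).contDiff.contDiffAt.comp z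
      (contDiffAt_fderiv_apply hψ v)
  refine ContDiffAt.sum fun i _ => ContDiffAt.sum fun j _ => ?_
  exact ((hcoord v i).mul (hcoord w j)).mul
    (ContDiffAt.comp (g := fun y => nab (tens h c) (form W c) y (EuclideanSpace.single i (1 : ℝ))
      (EuclideanSpace.single j (1 : ℝ))) z (contDiffAt_nab hG hi hW _ _) hψ)

omit [IsManifold (𝓡 n) ∞ M] [IsManifold (𝓡 m) ∞ N] in
/-- A smooth embedding has a smooth left inverse near each point of its image. -/
theorem exists_left_inverse {φ : N → M} (hφ : IsSmoothEmbedding (𝓡 m) (𝓡 n) ∞ φ) (x : N) :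
    ∃ (r : M → N) (V : Set M), IsOpen V ∧ φ x ∈ V ∧ ContMDiffOn (𝓡 n) (𝓡 m) ∞ r V ∧
      ∀ y, φ y ∈ V → r (φ y) = y := by
  have h := hφ.isImmersion.isImmersionAt x
  -- The embedding topology is used here: it excludes distant points of N whose images come close to
  -- φ x. This makes r a left inverse on all of φ⁻¹(V), not only near x.
  obtain ⟨V', hV', hV's⟩ : ∃ V' ∈ 𝓝 (φ x), φ ⁻¹' V' ⊆ h.domChart.source := by
    have : h.domChart.source ∈ 𝓝 x := h.domChart.open_source.mem_nhds h.mem_domChart_source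
    rwa [hφ.isEmbedding.nhds_eq_comap, Filter.mem_comap] at this
  obtain ⟨V₁, hV₁, hV₁o, hxV₁⟩ := mem_nhds_iff.1 hV'
  -- In the charts adapted to the immersion φ is y ↦ (y, 0), so the first component recovers y.
  let P : M → Model m := fun p => (h.equiv.symm (h.codChart.extend (𝓡 n) p)).1
  have hP : ContMDiffOn (𝓡 n) 𝓘(ℝ, Model m) ∞ P h.codChart.source := by
    have h1 := h.codChart.contMDiffOn_extend h.codChart_mem_maximalAtlas
    have h2 : ContDiff ℝ ∞ (fun y : Model n => (h.equiv.symm y).1) :=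
      contDiff_fst.comp h.equiv.symm.contDiff
    exact h2.contMDiff.comp_contMDiffOn h1
  have hPφ : ∀ y ∈ h.domChart.source, P (φ y) = h.domChart.extend (𝓡 m) y := by
    intro y hy
    have hy' : h.domChart.extend (𝓡 m) y ∈ (h.domChart.extend (𝓡 m)).target :=
      (h.domChart.extend (𝓡 m)).map_source (by rwa [OpenPartialHomeomorph.extend_source])
    have h1 := h.writtenInCharts hy'
    simp only [Function.comp_apply, OpenPartialHomeomorph.extend_left_inv _ hy] at h1
    change (h.equiv.symm (h.codChart.extend (𝓡 n) (φ y))).1 = _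
    rw [h1]
    simp
  have hsrc := h.source_subset_preimage_source
  refine ⟨fun p => (h.domChart.extend (𝓡 m)).symm (P p),
    (h.codChart.source ∩ P ⁻¹' (h.domChart.extend (𝓡 m)).target) ∩ V₁, ?_, ?_, ?_, ?_⟩
  · exact (hP.continuousOn.isOpen_inter_preimage h.codChart.open_source
      h.domChart.isOpen_extend_target).inter hV₁o
  · refine ⟨⟨h.mem_codChart_source, ?_⟩, hxV₁⟩
    rw [Set.mem_preimage, hPφ x h.mem_domChart_source]
    exact (h.domChart.extend (𝓡 m)).map_source
      (by rw [OpenPartialHomeomorph.extend_source]; exact h.mem_domChart_source)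
  · have h1 := contMDiffOn_extend_symm (I := 𝓡 m) h.domChart_mem_maximalAtlas
    rw [← OpenPartialHomeomorph.extend_target'] at h1
    exact h1.comp (hP.mono fun p hp => hp.1.1) fun p hp => hp.1.2
  · intro y hy
    have hys : y ∈ h.domChart.source := hV's (hV₁ hy.2)
    change (h.domChart.extend (𝓡 m)).symm (P (φ y)) = y
    rw [hPφ y hys, OpenPartialHomeomorph.extend_left_inv _ hys]

end Pullback

end NullPullback
end

noncomputable section

namespace NullPullback

/-! ### Composition with a smooth map is smooth on a space of continuous paths. -/

section Superposition

set_option synthInstance.maxHeartbeats 400000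

variable {X : Type} [TopologicalSpace X] [CompactSpace X]
  {E F : Type} [NormedAddCommGroup E] [NormedSpace ℝ E] [NormedAddCommGroup F] [NormedSpace ℝ F]

/-- The superposition operator `γ ↦ f ∘ γ`. -/
def superpos (f : E → F) (hf : Continuous f) (γ : C(X, E)) : C(X, F) :=
  ContinuousMap.comp ⟨f, hf⟩ γ

omit [CompactSpace X] [NormedSpace ℝ E] [NormedSpace ℝ F] in
@[simp]
theorem superpos_apply (f : E → F) (hf : Continuous f) (γ : C(X, E)) (s : X) :
    superpos f hf γ s = f (γ s) := rfl

omit [CompactSpace X] [NormedSpace ℝ E] [NormedSpace ℝ F] in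
theorem continuous_superpos (f : E → F) (hf : Continuous f) :
    Continuous (superpos (X := X) f hf) :=
  ContinuousMap.continuous_postcomp ⟨f, hf⟩

/-- Pointwise application of a continuous family of linear maps. -/
def pointwise : C(X, E →L[ℝ] F) →L[ℝ] C(X, E) →L[ℝ] C(X, F) :=
  LinearMap.mkContinuous₂
    (LinearMap.mk₂ ℝ (fun (L : C(X, E →L[ℝ] F)) (δ : C(X, E)) =>
      (⟨fun s => L s (δ s), L.continuous.clm_apply δ.continuous⟩ : C(X, F)))
      (fun _ _ _ => by ext; simp) (fun _ _ _ => by ext; simp)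
      (fun _ _ _ => by ext; simp) (fun _ _ _ => by ext; simp)) 1
    (fun L δ => by
      rw [one_mul]
      refine (ContinuousMap.norm_le _ (by positivity)).2 fun s => ?_
      exact (L s).le_of_opNorm_le_of_le (L.norm_coe_le_norm s) (δ.norm_coe_le_norm s))

@[simp]
theorem pointwise_apply (L : C(X, E →L[ℝ] F)) (δ : C(X, E)) (s : X) :
    pointwise L δ s = L s (δ s) := rfl

/-- The mean value inequality is applied on the segment from γ(s) to γ(s) + δ(s) for each s.
Continuity of the superposition operator of Df in the sup norm makes the bound uniform in s. -/
theorem hasFDerivAt_superpos {f : E → F} (hf : ContDiff ℝ ∞ f) (γ : C(X, E)) :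
    HasFDerivAt (superpos (X := X) f hf.continuous)
      (pointwise (superpos (fderiv ℝ f) (hf.continuous_fderiv (by simp)) γ)) γ := by
  rw [hasFDerivAt_iff_isLittleO_nhds_zero, Asymptotics.isLittleO_iff]
  intro ε hε
  have hc := (continuous_superpos (X := X) (fderiv ℝ f)
    (hf.continuous_fderiv (by simp))).continuousAt (x := γ)
  obtain ⟨r, hr, hr'⟩ := Metric.continuousAt_iff.1 hc ε hε
  filter_upwards [Metric.ball_mem_nhds (0 : C(X, E)) hr] with δ hδ
  rw [mem_ball_zero_iff] at hδ
  refine (ContinuousMap.norm_le _ (by positivity)).2 fun s => ?_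
  simp only [ContinuousMap.sub_apply, superpos_apply, ContinuousMap.add_apply, pointwise_apply]
  have key := (convex_segment (γ s) (γ s + δ s)).norm_image_sub_le_of_norm_fderiv_le' (f := f)
    (φ := fderiv ℝ f (γ s)) (C := ε) (fun x _ => (hf.differentiable (by simp)).differentiableAt)
    (fun x hx => ?_) (left_mem_segment ℝ _ _) (right_mem_segment ℝ _ _)
  · rw [add_sub_cancel_left] at key
    exact key.trans (mul_le_mul_of_nonneg_left (δ.norm_coe_le_norm s) hε.le)
  · rw [segment_eq_image'] at hx
    obtain ⟨t, ht, rfl⟩ := hx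
    rw [add_sub_cancel_left]
    have h1 : dist (γ + t • δ) γ < r := by
      rw [dist_eq_norm, add_sub_cancel_left, norm_smul, Real.norm_of_nonneg ht.1]
      exact lt_of_le_of_lt (mul_le_of_le_one_left (norm_nonneg _) ht.2) hδ
    have h2 := hr' h1
    rw [dist_eq_norm] at h2
    have h3 := ((superpos (X := X) (fderiv ℝ f) (hf.continuous_fderiv (by simp)) (γ + t • δ)
      - superpos (X := X) (fderiv ℝ f) (hf.continuous_fderiv (by simp)) γ).norm_coe_le_norm s).trans
      h2.le
    exact h3

/-- The derivative of a superposition operator is again one, for Df, followed by a continuous linear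
map. The target space is quantified inside the induction because Df takes values in a different
space. -/
theorem contDiff_superpos_nat (k : ℕ) : ∀ {F : Type} [NormedAddCommGroup F] [NormedSpace ℝ F]
    {f : E → F} (hf : ContDiff ℝ ∞ f), ContDiff ℝ k (superpos (X := X) f hf.continuous) := by
  induction k with
  | zero =>
    intro F _ _ f hf
    exact contDiff_zero.2 (continuous_superpos f hf.continuous)
  | succ k ih =>
    intro F _ _ f hf
    have hf' : ContDiff ℝ ∞ (fderiv ℝ f) := hf.fderiv_right (by simp)
    refine (contDiff_succ_iff_hasFDerivAt (n := k)).2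
      ⟨fun γ => pointwise (superpos (fderiv ℝ f) hf'.continuous γ), ?_,
        fun γ => hasFDerivAt_superpos hf γ⟩
    exact (ContinuousLinearMap.contDiff _).comp (ih hf')

theorem contDiff_superpos {f : E → F} (hf : ContDiff ℝ ∞ f) :
    ContDiff ℝ ∞ (superpos (X := X) f hf.continuous) :=
  contDiff_infty.2 fun k => contDiff_superpos_nat k hf

end Superposition

/-! ### Integration of paths and the fundamental theorem along a curve. -/

section Integration

set_option synthInstance.maxHeartbeats 400000

variable {E F : Type} [NormedAddCommGroup E] [NormedSpace ℝ E] [NormedAddCommGroup F]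
  [NormedSpace ℝ F] [CompleteSpace F]

/-- The extension of a path to the real line by constants. -/
def ext01 (γ : C(unitInterval, F)) (t : ℝ) : F := γ (Set.projIcc 0 1 zero_le_one t)

omit [NormedSpace ℝ F] [CompleteSpace F] in
theorem continuous_ext01 (γ : C(unitInterval, F)) : Continuous (ext01 γ) :=
  γ.continuous.comp continuous_projIcc

omit [NormedSpace ℝ F] [CompleteSpace F] in
theorem ext01_coe (γ : C(unitInterval, F)) (s : unitInterval) : ext01 γ s = γ s := by
  rw [ext01, Set.projIcc_val]

/-- The operator `γ ↦ (s ↦ ∫ₛ¹ γ)`. -/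
def integ : C(unitInterval, F) →L[ℝ] C(unitInterval, F) :=
  LinearMap.mkContinuous
    { toFun := fun γ => ⟨fun s => ∫ t in (s : ℝ)..1, ext01 γ t, by
        have h := intervalIntegral.continuous_primitive
          (fun a b => (continuous_ext01 γ).intervalIntegrable (μ := MeasureTheory.volume) a b) 1
        have e : (fun s : unitInterval => ∫ t in (s : ℝ)..1, ext01 γ t)
            = fun s : unitInterval => - ∫ t in (1 : ℝ)..s, ext01 γ t := by
          funext s
          rw [intervalIntegral.integral_symm]
        rw [e]
        exact (h.comp continuous_subtype_val).neg⟩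
      map_add' := fun γ δ => by
        ext s
        exact intervalIntegral.integral_add ((continuous_ext01 γ).intervalIntegrable _ _)
          ((continuous_ext01 δ).intervalIntegrable _ _)
      map_smul' := fun c γ => by
        ext s
        exact intervalIntegral.integral_smul c _ } 1
    (fun γ => by
      rw [one_mul]
      refine (ContinuousMap.norm_le _ (by positivity)).2 fun s => ?_
      refine (intervalIntegral.norm_integral_le_of_norm_le_const (C := ‖γ‖)
        fun t _ => γ.norm_coe_le_norm _).trans ?_
      refine mul_le_of_le_one_right (norm_nonneg _) ?_
      rw [abs_le]
      constructor <;> linarith [s.2.1, s.2.2])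

omit [CompleteSpace F] in
theorem integ_apply (γ : C(unitInterval, F)) (s : unitInterval) :
    integ γ s = ∫ t in (s : ℝ)..1, ext01 γ t := rfl

/-- Constant paths. -/
def constPath : E →L[ℝ] C(unitInterval, E) :=
  LinearMap.mkContinuous
    { toFun := fun x => ContinuousMap.const _ x
      map_add' := fun _ _ => by ext; simp
      map_smul' := fun _ _ => by ext; simp } 1
    (fun x => by
      rw [one_mul]
      exact (ContinuousMap.norm_le _ (by positivity)).2 fun s => le_rfl)

/-- The path `s ↦ s γ(s)`. -/
def timesId (γ : C(unitInterval, F)) : C(unitInterval, F) :=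
  ⟨fun s => (s : ℝ) • γ s, continuous_subtype_val.smul γ.continuous⟩

omit [CompleteSpace F] in
@[simp]
theorem timesId_apply (γ : C(unitInterval, F)) (s : unitInterval) :
    timesId γ s = (s : ℝ) • γ s := rfl

/-- The path satisfies γ' = τ v(γ) and γ(1) = x; integrate the derivative of s ↦ s f(γ(s)) from s to
1. The weight s appears because, when the end point x and the duration τ both advance along the
flow, γ(s) moves with velocity s v(γ(s)). -/
theorem ftc_along [CompleteSpace E] {f : E → F} {v : E → E} (hf : ContDiff ℝ ∞ f)
    (hv : ContDiff ℝ ∞ v)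
    {γ : C(unitInterval, E)} {x : E} {τ : ℝ}
    (hγ : γ = constPath x - τ • integ (superpos v hv.continuous γ)) (s : unitInterval) :
    f x - (s : ℝ) • f (γ s) = integ (superpos f hf.continuous γ) s
      + τ • integ (pointwise (superpos (fderiv ℝ f) (hf.continuous_fderiv (by simp)) γ)
        (timesId (superpos v hv.continuous γ))) s := by
  have hvc := continuous_ext01 (superpos v hv.continuous γ)
  let γ' : ℝ → E := fun s => x - τ • ∫ t in s..1, ext01 (superpos v hv.continuous γ) t
  have hγ' : ∀ s : unitInterval, γ' s = γ s := by
    intro s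
    conv_rhs => rw [hγ]
    rfl
  have hder : ∀ s, HasDerivAt γ' (τ • ext01 (superpos v hv.continuous γ) s) s := by
    intro s
    have h1 := intervalIntegral.integral_hasDerivAt_left (hvc.intervalIntegrable s 1)
      (hvc.stronglyMeasurableAtFilter _ _) hvc.continuousAt
    have h2 := (h1.const_smul τ).const_sub x
    simpa using h2
  have hγ'1 : γ' 1 = x := by simp [γ']
  have hg : ∀ s, HasDerivAt (fun s => s • f (γ' s))
      (s • fderiv ℝ f (γ' s) (τ • ext01 (superpos v hv.continuous γ) s) + (1 : ℝ) • f (γ' s)) s := by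
    intro s
    exact (hasDerivAt_id s).smul
      (((hf.differentiable (by simp)).differentiableAt.hasFDerivAt).comp_hasDerivAt s (hder s))
  have hcγ' : Continuous γ' := continuous_iff_continuousAt.2 fun s => (hder s).continuousAt
  have hfd : Continuous (fderiv ℝ f) := hf.continuous_fderiv (by simp)
  have hcont : Continuous fun s => s • fderiv ℝ f (γ' s)
      (τ • ext01 (superpos v hv.continuous γ) s) + (1 : ℝ) • f (γ' s) :=
    (continuous_id.smul ((hfd.comp hcγ').clm_apply (hvc.const_smul τ))).add
      ((hf.continuous.comp hcγ').const_smul _)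
  have hft := intervalIntegral.integral_eq_sub_of_hasDerivAt (a := (s : ℝ)) (b := 1)
    (fun s _ => hg s) (hcont.intervalIntegrable _ _)
  rw [one_smul, hγ'1, hγ' s] at hft
  rw [← hft, integ_apply, integ_apply, ← intervalIntegral.integral_smul]
  refine Eq.trans ?_ (intervalIntegral.integral_add ((continuous_ext01 _).intervalIntegrable _ _)
      (((continuous_ext01 _).const_smul τ).intervalIntegrable _ _))
  refine intervalIntegral.integral_congr fun t ht => ?_
  rw [Set.uIcc_of_le s.2.2] at ht
  have ht' : t ∈ Set.Icc (0 : ℝ) 1 := ⟨s.2.1.trans ht.1, ht.2⟩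
  have e : Set.projIcc 0 1 zero_le_one t = ⟨t, ht'⟩ := Set.projIcc_of_mem _ ht'
  have e' : γ' t = γ ⟨t, ht'⟩ := hγ' ⟨t, ht'⟩
  simp only [ext01, e, superpos_apply, pointwise_apply, timesId_apply, e', map_smul, one_smul]
  rw [add_comm, smul_comm]

end Integration

end NullPullback
end

noncomputable section

namespace NullPullback

/-! ### Local solution of a first order linear equation by characteristics. -/

section Transport

set_option synthInstance.maxHeartbeats 400000

variable {E : Type} [NormedAddCommGroup E] [NormedSpace ℝ E] [CompleteSpace E]

/-- The integral equation for the backward integral curves of `v`, with prescribed end point. -/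
def backward (v : E → E) (hv : ContDiff ℝ ∞ v) (ℓ : E →L[ℝ] ℝ) (x₀ : E)
    (p : E × C(unitInterval, E)) : E × C(unitInterval, E) :=
  (p.1, p.2 - constPath p.1 + ℓ (p.1 - x₀) • integ (superpos v hv.continuous p.2))

omit [CompleteSpace E] in
theorem contDiff_backward (v : E → E) (hv : ContDiff ℝ ∞ v) (ℓ : E →L[ℝ] ℝ) (x₀ : E) :
    ContDiff ℝ ∞ (backward v hv ℓ x₀) := by
  have h1 : ContDiff ℝ ∞ fun p : E × C(unitInterval, E) => constPath (E := E) p.1 :=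
    (ContinuousLinearMap.contDiff _).comp contDiff_fst
  have h2 : ContDiff ℝ ∞ fun p : E × C(unitInterval, E) => ℓ (p.1 - x₀) :=
    ℓ.contDiff.comp (contDiff_fst.sub contDiff_const)
  have h3 : ContDiff ℝ ∞ fun p : E × C(unitInterval, E) =>
      integ (superpos v hv.continuous p.2) :=
    (ContinuousLinearMap.contDiff _).comp ((contDiff_superpos hv).comp contDiff_snd)
  exact contDiff_fst.prodMk ((contDiff_snd.sub h1).add (h2.smul h3))

omit [CompleteSpace E] in
theorem hasFDerivAt_smul_integ {F : Type} [NormedAddCommGroup F] [NormedSpace ℝ F]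
    [CompleteSpace F] {f : E → F} (hf : ContDiff ℝ ∞ f) (ℓ : E →L[ℝ] ℝ) (x₀ : E)
    (p : E × C(unitInterval, E)) :
    HasFDerivAt (fun p : E × C(unitInterval, E) =>
      ℓ (p.1 - x₀) • integ (superpos f hf.continuous p.2))
      (ℓ (p.1 - x₀) • (integ.comp (pointwise (superpos (fderiv ℝ f)
        (hf.continuous_fderiv (by simp)) p.2))).comp (ContinuousLinearMap.snd ℝ _ _)
      + (ℓ.comp (ContinuousLinearMap.fst ℝ _ _)).smulRight
          (integ (superpos f hf.continuous p.2))) p := by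
  have h1 : HasFDerivAt (fun p : E × C(unitInterval, E) => ℓ (p.1 - x₀))
      (ℓ.comp (ContinuousLinearMap.fst ℝ _ _)) p :=
    ℓ.hasFDerivAt.comp p (hasFDerivAt_fst.sub_const x₀)
  have h2 : HasFDerivAt (fun p : E × C(unitInterval, E) => integ (superpos f hf.continuous p.2))
      ((integ.comp (pointwise (superpos (fderiv ℝ f)
        (hf.continuous_fderiv (by simp)) p.2))).comp (ContinuousLinearMap.snd ℝ _ _)) p :=
    ((integ (F := F)).hasFDerivAt.comp p.2 (hasFDerivAt_superpos hf p.2)).comp p hasFDerivAt_snd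
  exact h1.smul h2

theorem fderiv_backward (v : E → E) (hv : ContDiff ℝ ∞ v) (ℓ : E →L[ℝ] ℝ) (x₀ : E)
    (p w : E × C(unitInterval, E)) :
    fderiv ℝ (backward v hv ℓ x₀) p w = (w.1, w.2 - constPath w.1
      + (ℓ (p.1 - x₀) • integ (pointwise (superpos (fderiv ℝ v)
        (hv.continuous_fderiv (by simp)) p.2) w.2)
        + ℓ w.1 • integ (superpos v hv.continuous p.2))) := by
  have h1 : HasFDerivAt (fun p : E × C(unitInterval, E) => constPath (E := E) p.1)
      (constPath.comp (ContinuousLinearMap.fst ℝ _ _)) p :=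
    (constPath (E := E)).hasFDerivAt.comp p hasFDerivAt_fst
  have h2 : HasFDerivAt (backward v hv ℓ x₀) _ p :=
    hasFDerivAt_fst.prodMk ((hasFDerivAt_snd.sub h1).add (hasFDerivAt_smul_integ hv ℓ x₀ p))
  rw [h2.fderiv]
  rfl

/-- A first order linear equation `Dh(v) = F` has a local solution. -/
theorem exists_transport {v : E → E} {F : E → ℝ} (hv : ContDiff ℝ ∞ v) (hF : ContDiff ℝ ∞ F)
    (ℓ : E →L[ℝ] ℝ) (x₀ : E) (hℓ : ∀ᶠ x in 𝓝 x₀, ℓ (v x) = 1) :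
    ∃ h : E → ℝ, ∀ᶠ x in 𝓝 x₀, ContDiffAt ℝ ∞ h x ∧ fderiv ℝ h x (v x) = F x := by
  have hQ := contDiff_backward v hv ℓ x₀
  set Q := backward v hv ℓ x₀ with hQdef
  let p₀ : E × C(unitInterval, E) := (x₀, constPath x₀)
  -- At x₀ the duration ℓ(x - x₀) vanishes, so the derivative of Q is the shear (x, γ) ↦ (x, γ - K
  -- x), which is invertible without any condition on v.
  let K : E →L[ℝ] C(unitInterval, E) := constPath
    - ℓ.smulRight (integ (superpos v hv.continuous (constPath x₀)))
  let A : (E × C(unitInterval, E)) ≃L[ℝ] E × C(unitInterval, E) :=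
    ContinuousLinearEquiv.equivOfInverse'
      ((ContinuousLinearMap.fst ℝ _ _).prod
        (ContinuousLinearMap.snd ℝ _ _ - K.comp (ContinuousLinearMap.fst ℝ _ _)))
      ((ContinuousLinearMap.fst ℝ _ _).prod
        (ContinuousLinearMap.snd ℝ _ _ + K.comp (ContinuousLinearMap.fst ℝ _ _)))
      (by refine ContinuousLinearMap.ext fun w => ?_; exact Prod.ext rfl (add_sub_cancel_right _ _))
      (by refine ContinuousLinearMap.ext fun w => ?_; exact Prod.ext rfl (sub_add_cancel _ _))
  have hA : fderiv ℝ Q p₀ = (A : (E × C(unitInterval, E)) →L[ℝ] E × C(unitInterval, E)) := by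
    refine ContinuousLinearMap.ext fun w => ?_
    rw [hQdef, fderiv_backward]
    refine Prod.ext rfl ?_
    change w.2 - constPath w.1 + (ℓ (x₀ - x₀) • _ + ℓ w.1 • _) = w.2 - (constPath w.1 - ℓ w.1 • _)
    rw [sub_self, map_zero, zero_smul, zero_add]
    abel
  have hA' : HasFDerivAt Q (A : (E × C(unitInterval, E)) →L[ℝ] E × C(unitInterval, E)) p₀ := by
    rw [← hA]
    exact (hQ.differentiable (by simp)).differentiableAt.hasFDerivAt
  let e := (hQ.contDiffAt (x := p₀)).toOpenPartialHomeomorph Q hA' (by simp)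
  have he : ∀ p, e p = Q p := fun p => rfl
  have hp₀ : p₀ ∈ e.source :=
    (hQ.contDiffAt (x := p₀)).mem_toOpenPartialHomeomorph_source hA' (by simp)
  have hQp₀ : e p₀ = (x₀, 0) := by
    refine Prod.ext rfl ?_
    change constPath x₀ - constPath x₀ + ℓ (x₀ - x₀) • _ = (0 : C(unitInterval, E))
    rw [sub_self, sub_self, map_zero, zero_smul, zero_add]
  have hev : ∀ᶠ p in 𝓝 p₀, fderiv ℝ Q p ∈ Set.range
      ((↑) : ((E × C(unitInterval, E)) ≃L[ℝ] E × C(unitInterval, E)) → _) := by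
    refine (hQ.continuous_fderiv (by simp)).continuousAt.eventually ?_
    rw [hA]
    exact ContinuousLinearEquiv.nhds A
  -- g pairs y with a path ending at y that follows v for the time ℓ(y - x₀).
  let g : E → E × C(unitInterval, E) := fun y => e.symm (y, 0)
  -- The solution h = H ∘ g is the integral of F along that path, with respect to the time of the
  -- flow.
  let H : E × C(unitInterval, E) → ℝ := fun p =>
    (ℓ (p.1 - x₀) • integ (superpos F hF.continuous p.2)) 0
  have htar : ∀ᶠ y in 𝓝 x₀, (y, (0 : C(unitInterval, E))) ∈ e.target := by
    have h1 : Continuous fun y : E => (y, (0 : C(unitInterval, E))) := by fun_prop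
    refine h1.continuousAt.eventually (e.open_target.mem_nhds ?_)
    change (x₀, (0 : C(unitInterval, E))) ∈ e.target
    rw [← hQp₀]
    exact e.map_source hp₀
  have hg₀ : g x₀ = p₀ := by
    change e.symm (x₀, 0) = p₀
    rw [← hQp₀, e.left_inv hp₀]
  have hgc : ContinuousAt g x₀ := by
    have h1 : Continuous fun y : E => (y, (0 : C(unitInterval, E))) := by fun_prop
    have h2 : ContinuousAt e.symm (x₀, 0) := e.symm.continuousAt htar.self_of_nhds
    exact ContinuousAt.comp (f := fun y : E => (y, (0 : C(unitInterval, E)))) h2 h1.continuousAt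
  -- Invertibility of DQ at nearby points is needed to have the inverse smooth on a neighbourhood,
  -- not only at x₀.
  have hev' : ∀ᶠ y in 𝓝 x₀, fderiv ℝ Q (g y) ∈ Set.range
      ((↑) : ((E × C(unitInterval, E)) ≃L[ℝ] E × C(unitInterval, E)) → _) := by
    rw [← hg₀] at hev
    exact hgc.eventually hev
  refine ⟨fun y => H (g y), ?_⟩
  filter_upwards [htar.eventually_nhds, hev', hℓ] with x hx hxA hxℓ
  obtain ⟨B, hB⟩ := hxA
  have hdQ : HasFDerivAt Q (B : (E × C(unitInterval, E)) →L[ℝ] E × C(unitInterval, E)) (g x) := by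
    rw [hB]
    exact (hQ.differentiable (by simp)).differentiableAt.hasFDerivAt
  have hgs : ContDiffAt ℝ ∞ g x := by
    have h1 : ContDiffAt ℝ ∞ (fun y : E => (y, (0 : C(unitInterval, E)))) x :=
      contDiffAt_id.prodMk contDiffAt_const
    have h2 : ContDiffAt ℝ ∞ e.symm (x, 0) :=
      e.contDiffAt_symm hx.self_of_nhds hdQ hQ.contDiffAt
    exact ContDiffAt.comp x h2 h1
  have hgd := (hgs.differentiableAt (by simp)).hasFDerivAt
  have hQg : ∀ᶠ y in 𝓝 x, Q (g y) = (y, 0) := hx.mono fun y hy => e.right_inv hy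
  have hQgx := hQg.self_of_nhds
  have h1x : (g x).1 = x := congrArg Prod.fst hQgx
  have h2x : (g x).2 - constPath x + ℓ (x - x₀) • integ (superpos v hv.continuous (g x).2) = 0 := by
    have := congrArg Prod.snd hQgx
    rw [hQdef, backward, h1x] at this
    exact this
  have hγ : (g x).2 = constPath x - ℓ (x - x₀) • integ (superpos v hv.continuous (g x).2) := by
    rw [eq_sub_iff_add_eq, ← sub_eq_zero, ← h2x]
    abel
  -- The expected velocity of the path is s v(γ(s)). It is verified by applying the injective DQ:
  -- the path component must vanish, which is `ftc_along` with f = v, using that ℓ(v) = 1.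
  have hdg : fderiv ℝ g x (v x) = (v x, timesId (superpos v hv.continuous (g x).2)) := by
    apply B.injective
    have h1 : HasFDerivAt (fun y => Q (g y)) ((B : (E × C(unitInterval, E)) →L[ℝ]
        E × C(unitInterval, E)).comp (fderiv ℝ g x)) x := hdQ.comp x hgd
    have h2 : HasFDerivAt (fun y => Q (g y)) (ContinuousLinearMap.inl ℝ E C(unitInterval, E)) x :=
      (ContinuousLinearMap.inl ℝ E C(unitInterval, E)).hasFDerivAt.congr_of_eventuallyEq hQg
    have h3 := congrArg (fun L => L (v x)) (h1.unique h2)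
    refine Eq.trans h3 ?_
    have h4 : B (v x, timesId (superpos v hv.continuous (g x).2))
        = fderiv ℝ Q (g x) (v x, timesId (superpos v hv.continuous (g x).2)) := by
      rw [← hB]; rfl
    rw [h4, hQdef, fderiv_backward, h1x, hxℓ, one_smul]
    refine Prod.ext rfl ?_
    ext s
    have h5 := ftc_along hv hv hγ s
    change (0 : E) = (s : ℝ) • v ((g x).2 s) - v x + (_ + _)
    rw [← neg_sub (v x), h5]
    change _ = _ + (ℓ (x - x₀) • integ (pointwise (superpos (fderiv ℝ v)
        (hv.continuous_fderiv (by simp)) (g x).2) (timesId (superpos v hv.continuous (g x).2))) s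
        + integ (superpos v hv.continuous (g x).2) s)
    abel
  have hH : HasFDerivAt H
      ((ContinuousMap.evalCLM ℝ (0 : unitInterval) : C(unitInterval, ℝ) →L[ℝ] ℝ).comp _) (g x) :=
    (ContinuousMap.evalCLM ℝ (0 : unitInterval) : C(unitInterval, ℝ) →L[ℝ] ℝ).hasFDerivAt.comp (g x)
      (hasFDerivAt_smul_integ hF ℓ x₀ (g x))
  have hHs : ContDiff ℝ ∞ H := by
    have h2 : ContDiff ℝ ∞ fun p : E × C(unitInterval, E) => ℓ (p.1 - x₀) :=
      ℓ.contDiff.comp (contDiff_fst.sub contDiff_const)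
    have h3 : ContDiff ℝ ∞ fun p : E × C(unitInterval, E) =>
        integ (superpos F hF.continuous p.2) :=
      (ContinuousLinearMap.contDiff _).comp ((contDiff_superpos hF).comp contDiff_snd)
    exact (ContinuousMap.evalCLM ℝ (0 : unitInterval)).contDiff.comp (h2.smul h3)
  refine ⟨hHs.contDiffAt.comp x hgs, ?_⟩
  have h6 := congrArg (fun L => L (v x)) (hH.comp x hgd).fderiv
  refine Eq.trans h6 ?_
  -- The derivative of H along this velocity is the right side of `ftc_along` at s = 0, where the
  -- weight kills the value at the start of the path; what remains is F(x).
  have h7 := ftc_along hF hv hγ 0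
  simp only [ContinuousLinearMap.comp_apply, hdg]
  change (ℓ ((g x).1 - x₀) • _ + ℓ (v x) • _ : ℝ) = _
  rw [h1x, hxℓ, one_smul, add_comm]
  refine h7.symm.trans ?_
  simp

/-- A function that is smooth on an open set agrees near a given point with a globally smooth one. -/
theorem exists_contDiff_eventuallyEq {E F : Type} [NormedAddCommGroup E] [NormedSpace ℝ E]
    [HasContDiffBump E] [NormedAddCommGroup F] [NormedSpace ℝ F]
    {f : E → F} {x₀ : E} (hf : ∀ᶠ x in 𝓝 x₀, ContDiffAt ℝ ∞ f x) :
    ∃ f' : E → F, ContDiff ℝ ∞ f' ∧ f' =ᶠ[𝓝 x₀] f := by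
  obtain ⟨R, hR, hRf⟩ := Metric.eventually_nhds_iff_ball.1 hf
  let χ : ContDiffBump x₀ := ⟨R / 4, R / 2, by linarith, by linarith⟩
  refine ⟨fun x => χ x • f x, ?_, ?_⟩
  · rw [contDiff_iff_contDiffAt]
    intro x
    by_cases hx : x ∈ Metric.ball x₀ R
    · exact χ.contDiff.contDiffAt.smul (hRf x hx)
    · have h1 : x ∉ tsupport χ := by
        rw [χ.tsupport_eq, Metric.mem_closedBall]
        rw [Metric.mem_ball] at hx
        change ¬ dist x x₀ ≤ R / 2
        linarith
      have h2 : (fun x => χ x • f x) =ᶠ[𝓝 x] fun _ => 0 := by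
        filter_upwards [(isClosed_tsupport χ).isOpen_compl.mem_nhds h1] with y hy
        rw [image_eq_zero_of_notMem_tsupport hy, zero_smul]
      exact contDiffAt_const.congr_of_eventuallyEq h2
  · filter_upwards [χ.eventuallyEq_one] with x hx
    rw [hx]
    simp

/-- Dividing v and F by ℓ(v), for a functional ℓ with ℓ(v x₀) = 1, does not change the equation and
normalises ℓ(v) = 1. Cutting off with a bump function makes the data globally smooth. -/
theorem exists_transport_of_ne_zero {E : Type} [NormedAddCommGroup E] [NormedSpace ℝ E]
    [CompleteSpace E] [HasContDiffBump E] {v : E → E} {F : E → ℝ} {x₀ : E}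
    (hv : ∀ᶠ x in 𝓝 x₀, ContDiffAt ℝ ∞ v x) (hF : ∀ᶠ x in 𝓝 x₀, ContDiffAt ℝ ∞ F x)
    (h0 : v x₀ ≠ 0) :
    ∃ h : E → ℝ, ∀ᶠ x in 𝓝 x₀, ContDiffAt ℝ ∞ h x ∧ fderiv ℝ h x (v x) = F x := by
  obtain ⟨ℓ, hℓ⟩ := SeparatingDual.exists_eq_one (R := ℝ) h0
  have hne : ∀ᶠ x in 𝓝 x₀, ℓ (v x) ≠ 0 := by
    refine (ℓ.continuous.continuousAt.comp hv.self_of_nhds.continuousAt).eventually_ne ?_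
    rw [Function.comp_apply, hℓ]
    exact one_ne_zero
  have hs : ∀ᶠ x in 𝓝 x₀, ContDiffAt ℝ ∞ (fun x => (ℓ (v x))⁻¹) x := by
    filter_upwards [hv, hne] with x hx hx0
    exact (ℓ.contDiff.contDiffAt.comp x hx).inv hx0
  obtain ⟨v', hv', hvv'⟩ := exists_contDiff_eventuallyEq (f := fun x => (ℓ (v x))⁻¹ • v x)
    ((hs.and hv).mono fun x hx => hx.1.smul hx.2)
  obtain ⟨F', hF', hFF'⟩ := exists_contDiff_eventuallyEq (f := fun x => (ℓ (v x))⁻¹ • F x)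
    ((hs.and hF).mono fun x hx => hx.1.smul hx.2)
  obtain ⟨h, hh⟩ := exists_transport hv' hF' ℓ x₀ (by
    filter_upwards [hvv', hne] with x hx hx0
    rw [hx, map_smul, smul_eq_mul, inv_mul_cancel₀ hx0])
  refine ⟨h, ?_⟩
  filter_upwards [hh, hvv', hFF', hne] with x hx h1 h2 hx0
  refine ⟨hx.1, ?_⟩
  have h3 := hx.2
  rw [h1, h2, map_smul] at h3
  exact smul_right_injective ℝ (inv_ne_zero hx0) h3

end Transport

end NullPullback
end

noncomputable section

namespace NullPullback

/-! ### The differential and the gradient of u in coordinates. -/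

section Differential

set_option synthInstance.maxHeartbeats 200000

variable {n : ℕ} {M : Type*} [TopologicalSpace M] [ChartedSpace (Model n) M]
  [IsManifold (𝓡 n) ∞ M]

theorem form_diff {u : M → ℝ} (hu : ContMDiff (𝓡 n) 𝓘(ℝ, ℝ) ∞ u) {c : M} {y : Model n}
    (hy : y ∈ (extChartAt (𝓡 n) c).target) :
    form (n := n) (diff u) c y = fderiv ℝ (fun z => u ((extChartAt (𝓡 n) c).symm z)) y := by
  ext v
  exact mvfderiv_fr hy ((hu _).mdifferentiableAt (by simp)) v

theorem contDiffAt_coord {u : M → ℝ} (hu : ContMDiff (𝓡 n) 𝓘(ℝ, ℝ) ∞ u) {c : M} {y : Model n}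
    (hy : y ∈ (extChartAt (𝓡 n) c).target) :
    ContDiffAt ℝ ∞ (fun z => u ((extChartAt (𝓡 n) c).symm z)) y :=
  (contMDiffAt_iff_coord hy).1 (hu _)

theorem form_diff_eventuallyEq {u : M → ℝ} (hu : ContMDiff (𝓡 n) 𝓘(ℝ, ℝ) ∞ u) {c : M}
    {y : Model n} (hy : y ∈ (extChartAt (𝓡 n) c).target) :
    form (n := n) (diff u) c =ᶠ[𝓝 y] fderiv ℝ (fun z => u ((extChartAt (𝓡 n) c).symm z)) :=
  Filter.mem_of_superset (target_mem_nhds' hy) fun _ hz => form_diff hu hz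

theorem contDiffAt_form_diff {u : M → ℝ} (hu : ContMDiff (𝓡 n) 𝓘(ℝ, ℝ) ∞ u) {c : M}
    {y : Model n} (hy : y ∈ (extChartAt (𝓡 n) c).target) :
    ContDiffAt ℝ ∞ (form (n := n) (diff u) c) y :=
  ((contDiffAt_coord hu hy).fderiv_right (m := ∞) (by simp)).congr_of_eventuallyEq
    (form_diff_eventuallyEq hu hy)

theorem oneFormDiffAt_diff {u : M → ℝ} (hu : ContMDiff (𝓡 n) 𝓘(ℝ, ℝ) ∞ u) (p : M) :
    OneFormDiffAt (n := n) (diff u) p := by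
  have hy := mem_extChartAt_target (I := 𝓡 n) p
  have h := oneFormDiffAt_iff (n := n) (diff u) hy
  rw [extChartAt_to_inv] at h
  exact h.2 ((contDiffAt_form_diff hu hy).differentiableAt (by simp))

theorem fderiv_form_diff_symm {u : M → ℝ} (hu : ContMDiff (𝓡 n) 𝓘(ℝ, ℝ) ∞ u) {c : M}
    {y : Model n} (hy : y ∈ (extChartAt (𝓡 n) c).target) (a b : Model n) :
    fderiv ℝ (form (n := n) (diff u) c) y a b = fderiv ℝ (form (n := n) (diff u) c) y b a := by
  rw [(form_diff_eventuallyEq hu hy).fderiv_eq]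
  exact sndFDeriv_symm ((contDiffAt_coord hu hy).of_le two_le_infty) a b

theorem tens_vec_grad (g : LorentzMetric n M) (u : M → ℝ) {c : M} {y : Model n}
    (hy : y ∈ (extChartAt (𝓡 n) c).target) :
    tens g.val c y (vec (g.grad u) c y) = form (n := n) (diff u) c y := by
  ext w
  rw [tens_apply, fr_vec _ hy, g.val_grad, form_apply]

theorem contDiffAt_vec_grad (g : LorentzMetric n M) {u : M → ℝ}
    (hu : ContMDiff (𝓡 n) 𝓘(ℝ, ℝ) ∞ u) {c : M} {y : Model n}
    (hy : y ∈ (extChartAt (𝓡 n) c).target) : ContDiffAt ℝ ∞ (vec (g.grad u) c) y := by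
  have hg := g.isMetricOn
  have h1 := contDiffAt_inverse (hg.contDiffAt hy trivial) (hg.isInvertible hy trivial)
  refine (h1.clm_apply (contDiffAt_form_diff hu hy)).congr_of_eventuallyEq ?_
  filter_upwards [target_mem_nhds' hy] with z hz
  rw [← tens_vec_grad g u hz, isInvertible_inverse_apply (hg.isInvertible hz trivial)]

end Differential

/-! ### Tangent spaces of the hypersurface, and the Lie derivative as a Hessian. -/

section NullSurface

set_option synthInstance.maxHeartbeats 200000

variable {n m : ℕ} {M : Type*} [TopologicalSpace M] [ChartedSpace (Model n) M]
  {N : Type*} [TopologicalSpace N] [ChartedSpace (Model m) N]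

variable [IsManifold (𝓡 n) ∞ M] [IsManifold (𝓡 m) ∞ N]

theorem fderiv_left_inverse {φ : N → M} (hφ : ContMDiff (𝓡 m) (𝓡 n) ∞ φ) {r : M → N} {V : Set M}
    (hV : IsOpen V) (hr : ContMDiffOn (𝓡 n) (𝓡 m) ∞ r V) (hrφ : ∀ y, φ y ∈ V → r (φ y) = y)
    {b : N} {c : M} {z : Model m} (hz : z ∈ (extChartAt (𝓡 m) b).target)
    (hzV : φ ((extChartAt (𝓡 m) b).symm z) ∈ V)
    (hc : φ ((extChartAt (𝓡 m) b).symm z) ∈ (extChartAt (𝓡 n) c).source) (v : Model m) :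
    fderiv ℝ (loc (n := m) (m := n) r c b) (loc (n := n) (m := m) φ b c z)
      (fderiv ℝ (loc (n := n) (m := m) φ b c) z v) = v := by
  have hy : loc (n := n) (m := m) φ b c z ∈ (extChartAt (𝓡 n) c).target :=
    (extChartAt (𝓡 n) c).map_source hc
  have hsy : (extChartAt (𝓡 n) c).symm (loc (n := n) (m := m) φ b c z)
      = φ ((extChartAt (𝓡 m) b).symm z) := (extChartAt (𝓡 n) c).left_inv hc
  have h1 := contDiffAt_loc hz (hφ.contMDiffAt (x := (extChartAt (𝓡 m) b).symm z)) hc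
  have h2 : ContDiffAt ℝ ∞ (loc (n := m) (m := n) r c b) (loc (n := n) (m := m) φ b c z) := by
    refine contDiffAt_loc hy ?_ ?_
    · rw [hsy]; exact hr.contMDiffAt (hV.mem_nhds hzV)
    · rw [hsy, hrφ _ hzV]; exact (extChartAt (𝓡 m) b).map_target hz
  have h3 : (fun x => loc (n := m) (m := n) r c b (loc (n := n) (m := m) φ b c x))
      =ᶠ[𝓝 z] fun x => x := by
    have hO := hV.preimage hφ.continuous
    filter_upwards [eventually_loc hO hφ.contMDiffOn hz hzV hc,
      eventually_mem_of_symm hO hz hzV] with x hx hx'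
    rw [loc, loc, (extChartAt (𝓡 n) c).left_inv hx.2.2, hrφ _ hx'.2,
      (extChartAt (𝓡 m) b).right_inv hx.1]
  have h4 := fderiv_comp (g := loc (n := m) (m := n) r c b) z (h2.differentiableAt (by simp))
    (h1.differentiableAt (by simp))
  have h5 := congrArg (fun L => L v) h4
  refine h5.symm.trans ?_
  have h6 := congrArg (fun L : Model m →L[ℝ] Model m => L v) h3.fderiv_eq
  exact h6.trans (by simp)

theorem fderiv_loc_cofr {φ : N → M} (hφ : ContMDiff (𝓡 m) (𝓡 n) ∞ φ) (x : N) {b : N} {c : M}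
    (hb : x ∈ (extChartAt (𝓡 m) b).source) (hc : φ x ∈ (extChartAt (𝓡 n) c).source)
    (X : TangentSpace (𝓡 m) x) :
    fderiv ℝ (loc (n := n) (m := m) φ b c) (extChartAt (𝓡 m) b x) (cofr b x X)
      = cofr c (φ x) (push φ x X) := by
  obtain ⟨z, hz, rfl⟩ := exists_coord hb
  rw [(extChartAt (𝓡 m) b).right_inv hz, ← cofr_push hz ((hφ _).mdifferentiableAt (by simp)) hc,
    fr_cofr hz]

theorem push_injective {φ : N → M} (hφ : IsSmoothEmbedding (𝓡 m) (𝓡 n) ∞ φ) (x : N) :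
    Function.Injective (push (n := n) (m := m) φ x) := by
  rw [injective_iff_map_eq_zero]
  intro X hX
  obtain ⟨r, V, hV, hxV, hr, hrφ⟩ := exists_left_inverse hφ x
  have hz := mem_extChartAt_target (I := 𝓡 m) x
  have hb := mem_extChartAt_source (I := 𝓡 m) x
  have hc := mem_extChartAt_source (I := 𝓡 n) (φ x)
  have h1 := fderiv_loc_cofr hφ.isImmersion.contMDiff x hb hc X
  have h2 := fderiv_left_inverse (c := φ x) hφ.isImmersion.contMDiff hV hr hrφ hz
    (by rwa [extChartAt_to_inv]) (by rwa [extChartAt_to_inv]) (cofr x x X)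
  rw [h1, hX, map_zero, map_zero] at h2
  exact cofr_injective (n := m) hb (by rw [← h2, map_zero])

omit [IsManifold (𝓡 n) ∞ M] [IsManifold (𝓡 m) ∞ N] in
theorem diff_push {φ : N → M} (hφ : ContMDiff (𝓡 m) (𝓡 n) ∞ φ) {u : M → ℝ}
    (hu : ContMDiff (𝓡 n) 𝓘(ℝ, ℝ) ∞ u) (h0 : ∀ x, u (φ x) = 0) (x : N)
    (X : TangentSpace (𝓡 m) x) : diff (n := n) u (φ x) (push φ x X) = 0 := by
  have h1 := mfderiv_comp x ((hu (φ x)).mdifferentiableAt (by simp))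
    ((hφ x).mdifferentiableAt (by simp))
  have h2 : u ∘ φ = fun _ => (0 : ℝ) := funext h0
  rw [h2, mfderiv_const] at h1
  exact (DFunLike.congr_fun h1 X).symm

/-- This is `lieF_eq_hess` for W = du, whose coordinate derivative is symmetric. The metric and the
field are kept general because the relation is used both for g with ν and for ρ² g with ρ⁻² ν. -/
theorem lieF_pullTensor {h : TwoTensor n M} {U : Set M} (hh : IsMetricOn h U) (hUo : IsOpen U)
    {φ : N → M} (hφ : ContMDiff (𝓡 m) (𝓡 n) ∞ φ) {u : M → ℝ}
    (hu : ContMDiff (𝓡 n) 𝓘(ℝ, ℝ) ∞ u) {ν : VField m N}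
    (hν : ∀ x, φ x ∈ U → ∀ w, h (φ x) (push φ x (ν x)) w = diff (n := n) u (φ x) w)
    {b : N} {c : M} {z : Model m} (hz : z ∈ (extChartAt (𝓡 m) b).target)
    (hU : φ ((extChartAt (𝓡 m) b).symm z) ∈ U)
    (hc : φ ((extChartAt (𝓡 m) b).symm z) ∈ (extChartAt (𝓡 n) c).source)
    (hνd : DifferentiableAt ℝ (vec ν b) z) (a a' : Model m) :
    lieF (vec ν b) (tens (pullTensor φ h) b) z a a'
      = 2 * nab (tens h c) (form (n := n) (diff u) c) (loc (n := n) (m := m) φ b c z)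
        (fderiv ℝ (loc (n := n) (m := m) φ b c) z a)
        (fderiv ℝ (loc (n := n) (m := m) φ b c) z a') := by
  have hO := hUo.preimage hφ.continuous
  have hy : loc (n := n) (m := m) φ b c z ∈ (extChartAt (𝓡 n) c).target :=
    (extChartAt (𝓡 n) c).map_source hc
  have hsy : (extChartAt (𝓡 n) c).symm (loc (n := n) (m := m) φ b c z)
      = φ ((extChartAt (𝓡 m) b).symm z) := (extChartAt (𝓡 n) c).left_inv hc
  have hyU : (extChartAt (𝓡 n) c).symm (loc (n := n) (m := m) φ b c z) ∈ U := by rwa [hsy]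
  have hG := hh.contDiffAt hy hyU
  refine lieF_eq_hess (hG.differentiableAt (by simp)) ?_ ?_ ?_ (hh.isInvertible hy hyU)
    (hh.eventually_symm hUo hy hyU) hνd ((contDiffAt_form_diff hu hy).differentiableAt (by simp))
    (fderiv_form_diff_symm hu hy) ?_ a a'
  · exact (contDiffAt_tens_pullTensor isOpen_univ hφ.contMDiffOn hz trivial hc
      hG).differentiableAt (by simp)
  · exact (contDiffAt_loc hz hφ.contMDiffAt hc).of_le two_le_infty
  · exact tens_pullTensor_eventuallyEq isOpen_univ hφ.contMDiffOn h hz trivial hc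
  · filter_upwards [eventually_loc hO hφ.contMDiffOn hz hU hc, eventually_mem_of_symm hO hz hU]
      with x hx hxU
    ext w
    obtain ⟨w', rfl⟩ := cofr_surjective (n := n) hx.2.2 w
    rw [← cofr_push hx.1 (hx.2.1.mdifferentiableAt (by simp)) hx.2.2, fr_vec ν hx.1, loc,
      tens_cofr h hx.2.2, hν _ hxU.2]
    exact (form_cofr (n := n) (diff u) hx.2.2 w').symm

end NullSurface

/-! ### The null normal as a smooth vector field on the hypersurface. -/

section NullSurface

set_option synthInstance.maxHeartbeats 200000

variable {d : ℕ} {M : Type*} [TopologicalSpace M] [ChartedSpace (Model (d + 2)) M]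
  [IsManifold (𝓡 (d + 2)) ∞ M]
  {N : Type*} [TopologicalSpace N] [ChartedSpace (Model (d + 1)) N] [IsManifold (𝓡 (d + 1)) ∞ N]
  {g : LorentzMetric (d + 2) M} {u : M → ℝ} {φ : N → M}

omit [IsManifold (𝓡 (d + 1)) ∞ N] in
theorem IsNullSurface.contMDiff (hφ : IsNullSurface (m := d + 1) g u φ) :
    ContMDiff (𝓡 (d + 1)) (𝓡 (d + 2)) ∞ φ :=
  hφ.embedding.isImmersion.contMDiff

omit [IsManifold (𝓡 (d + 1)) ∞ N] in
theorem IsNullSurface.apply_eq_zero (hφ : IsNullSurface (m := d + 1) g u φ) (x : N) :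
    u (φ x) = 0 := by
  have h : φ x ∈ {p | u p = 0} := by rw [← hφ.range_eq]; exact ⟨x, rfl⟩
  exact h

/-- The image of the injective differential lies in the kernel of du, and both have dimension d + 1.
-/
theorem IsNullSurface.exists_push_eq (hφ : IsNullSurface (m := d + 1) g u φ)
    (hu : ContMDiff (𝓡 (d + 2)) 𝓘(ℝ, ℝ) ∞ u) (x : N) {v : TangentSpace (𝓡 (d + 2)) (φ x)}
    (hv : diff (n := d + 2) u (φ x) v = 0) :
    ∃ X, push (n := d + 2) (m := d + 1) φ x X = v := by
  let A : Model (d + 1) →ₗ[ℝ] Model (d + 2) := (push (n := d + 2) (m := d + 1) φ x).toLinearMap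
  let W : Model (d + 2) →ₗ[ℝ] ℝ := (diff (n := d + 2) u (φ x)).toLinearMap
  have hA : Function.Injective A := push_injective hφ.embedding x
  have hle : LinearMap.range A ≤ LinearMap.ker W := by
    rintro _ ⟨X, rfl⟩
    exact diff_push hφ.contMDiff hu hφ.apply_eq_zero x X
  have hW : W ≠ 0 := by
    intro h
    refine hφ.diff_ne_zero x ?_
    ext v
    exact LinearMap.congr_fun h v
  have h1 : Module.finrank ℝ (LinearMap.range A) = d + 1 := by
    rw [LinearMap.finrank_range_of_inj hA]; simp
  have h2 : Module.finrank ℝ (LinearMap.range W) = 1 := by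
    rw [LinearMap.range_eq_top.2 (LinearMap.surjective hW)]; simp
  have h3 := LinearMap.finrank_range_add_finrank_ker W
  rw [h2, finrank_euclideanSpace_fin] at h3
  have h4 := Submodule.eq_of_le_of_finrank_eq hle (by omega)
  have h5 : v ∈ LinearMap.ker W := hv
  rw [← h4] at h5
  exact h5

omit [IsManifold (𝓡 (d + 1)) ∞ N] in
theorem IsNullSurface.diff_grad (hφ : IsNullSurface (m := d + 1) g u φ) (x : N) :
    diff (n := d + 2) u (φ x) (g.grad u (φ x)) = 0 := by
  rw [← g.val_grad, hφ.null]

omit [IsManifold (𝓡 (d + 1)) ∞ N] in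
theorem IsNullSurface.grad_ne_zero (hφ : IsNullSurface (m := d + 1) g u φ) (x : N) :
    g.grad u (φ x) ≠ 0 := by
  intro h
  refine hφ.diff_ne_zero x ?_
  ext v
  rw [← g.val_grad, h, map_zero]

/-- Nullity says du(n) = 0, so n is tangent. Smoothness holds because locally ν is the image of n
under the differential of a smooth left inverse of φ. -/
theorem IsNullSurface.exists_normal (hφ : IsNullSurface (m := d + 1) g u φ)
    (hu : ContMDiff (𝓡 (d + 2)) 𝓘(ℝ, ℝ) ∞ u) : ∃ ν : VField (d + 1) N, IsNormalField g u φ ν := by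
  choose ν hν using fun x => hφ.exists_push_eq hu x (hφ.diff_grad x)
  refine ⟨ν, ⟨fun x => ?_, hν⟩⟩
  have hz := mem_extChartAt_target (I := 𝓡 (d + 1)) x
  have h0 := contMDiffAt_vec_iff ν hz
  rw [extChartAt_to_inv] at h0
  rw [h0]
  obtain ⟨r, V, hV, hxV, hr, hrφ⟩ := exists_left_inverse hφ.embedding x
  have hzV : φ ((extChartAt (𝓡 (d + 1)) x).symm (extChartAt (𝓡 (d + 1)) x x)) ∈ V := by
    rwa [extChartAt_to_inv]
  have hc : φ ((extChartAt (𝓡 (d + 1)) x).symm (extChartAt (𝓡 (d + 1)) x x))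
      ∈ (extChartAt (𝓡 (d + 2)) (φ x)).source := by
    rw [extChartAt_to_inv]; exact mem_extChartAt_source (I := 𝓡 (d + 2)) (φ x)
  have hy := (extChartAt (𝓡 (d + 2)) (φ x)).map_source hc
  have hsy := (extChartAt (𝓡 (d + 2)) (φ x)).left_inv hc
  have h1 := contDiffAt_loc hz hφ.contMDiff.contMDiffAt hc
  have h2 : ContDiffAt ℝ ∞ (loc (n := d + 1) (m := d + 2) r (φ x) x)
      (loc (n := d + 2) (m := d + 1) φ x (φ x) (extChartAt (𝓡 (d + 1)) x x)) := by
    refine contDiffAt_loc hy ?_ ?_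
    · rw [loc, hsy]; exact hr.contMDiffAt (hV.mem_nhds hzV)
    · rw [loc, hsy, hrφ _ hzV]; exact (extChartAt (𝓡 (d + 1)) x).map_target hz
  have h3 : ContDiffAt ℝ ∞ (fun z => fderiv ℝ (loc (n := d + 1) (m := d + 2) r (φ x) x)
      (loc (n := d + 2) (m := d + 1) φ x (φ x) z)) (extChartAt (𝓡 (d + 1)) x x) :=
    ContDiffAt.comp (g := fderiv ℝ (loc (n := d + 1) (m := d + 2) r (φ x) x)) _
      (h2.fderiv_right (m := ∞) (by simp)) h1
  have h4 : ContDiffAt ℝ ∞ (fun z => vec (g.grad u) (φ x)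
      (loc (n := d + 2) (m := d + 1) φ x (φ x) z)) (extChartAt (𝓡 (d + 1)) x x) :=
    ContDiffAt.comp (g := vec (g.grad u) (φ x)) _ (contDiffAt_vec_grad g hu hy) h1
  refine (h3.clm_apply h4).congr_of_eventuallyEq ?_
  have hO := hV.preimage hφ.contMDiff.continuous
  filter_upwards [eventually_loc hO hφ.contMDiff.contMDiffOn hz hzV hc,
    eventually_mem_of_symm hO hz hzV] with z hx hxV
  have h5 := cofr_push hx.1 (hx.2.1.mdifferentiableAt (by simp)) hx.2.2 (vec ν x z)
  rw [fr_vec ν hx.1, hν] at h5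
  have h6 := vec_apply (g.grad u) hx.2.2
  rw [loc, h6, h5]
  exact (fderiv_left_inverse hφ.contMDiff hV hr hrφ hx.1 hxV.2 hx.2.2 _).symm

end NullSurface

end NullPullback
end

noncomputable section

namespace NullPullback

/-! ### The Ricci difference for the conformal factor 1/f. -/

section Nab

set_option synthInstance.maxHeartbeats 200000

variable {E : Type*} [NormedAddCommGroup E] [NormedSpace ℝ E]

theorem nab_congr {G : E → E →L[ℝ] E →L[ℝ] ℝ} {W W' : E → E →L[ℝ] ℝ} {y : E}
    (h : W =ᶠ[𝓝 y] W') (v w : E) : nab G W y v w = nab G W' y v w := by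
  rw [nab, nab, h.fderiv_eq, h.self_of_nhds]

theorem nab_smul {G : E → E →L[ℝ] E →L[ℝ] ℝ} {W : E → E →L[ℝ] ℝ} {s : E → ℝ} {y : E}
    (hs : DifferentiableAt ℝ s y) (hW : DifferentiableAt ℝ W y) (v w : E) :
    nab G (fun x => s x • W x) y v w = s y * nab G W y v w + fderiv ℝ s y v * W y w := by
  rw [nab, nab, fderiv_smul_apply (f := W) hs hW]
  simp only [add_apply, smul_apply, smul_eq_mul]
  ring

/-- The Ricci tensor of `f⁻² G`, up to multiples of the metric. -/
theorem ricF_conformal_inv {n : ℕ} {G : Model n → Model n →L[ℝ] Model n →L[ℝ] ℝ}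
    {f : Model n → ℝ} {y : Model n}
    (hG : ContDiffAt ℝ ∞ G y) (hi : (G y).IsInvertible)
    (hs : ∀ᶠ x in 𝓝 y, ∀ v w, G x v w = G x w v)
    (hf : ContDiffAt ℝ ∞ f y) (h0 : f y ≠ 0) : ∃ c : ℝ, ∀ a b,
    f y * (ricF (gam G) y a b - ricF (gam fun x => (f x)⁻¹ ^ 2 • G x) y a b)
      = -((n - 2) * nab G (fderiv ℝ f) y b a) + c * G y a b := by
  have hρ : ContDiffAt ℝ ∞ (fun x => (f x)⁻¹) y := hf.inv h0
  obtain ⟨c, hc⟩ := ricF_conformal hG hi hs hρ (inv_ne_zero h0)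
  have hev : ∀ᶠ x in 𝓝 y, f x ≠ 0 := hf.continuousAt.eventually_ne h0
  have hfd : ∀ᶠ x in 𝓝 y, DifferentiableAt ℝ f x :=
    (hf.of_le (m := 1) (by simp)).eventually (by simp) |>.mono
      fun x hx => hx.differentiableAt (by simp)
  have hinv : ∀ x, f x ≠ 0 → DifferentiableAt ℝ f x →
      HasFDerivAt (fun x => (f x)⁻¹) ((-(f x ^ 2)⁻¹) • fderiv ℝ f x) x := fun x hx hd =>
    (hasDerivAt_inv hx).comp_hasFDerivAt x hd.hasFDerivAt
  -- For ρ = 1/f the form d log |ρ| is -df / f. Its covariant derivative contains df ⊗ df / f²,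
  -- which cancels the quadratic term of `ricF_conformal` and leaves only the Hessian of f.
  have hσ : (fun x => ((f x)⁻¹)⁻¹ • fderiv ℝ (fun x => (f x)⁻¹) x)
      =ᶠ[𝓝 y] fun x => (-(f x)⁻¹) • fderiv ℝ f x := by
    filter_upwards [hev, hfd] with x hx hd
    rw [(hinv x hx hd).fderiv, smul_smul]
    congr 1
    field_simp
  have hdf : DifferentiableAt ℝ (fderiv ℝ f) y :=
    (hf.fderiv_right (m := ∞) (by simp)).differentiableAt (by simp)
  have hy := hinv y h0 hfd.self_of_nhds
  refine ⟨-(f y * c), fun a b => ?_⟩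
  have hneg : HasFDerivAt (fun x => -(f x)⁻¹) (-((-(f y ^ 2)⁻¹) • fderiv ℝ f y)) y := hy.neg
  have hn : fderiv ℝ (fun x => -(f x)⁻¹) y b = (f y ^ 2)⁻¹ * fderiv ℝ f y b := by
    rw [hneg.fderiv]
    simp
  rw [hc a b, nab_congr hσ, nab_smul (s := fun x => -(f x)⁻¹) hneg.differentiableAt hdf, hn, hy.fderiv]
  simp only [smul_apply, smul_eq_mul]
  field_simp
  ring

/-- Makes the complement of the hypersurface accumulate at each of its points, so that identities
extend by continuity. -/
theorem frequently_ne_zero {f : E → ℝ} {y : E} (h : fderiv ℝ f y ≠ 0) :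
    ∃ᶠ x in 𝓝 y, f x ≠ 0 := by
  intro hev
  have h1 : f =ᶠ[𝓝 y] fun _ => 0 := hev.mono fun x hx => not_not.1 hx
  exact h (by rw [h1.fderiv_eq]; simp)

end Nab

/-! ### Passing the Ricci difference to the limit on the hypersurface. -/

section Conformal

set_option synthInstance.maxHeartbeats 200000

variable {n : ℕ} {M : Type*} [TopologicalSpace M] [ChartedSpace (Model n) M]

theorem tens_conformal (ρ : M → ℝ) (h : TwoTensor n M) (c : M) :
    tens (conformal ρ h) c
      = fun y => ρ ((extChartAt (𝓡 n) c).symm y) ^ 2 • tens h c y := by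
  funext y
  ext v w
  rfl

variable [IsManifold (𝓡 n) ∞ M]

theorem isMetricOn_conformal {h : TwoTensor n M} {U : Set M} (hh : IsMetricOn h U)
    (hU : IsOpen U) {ρ : M → ℝ} (hρ : ContMDiffOn (𝓡 n) 𝓘(ℝ, ℝ) ∞ ρ U) (h0 : ∀ p ∈ U, ρ p ≠ 0) :
    IsMetricOn (conformal ρ h) U := by
  refine ⟨fun p hp v w => ?_, fun p hp => ?_, fun p hp w hw => ?_⟩
  · change ρ p ^ 2 * h p v w = ρ p ^ 2 * h p w v
    rw [hh.symm p hp]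
  · have hy := mem_extChartAt_target (I := 𝓡 n) p
    have h1 := contMDiffAt_tensor_iff (conformal ρ h) hy
    rw [extChartAt_to_inv] at h1
    rw [h1, tens_conformal]
    have h2 : ContDiffAt ℝ ∞ (fun y => ρ ((extChartAt (𝓡 n) p).symm y)) (extChartAt (𝓡 n) p p) := by
      refine (contMDiffAt_iff_coord hy).1 ?_
      rw [extChartAt_to_inv]
      exact hρ.contMDiffAt (hU.mem_nhds hp)
    refine contDiffAt_of_apply fun v => contDiffAt_of_apply fun w => ?_
    exact (h2.pow 2).mul (((hh.contDiffAt hy (by rwa [extChartAt_to_inv])).clm_apply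
      contDiffAt_const).clm_apply contDiffAt_const)
  · refine hh.nondegenerate p hp w fun v => ?_
    have h1 : ρ p ^ 2 * h p w v = 0 := hw v
    exact (mul_eq_zero.1 h1).resolve_left (pow_ne_zero 2 (h0 p hp))

theorem IsRicciDifference.exists_eq {g : LorentzMetric n M} {u : M → ℝ} {T : TwoTensor n M}
    (hT : IsRicciDifference g u T) (hu : ContMDiff (𝓡 n) 𝓘(ℝ, ℝ) ∞ u) {p : M} (hp : u p ≠ 0) :
    ∃ c : ℝ, ∀ X Y : TangentSpace (𝓡 n) p,
      T p X Y = -((n - 2) * nablaForm g.val (diff u) p Y X) + c * g.val p X Y := by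
  have hg := g.isMetricOn
  have hUo : IsOpen {p | u p ≠ 0} := isOpen_ne_fun hu.continuous continuous_const
  have hρ : ContMDiffOn (𝓡 n) 𝓘(ℝ, ℝ) ∞ (fun p' => (u p')⁻¹) {p | u p ≠ 0} := fun q hq =>
    ((contDiffAt_inv ℝ hq).contMDiffAt.comp q (hu q)).contMDiffWithinAt
  have hm := isMetricOn_conformal (hg.mono (Set.subset_univ _)) hUo hρ fun q hq => inv_ne_zero hq
  have hy := mem_extChartAt_target (I := 𝓡 n) p
  have hu' := contDiffAt_coord hu hy
  have h0 : (fun z => u ((extChartAt (𝓡 n) p).symm z)) (extChartAt (𝓡 n) p p) ≠ 0 := by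
    simpa using hp
  obtain ⟨c, hc⟩ := ricF_conformal_inv (hg.contDiffAt hy trivial) (hg.isInvertible hy trivial)
    (hg.eventually_symm isOpen_univ hy trivial) hu' h0
  refine ⟨c, fun X Y => ?_⟩
  have h1 := hc (cofr p p X) (cofr p p Y)
  rw [hT.eq p hp, ricci_eq hg isOpen_univ trivial, ricci_eq hm hUo hp, tens_conformal,
    nablaForm_center hg isOpen_univ trivial (oneFormDiffAt_diff hu p),
    nab_congr (form_diff_eventuallyEq hu hy), ← tens_cofr g.val (mem_extChartAt_source p), ← h1]
  simp only [extChartAt_to_inv]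

/-- The coefficient c of `IsRicciDifference.exists_eq` is not controlled as u tends to 0.
Cross-multiplication eliminates it, and the resulting identity is between continuous functions, so
it survives the limit u → 0. -/
theorem IsRicciDifference.proportional {g : LorentzMetric n M} {u : M → ℝ} {T : TwoTensor n M}
    (hT : IsRicciDifference g u T) (hu : ContMDiff (𝓡 n) 𝓘(ℝ, ℝ) ∞ u) {p : M}
    (hdu : diff (n := n) u p ≠ 0) (X Y Z Z' : TangentSpace (𝓡 n) p) :
    (T p X Y + (n - 2) * nablaForm g.val (diff u) p Y X) * g.val p Z Z'
      = (T p Z Z' + (n - 2) * nablaForm g.val (diff u) p Z' Z) * g.val p X Y := by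
  have hg := g.isMetricOn
  have hy := mem_extChartAt_target (I := 𝓡 n) p
  have hps := mem_extChartAt_source (I := 𝓡 n) p
  set y := extChartAt (𝓡 n) p p with hydef
  let f : Model n → ℝ := fun z => u ((extChartAt (𝓡 n) p).symm z)
  let Ψ : Model n → Model n → Model n → ℝ := fun a b z =>
    tens T p z a b + (n - 2) * nab (tens g.val p) (form (n := n) (diff u) p) z b a
  have hΨ : ∀ a b, ContinuousAt (Ψ a b) y := fun a b =>
    (((continuousAt_tens hT.continuous hy).clm_apply continuousAt_const).clm_apply
      continuousAt_const).add (continuousAt_const.mul (contDiffAt_nab (hg.contDiffAt hy trivial)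
        (hg.isInvertible hy trivial) (contDiffAt_form_diff hu hy) b a).continuousAt)
  have hGc : ∀ a b, ContinuousAt (fun z => tens g.val p z a b) y := fun a b =>
    (((hg.contDiffAt hy trivial).continuousAt).clm_apply continuousAt_const).clm_apply
      continuousAt_const
  have hfreq : ∃ᶠ z in 𝓝 y, f z ≠ 0 := by
    refine frequently_ne_zero fun h => hdu ?_
    ext v
    have h1 := form_cofr (n := n) (diff u) hps v
    rw [form_diff hu hy, h] at h1
    exact h1.symm
  -- The chart at p stays fixed while the point varies, which is why `nablaForm_eq` is needed for
  -- arbitrary charts.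
  have hΨT : ∀ z ∈ (extChartAt (𝓡 n) p).target, ∀ a b, Ψ a b z
      = T ((extChartAt (𝓡 n) p).symm z) (fr p z a) (fr p z b) + (n - 2) * nablaForm g.val (diff u)
        ((extChartAt (𝓡 n) p).symm z) (fr p z b) (fr p z a) := by
    intro z hz a b
    rw [nablaForm_eq hg isOpen_univ trivial ((extChartAt (𝓡 n) p).map_target hz)
      (oneFormDiffAt_diff hu _), cofr_fr hz, cofr_fr hz, (extChartAt (𝓡 n) p).right_inv hz]
    rfl
  -- A nonzero difference would stay nonzero nearby, hence also at some point with u ≠ 0, where both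
  -- brackets are the same multiple of g.
  have key : ∀ a b e e', Ψ a b y * tens g.val p y e e' = Ψ e e' y * tens g.val p y a b := by
    intro a b e e'
    by_contra hne
    have h1 := (((hΨ a b).mul (hGc e e')).sub ((hΨ e e').mul (hGc a b))).eventually_ne
      (sub_ne_zero.2 hne)
    obtain ⟨z, hz, hz1, hz2⟩ := (hfreq.and_eventually (h1.and (target_mem_nhds' hy))).exists
    obtain ⟨c, hc⟩ := hT.exists_eq hu (p := (extChartAt (𝓡 n) p).symm z) hz
    refine hz1 ?_
    change Ψ a b z * tens g.val p z e e' - Ψ e e' z * tens g.val p z a b = 0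
    rw [hΨT z hz2, hΨT z hz2, hc, hc, tens_apply, tens_apply]
    ring
  have hΨp : ∀ X Y, Ψ (cofr p p X) (cofr p p Y) y
      = T p X Y + (n - 2) * nablaForm g.val (diff u) p Y X := by
    intro X Y
    rw [nablaForm_center hg isOpen_univ trivial (oneFormDiffAt_diff hu p), ← tens_cofr T hps]
  have h2 := key (cofr p p X) (cofr p p Y) (cofr p p Z) (cofr p p Z')
  rwa [hΨp, hΨp, tens_cofr g.val hps, tens_cofr g.val hps] at h2

end Conformal

section Loc

variable {n m : ℕ} {M : Type*} [TopologicalSpace M] [ChartedSpace (Model n) M]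
  {N : Type*} [TopologicalSpace N] [ChartedSpace (Model m) N]
  [IsManifold (𝓡 n) ∞ M] [IsManifold (𝓡 m) ∞ N]

theorem nab_loc {h : TwoTensor n M} {U : Set M} (hh : IsMetricOn h U) (hU : IsOpen U)
    {φ : N → M} {b : N} {c : M} {z : Model m} (hz : z ∈ (extChartAt (𝓡 m) b).target)
    (hφ : MDifferentiableAt (𝓡 m) (𝓡 n) φ ((extChartAt (𝓡 m) b).symm z))
    (hzU : φ ((extChartAt (𝓡 m) b).symm z) ∈ U)
    (hc : φ ((extChartAt (𝓡 m) b).symm z) ∈ (extChartAt (𝓡 n) c).source)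
    {W : OneForm n M} (hW : OneFormDiffAt W (φ ((extChartAt (𝓡 m) b).symm z))) (v w : Model m) :
    nab (tens h c) (form W c) (loc (n := n) (m := m) φ b c z)
        (fderiv ℝ (loc (n := n) (m := m) φ b c) z v) (fderiv ℝ (loc (n := n) (m := m) φ b c) z w)
      = nablaForm h W (φ ((extChartAt (𝓡 m) b).symm z))
        (push (n := n) (m := m) φ ((extChartAt (𝓡 m) b).symm z) (fr b z v))
        (push (n := n) (m := m) φ ((extChartAt (𝓡 m) b).symm z) (fr b z w)) := by
  rw [nablaForm_eq hh hU hzU hc hW, cofr_push hz hφ hc, cofr_push hz hφ hc]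
  rfl

end Loc

/-! ### The Lie derivative of the induced tensor is a smooth multiple of it. -/

section NullSurface

set_option synthInstance.maxHeartbeats 200000

variable {d : ℕ} {M : Type*} [TopologicalSpace M] [ChartedSpace (Model (d + 2)) M]
  [IsManifold (𝓡 (d + 2)) ∞ M]
  {N : Type*} [TopologicalSpace N] [ChartedSpace (Model (d + 1)) N] [IsManifold (𝓡 (d + 1)) ∞ N]
  {g : LorentzMetric (d + 2) M} {u : M → ℝ} {φ : N → M}

/-- The Hessian of `u`, restricted to the hypersurface, is half the Lie derivative of the induced
tensor along the normal. -/
theorem lieF_center {h : TwoTensor (d + 2) M} {U : Set M} (hh : IsMetricOn h U) (hUo : IsOpen U)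
    (hφ : ContMDiff (𝓡 (d + 1)) (𝓡 (d + 2)) ∞ φ)
    (hu : ContMDiff (𝓡 (d + 2)) 𝓘(ℝ, ℝ) ∞ u) {ν : VField (d + 1) N}
    (hν : ∀ x, φ x ∈ U → ∀ w, h (φ x) (push φ x (ν x)) w = diff (n := d + 2) u (φ x) w)
    {x : N} (hx : φ x ∈ U)
    (hνd : DifferentiableAt ℝ (vec ν x) (extChartAt (𝓡 (d + 1)) x x))
    (X Y : TangentSpace (𝓡 (d + 1)) x) :
    lieF (vec ν x) (tens (pullTensor φ h) x) (extChartAt (𝓡 (d + 1)) x x)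
        (cofr x x X) (cofr x x Y)
      = 2 * nablaForm h (diff u) (φ x) (push φ x X) (push φ x Y) := by
  have hz := mem_extChartAt_target (I := 𝓡 (d + 1)) x
  have hxs := mem_extChartAt_source (I := 𝓡 (d + 1)) x
  have hcs := mem_extChartAt_source (I := 𝓡 (d + 2)) (φ x)
  rw [lieF_pullTensor (c := φ x) hh hUo hφ hu hν hz (by rwa [extChartAt_to_inv])
    (by rwa [extChartAt_to_inv]) hνd, fderiv_loc_cofr hφ x hxs hcs, fderiv_loc_cofr hφ x hxs hcs,
    nablaForm_center hh hUo hx (oneFormDiffAt_diff hu _), loc_center]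

theorem IsNormalField.differentiableAt {ν : VField (d + 1) N} (hν : IsNormalField g u φ ν) {x : N}
    {z : Model (d + 1)} (hz : z ∈ (extChartAt (𝓡 (d + 1)) x).target) :
    DifferentiableAt ℝ (vec ν x) z :=
  ((contMDiffAt_vec_iff ν hz).1 (hν.smooth _)).differentiableAt (by simp)

theorem IsNormalField.val_push {ν : VField (d + 1) N} (hν : IsNormalField g u φ ν) (x : N)
    (w : TangentSpace (𝓡 (d + 2)) (φ x)) :
    g.val (φ x) (push φ x (ν x)) w = diff (n := d + 2) u (φ x) w := by
  rw [hν.push_eq, g.val_grad]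

theorem IsNullSurface.pullTensor_normal (hφ : IsNullSurface (m := d + 1) g u φ)
    (hu : ContMDiff (𝓡 (d + 2)) 𝓘(ℝ, ℝ) ∞ u) {ν : VField (d + 1) N}
    (hν : IsNormalField g u φ ν) (x : N) (X : TangentSpace (𝓡 (d + 1)) x) :
    pullTensor φ g.val x (ν x) X = 0 := by
  change g.val (φ x) (push φ x (ν x)) (push φ x X) = 0
  rw [hν.val_push, diff_push hφ.contMDiff hu hφ.apply_eq_zero]

/-- In dimension at least 3 the two linear conditions du(w) = 0 and g(v, w) = 0 have a common
nonzero solution. Orthogonality to the timelike v makes it spacelike, and du(w) = 0 makes it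
tangent. -/
theorem IsNullSurface.exists_pos (hφ : IsNullSurface (m := d + 1) g u φ)
    (hu : ContMDiff (𝓡 (d + 2)) 𝓘(ℝ, ℝ) ∞ u) (hd : d ≠ 0) (x : N) :
    ∃ Z : TangentSpace (𝓡 (d + 1)) x, 0 < pullTensor (m := d + 1) φ g.val x Z Z := by
  obtain ⟨v, -, hv⟩ := g.lorentzian (φ x)
  let L : Model (d + 2) →ₗ[ℝ] ℝ × ℝ :=
    LinearMap.prod (diff (n := d + 2) u (φ x)).toLinearMap (g.val (φ x) v).toLinearMap
  have hL : LinearMap.ker L ≠ ⊥ := by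
    refine LinearMap.ker_ne_bot_of_finrank_lt ?_
    rw [Module.finrank_prod, Module.finrank_self, finrank_euclideanSpace_fin]
    omega
  obtain ⟨w, hw, hw0⟩ := Submodule.exists_mem_ne_zero_of_ne_bot hL
  have hw' : L w = 0 := hw
  obtain ⟨Z, hZ⟩ := hφ.exists_push_eq hu x (v := w) (congrArg Prod.fst hw')
  refine ⟨Z, ?_⟩
  change 0 < g.val (φ x) (push φ x Z) (push φ x Z)
  rw [hZ]
  exact hv w (congrArg Prod.snd hw') hw0

/-- In dimension 2 the tangent line of the hypersurface is spanned by the null normal itself. -/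
theorem IsNullSurface.pullTensor_eq_zero (hφ : IsNullSurface (m := d + 1) g u φ)
    (hu : ContMDiff (𝓡 (d + 2)) 𝓘(ℝ, ℝ) ∞ u) {ν : VField (d + 1) N} (hν : IsNormalField g u φ ν)
    (hd : d = 0) : pullTensor (m := d + 1) φ g.val = 0 := by
  subst hd
  funext x
  have hν0 : ν x ≠ 0 := by
    intro h
    have h1 := hν.push_eq x
    rw [h, map_zero] at h1
    exact hφ.grad_ne_zero x h1.symm
  have hfr : Module.finrank ℝ (TangentSpace (𝓡 (0 + 1)) x) = 1 := by
    change Module.finrank ℝ (EuclideanSpace ℝ (Fin (0 + 1))) = 1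
    simp
  ext X Y
  obtain ⟨s, rfl⟩ := (finrank_eq_one_iff_of_nonzero' (ν x) hν0).1 hfr X
  rw [map_smul, smul_apply, hφ.pullTensor_normal hu hν]
  simp

/-- The Hessian of `u` on the hypersurface is a smooth multiple of the induced tensor. -/
theorem IsNullSurface.exists_hess_eq (hφ : IsNullSurface (m := d + 1) g u φ)
    (hu : ContMDiff (𝓡 (d + 2)) 𝓘(ℝ, ℝ) ∞ u) {ν : VField (d + 1) N} (hν : IsNormalField g u φ ν)
    {T : TwoTensor (d + 2) M} (hT : IsRicciDifference g u T) {k : N → ℝ}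
    (hk : ∀ (x : N) (X Y : TangentSpace (𝓡 (d + 1)) x),
      pullTensor φ T x X Y = k x * pullTensor φ g.val x X Y) :
    ∃ f : N → ℝ, ContMDiff (𝓡 (d + 1)) 𝓘(ℝ, ℝ) ∞ f ∧
      ∀ (x : N) (X Y : TangentSpace (𝓡 (d + 1)) x),
        2 * nablaForm g.val (diff u) (φ x) (push φ x X) (push φ x Y)
          = f x * pullTensor φ g.val x X Y := by
  have hg := g.isMetricOn
  by_cases hd : d = 0
  -- In dimension 2 the Ricci relation carries no information, as s - 2 = 0. But half the Lie
  -- derivative of q = 0 is the pulled back Hessian, which therefore vanishes.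
  · refine ⟨fun _ => 0, contMDiff_const, fun x X Y => ?_⟩
    rw [← lieF_center hg isOpen_univ hφ.contMDiff hu (fun x _ => hν.val_push x) trivial
      (hν.differentiableAt (mem_extChartAt_target x)), hφ.pullTensor_eq_zero hu hν hd]
    have h0 : tens (0 : TwoTensor (d + 1) N) x = fun _ => 0 := by
      funext y; ext v w; rfl
    rw [h0, lieF]
    simp
  have hd' : (d : ℝ) ≠ 0 := Nat.cast_ne_zero.2 hd
  -- The terms with k are the same on both sides and cancel, leaving the Hessian with the factor s -
  -- 2 = d, which is nonzero here.
  have hprop : ∀ (x : N) (X Y Z Z' : TangentSpace (𝓡 (d + 1)) x),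
      nablaForm g.val (diff u) (φ x) (push φ x Y) (push φ x X) * pullTensor φ g.val x Z Z'
        = nablaForm g.val (diff u) (φ x) (push φ x Z') (push φ x Z) * pullTensor φ g.val x X Y := by
    intro x X Y Z Z'
    have h1 := hT.proportional hu (hφ.diff_ne_zero x) (push φ x X)
      (push φ x Y) (push φ x Z) (push φ x Z')
    have hk' : ∀ X Y : TangentSpace (𝓡 (d + 1)) x, T (φ x) (push φ x X) (push φ x Y) = k x * pullTensor φ g.val x X Y := hk x
    have hg' : ∀ X Y : TangentSpace (𝓡 (d + 1)) x, g.val (φ x) (push φ x X) (push φ x Y) = pullTensor φ g.val x X Y :=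
      fun X Y => rfl
    rw [hk', hk', hg', hg'] at h1
    push_cast at h1
    refine mul_left_cancel₀ hd' ?_
    linear_combination h1
  choose Z hZ using fun x => hφ.exists_pos hu hd x
  -- The vectors Z x are chosen without any regularity in x. By `hprop` the quotient does not depend
  -- on the choice.
  refine ⟨fun x => 2 * nablaForm g.val (diff u) (φ x) (push φ x (Z x)) (push φ x (Z x))
    / pullTensor φ g.val x (Z x) (Z x), fun x => ?_, fun x X Y => ?_⟩
  swap
  · have hne := (hZ x).ne'
    rw [div_mul_eq_mul_div, eq_div_iff hne, mul_assoc, mul_assoc, hprop x Y X (Z x) (Z x)]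
    congr 2
    exact hg.symm _ trivial _ _
  have hz := mem_extChartAt_target (I := 𝓡 (d + 1)) x
  have hxs := mem_extChartAt_source (I := 𝓡 (d + 1)) x
  have hcs := mem_extChartAt_source (I := 𝓡 (d + 2)) (φ x)
  set z := extChartAt (𝓡 (d + 1)) x x with hzdef
  have hsz : (extChartAt (𝓡 (d + 1)) x).symm z = x := extChartAt_to_inv x
  have hc : φ ((extChartAt (𝓡 (d + 1)) x).symm z) ∈ (extChartAt (𝓡 (d + 2)) (φ x)).source := by
    rwa [hsz]
  have hy := (extChartAt (𝓡 (d + 2)) (φ x)).map_source hc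
  set a := cofr x x (Z x) with ha
  have hq : ContDiffAt ℝ ∞ (tens (pullTensor φ g.val) x) z :=
    contDiffAt_tens_pullTensor isOpen_univ hφ.contMDiff.contMDiffOn hz trivial hc
      (hg.contDiffAt hy trivial)
  have hqa : ContDiffAt ℝ ∞ (fun y => tens (pullTensor φ g.val) x y a a) z :=
    (hq.clm_apply contDiffAt_const).clm_apply contDiffAt_const
  have hqa0 : tens (pullTensor φ g.val) x z a a ≠ 0 := by
    rw [ha, tens_cofr _ hxs]; exact (hZ x).ne'
  have hH := contDiffAt_nab_loc isOpen_univ hφ.contMDiff.contMDiffOn hg hz trivial trivial hc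
    (contDiffAt_form_diff hu hy) a a
  -- Near x the vector Z is replaced by the one with constant coordinates a, on which q stays
  -- nonzero. The quotient is unchanged and visibly smooth.
  have h0 : ContMDiffAt (𝓡 (d + 1)) 𝓘(ℝ, ℝ) ∞ (fun x => 2 * nablaForm g.val (diff u) (φ x)
      (push φ x (Z x)) (push φ x (Z x)) / pullTensor φ g.val x (Z x) (Z x))
      ((extChartAt (𝓡 (d + 1)) x).symm z) := by
    rw [contMDiffAt_iff_coord hz]
    refine (((contDiffAt_const (c := (2 : ℝ))).mul hH).div hqa hqa0).congr_of_eventuallyEq ?_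
    filter_upwards [eventually_loc isOpen_univ hφ.contMDiff.contMDiffOn hz trivial hc,
      hqa.continuousAt.eventually_ne hqa0] with y hy hy0
    change 2 * nablaForm g.val (diff u) _ _ _ / pullTensor (m := d + 1) φ g.val _ _ _
      = 2 * nab _ _ _ _ _ / tens (pullTensor φ g.val) x y a a
    rw [div_eq_div_iff (hZ _).ne' hy0, nab_loc hg isOpen_univ hy.1
      (hy.2.1.mdifferentiableAt (by simp)) trivial hy.2.2 (oneFormDiffAt_diff hu _), mul_assoc,
      mul_assoc, tens_apply]
    congr 1
    exact hprop _ _ _ _ _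
  rwa [hsz] at h0

theorem lieProportional_of_hess (hφ : IsNullSurface (m := d + 1) g u φ)
    (hu : ContMDiff (𝓡 (d + 2)) 𝓘(ℝ, ℝ) ∞ u) {ν : VField (d + 1) N} (hν : IsNormalField g u φ ν)
    {f : N → ℝ} (hf : ∀ (x : N) (X Y : TangentSpace (𝓡 (d + 1)) x),
        2 * nablaForm g.val (diff u) (φ x) (push φ x X) (push φ x Y)
          = f x * pullTensor φ g.val x X Y) :
    LieProportional ν (pullTensor φ g.val) f Set.univ := by
  have hg := g.isMetricOn
  rw [lieProportional_iff]
  · intro x _ a b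
    have hxs := mem_extChartAt_source (I := 𝓡 (d + 1)) x
    obtain ⟨X, rfl⟩ := cofr_surjective (n := d + 1) hxs a
    obtain ⟨Y, rfl⟩ := cofr_surjective (n := d + 1) hxs b
    rw [lieF_center hg isOpen_univ hφ.contMDiff hu (fun x _ => hν.val_push x) trivial
      (hν.differentiableAt (mem_extChartAt_target x)), hf, tens_cofr _ hxs]
  · intro x _
    have hz := mem_extChartAt_target (I := 𝓡 (d + 1)) x
    have hc : φ ((extChartAt (𝓡 (d + 1)) x).symm (extChartAt (𝓡 (d + 1)) x x))
        ∈ (extChartAt (𝓡 (d + 2)) (φ x)).source := by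
      rw [extChartAt_to_inv]; exact mem_extChartAt_source (I := 𝓡 (d + 2)) (φ x)
    exact (contDiffAt_tens_pullTensor isOpen_univ hφ.contMDiff.contMDiffOn hz trivial hc
      (hg.contDiffAt ((extChartAt (𝓡 (d + 2)) (φ x)).map_source hc) trivial)).differentiableAt
      (by simp)

end NullSurface

end NullPullback
end

noncomputable section

namespace NullPullback

/-! ### Admissible conformal factors from solutions of ν(h) = -f / 2. -/

section KillingFactor

set_option synthInstance.maxHeartbeats 200000

variable {d : ℕ} {M : Type*} [TopologicalSpace M] [ChartedSpace (Model (d + 2)) M]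
  [IsManifold (𝓡 (d + 2)) ∞ M]
  {N : Type*} [TopologicalSpace N] [ChartedSpace (Model (d + 1)) N] [IsManifold (𝓡 (d + 1)) ∞ N]
  {g : LorentzMetric (d + 2) M} {u : M → ℝ} {φ : N → M}

omit [IsManifold (𝓡 (d + 2)) ∞ M] [IsManifold (𝓡 (d + 1)) ∞ N] in
theorem tens_pullTensor_conformal (ρ : M → ℝ) (h : TwoTensor (d + 2) M) (b : N) :
    tens (pullTensor φ (conformal ρ h)) b
      = fun z => ρ (φ ((extChartAt (𝓡 (d + 1)) b).symm z)) ^ 2 •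
        tens (pullTensor (m := d + 1) φ h) b z := by
  funext y
  ext v w
  rfl

omit [IsManifold (𝓡 (d + 1)) ∞ N] in
theorem vec_smul (s : N → ℝ) (ν : VField (d + 1) N) (b : N) :
    vec (fun x => s x • ν x) b
      = fun z => s ((extChartAt (𝓡 (d + 1)) b).symm z) • vec ν b z := by
  funext y
  rw [vec, vec, map_smul]

theorem differentiableAt_tens_pullTensor (hφ : ContMDiff (𝓡 (d + 1)) (𝓡 (d + 2)) ∞ φ)
    {h : TwoTensor (d + 2) M} {U : Set M} (hh : IsMetricOn h U) {x : N} (hx : φ x ∈ U) :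
    DifferentiableAt ℝ (tens (pullTensor (m := d + 1) φ h) x) (extChartAt (𝓡 (d + 1)) x x) := by
  have hz := mem_extChartAt_target (I := 𝓡 (d + 1)) x
  have hc : φ ((extChartAt (𝓡 (d + 1)) x).symm (extChartAt (𝓡 (d + 1)) x x))
      ∈ (extChartAt (𝓡 (d + 2)) (φ x)).source := by
    rw [extChartAt_to_inv]; exact mem_extChartAt_source (I := 𝓡 (d + 2)) (φ x)
  refine (contDiffAt_tens_pullTensor isOpen_univ hφ.contMDiffOn hz trivial hc
    (hh.contDiffAt ((extChartAt (𝓡 (d + 2)) (φ x)).map_source hc) ?_)).differentiableAt (by simp)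
  rwa [loc, extChartAt_to_inv (I := 𝓡 (d + 1)) x, extChartAt_to_inv]

/-- A conformal factor `exp h` with `ν h = -f / 2` on the hypersurface. -/
theorem IsNullSurface.isKillingFactor_of_exp (hφ : IsNullSurface (m := d + 1) g u φ)
    (hu : ContMDiff (𝓡 (d + 2)) 𝓘(ℝ, ℝ) ∞ u) {ν : VField (d + 1) N} (hν : IsNormalField g u φ ν)
    {f : N → ℝ} (hf : LieProportional ν (pullTensor φ g.val) f Set.univ)
    {U : Set M} (hU : IsOpen U) {ρ : M → ℝ} (hρ : ContMDiffOn (𝓡 (d + 2)) 𝓘(ℝ, ℝ) ∞ ρ U)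
    (hpos : ∀ p ∈ U, 0 < ρ p) {h : N → ℝ}
    (hh : ∀ x, φ x ∈ U → ContMDiffAt (𝓡 (d + 1)) 𝓘(ℝ, ℝ) ∞ h x)
    (hρh : ∀ x, φ x ∈ U → ρ (φ x) = Real.exp (h x))
    (hνh : ∀ x, φ x ∈ U → 2 * diff (n := d + 1) h x (ν x) = -f x) :
    IsKillingFactor g φ ν U ρ := by
  have hg := g.isMetricOn
  have hm : IsMetricOn (conformal ρ g.val) U :=
    isMetricOn_conformal (hg.mono (Set.subset_univ _)) hU hρ fun p hp => (hpos p hp).ne'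
  rw [lieProportional_iff fun x _ => differentiableAt_tens_pullTensor hφ.contMDiff hg trivial] at hf
  refine ⟨hρ, hpos, ?_⟩
  rw [lieProportional_iff (V := φ ⁻¹' U)
    fun x hx => differentiableAt_tens_pullTensor hφ.contMDiff hm hx]
  intro x hx a b
  have hz := mem_extChartAt_target (I := 𝓡 (d + 1)) x
  have hxs := mem_extChartAt_source (I := 𝓡 (d + 1)) x
  obtain ⟨a, rfl⟩ := cofr_surjective (n := d + 1) hxs a
  obtain ⟨b, rfl⟩ := cofr_surjective (n := d + 1) hxs b
  have hsz : (extChartAt (𝓡 (d + 1)) x).symm (extChartAt (𝓡 (d + 1)) x x) = x :=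
    extChartAt_to_inv x
  have hh' : ContMDiffAt (𝓡 (d + 1)) 𝓘(ℝ, ℝ) ∞ h
      ((extChartAt (𝓡 (d + 1)) x).symm (extChartAt (𝓡 (d + 1)) x x)) := by
    rw [hsz]; exact hh x hx
  have hhd := ((contMDiffAt_iff_coord hz).1 hh').differentiableAt (by simp)
  have hD := mvfderiv_fr hz (hh'.mdifferentiableAt (by simp))
    (vec ν x (extChartAt (𝓡 (d + 1)) x x))
  rw [fr_vec ν hz] at hD
  have hD' : 2 * fderiv ℝ (fun z => h ((extChartAt (𝓡 (d + 1)) x).symm z))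
      (extChartAt (𝓡 (d + 1)) x x) (vec ν x (extChartAt (𝓡 (d + 1)) x x)) = -f x := by
    rw [← hD, ← hνh x hx, hsz, diff]
  have hev : (fun z => ρ (φ ((extChartAt (𝓡 (d + 1)) x).symm z)))
      =ᶠ[𝓝 (extChartAt (𝓡 (d + 1)) x x)]
        fun z => Real.exp (h ((extChartAt (𝓡 (d + 1)) x).symm z)) := by
    filter_upwards [eventually_mem_of_symm (hU.preimage hφ.contMDiff.continuous) hz
      (by rw [hsz]; exact hx)] with z hz'
    exact hρh _ hz'.2
  have hR := hhd.hasFDerivAt.exp.congr_of_eventuallyEq hev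
  have hR0 : ρ (φ x) ≠ 0 := (hpos _ hx).ne'
  have hq0 : ∀ e, tens (pullTensor (m := d + 1) φ g.val) x (extChartAt (𝓡 (d + 1)) x x)
      (vec ν x (extChartAt (𝓡 (d + 1)) x x)) e = 0 := by
    intro e
    rw [tens_apply, fr_vec ν hz, hφ.pullTensor_normal hu hν]
  have hq0' : ∀ e, tens (pullTensor (m := d + 1) φ g.val) x (extChartAt (𝓡 (d + 1)) x x) e
      (vec ν x (extChartAt (𝓡 (d + 1)) x x)) = 0 := by
    intro e
    rw [← hq0 e]
    exact g.symm _ _ _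
  have hRd : DifferentiableAt ℝ (fun z => ρ (φ ((extChartAt (𝓡 (d + 1)) x).symm z)) ^ 2)
      (extChartAt (𝓡 (d + 1)) x x) := hR.differentiableAt.pow 2
  have hRi : DifferentiableAt ℝ (fun z => (ρ (φ ((extChartAt (𝓡 (d + 1)) x).symm z)))⁻¹)
      (extChartAt (𝓡 (d + 1)) x x) := hR.differentiableAt.inv (by rwa [hsz])
  -- Since ρ² = exp(2h), its derivative along ν is 2 ρ² ν(h) = -ρ² f. In `lieF_rescale` with factors
  -- ρ⁻¹ and ρ² this cancels the term ρ f q.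
  have hR2 : fderiv ℝ (fun z => ρ (φ ((extChartAt (𝓡 (d + 1)) x).symm z)) ^ 2)
      (extChartAt (𝓡 (d + 1)) x x) (vec ν x (extChartAt (𝓡 (d + 1)) x x))
        = -(ρ (φ x) ^ 2 * f x) := by
    have e1 := (hR.pow 2).fderiv
    rw [e1]
    simp only [smul_apply, smul_eq_mul, nsmul_eq_mul, hsz, ← hρh x hx]
    push_cast
    linear_combination ρ (φ x) ^ 2 * hD'
  rw [vec_smul (fun x => (ρ (φ x))⁻¹) ν, tens_pullTensor_conformal,
    lieF_rescale (differentiableAt_tens_pullTensor hφ.contMDiff hg trivial)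
      (hν.differentiableAt hz) hRi hRd hq0 hq0', hf x trivial, hR2]
  simp only [hsz]
  field_simp
  ring

/-- Conformal factors exist locally. -/
theorem IsNullSurface.exists_isKillingFactor_near (hφ : IsNullSurface (m := d + 1) g u φ)
    (hu : ContMDiff (𝓡 (d + 2)) 𝓘(ℝ, ℝ) ∞ u) {ν : VField (d + 1) N} (hν : IsNormalField g u φ ν)
    {f : N → ℝ} (hf : LieProportional ν (pullTensor φ g.val) f Set.univ)
    (hfs : ContMDiff (𝓡 (d + 1)) 𝓘(ℝ, ℝ) ∞ f) (x : N) :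
    ∃ (U : Set M) (ρ : M → ℝ), IsOpen U ∧ φ x ∈ U ∧ IsKillingFactor g φ ν U ρ := by
  have hz := mem_extChartAt_target (I := 𝓡 (d + 1)) x
  have hxs := mem_extChartAt_source (I := 𝓡 (d + 1)) x
  have hν0 : vec ν x (extChartAt (𝓡 (d + 1)) x x) ≠ 0 := by
    rw [vec_apply ν hxs]
    intro h
    have h1 : ν x = 0 := cofr_injective (n := d + 1) hxs (by rw [h, map_zero])
    refine hφ.grad_ne_zero x ?_
    rw [← hν.push_eq, h1, map_zero]
  have hvs : ∀ᶠ z in 𝓝 (extChartAt (𝓡 (d + 1)) x x), ContDiffAt ℝ ∞ (vec ν x) z := by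
    filter_upwards [target_mem_nhds' hz] with z hz
    exact (contMDiffAt_vec_iff ν hz).1 (hν.smooth _)
  have hFs : ∀ᶠ z in 𝓝 (extChartAt (𝓡 (d + 1)) x x),
      ContDiffAt ℝ ∞ (fun z => -f ((extChartAt (𝓡 (d + 1)) x).symm z) / 2) z := by
    filter_upwards [target_mem_nhds' hz] with z hz
    exact ((contMDiffAt_iff_coord hz).1 (hfs _)).neg.div_const 2
  obtain ⟨h, hh⟩ := exists_transport_of_ne_zero hvs hFs hν0
  obtain ⟨O, hO, hOo, hxO⟩ := eventually_nhds_iff.1 (hh.and (target_mem_nhds' hz))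
  obtain ⟨r, V, hV, hxV, hr, hrφ⟩ := exists_left_inverse hφ.embedding x
  let A : Set N := (extChartAt (𝓡 (d + 1)) x).source ∩ extChartAt (𝓡 (d + 1)) x ⁻¹' O
  have hA : IsOpen A := isOpen_extChartAt_preimage' (I := 𝓡 (d + 1)) x hOo
  have hhA : ∀ y ∈ A, ContMDiffAt (𝓡 (d + 1)) 𝓘(ℝ, ℝ) ∞
      (fun y => h (extChartAt (𝓡 (d + 1)) x y)) y := by
    intro y hy
    have h1 := hy.1
    rw [extChartAt_source] at h1
    exact (hO _ hy.2).1.1.contMDiffAt.comp y (contMDiffAt_extChartAt' (I := 𝓡 (d + 1)) h1)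
  have hUo : IsOpen (V ∩ r ⁻¹' A) := hr.continuousOn.isOpen_inter_preimage hV hA
  -- The function h lives on the hypersurface; the local retraction r carries it to an open set of
  -- M.
  refine ⟨V ∩ r ⁻¹' A, fun p => Real.exp (h (extChartAt (𝓡 (d + 1)) x (r p))), hUo,
    ⟨hxV, ?_⟩, hφ.isKillingFactor_of_exp hu hν hf hUo ?_ (fun _ _ => Real.exp_pos _)
      (h := fun y => h (extChartAt (𝓡 (d + 1)) x y)) ?_ ?_ ?_⟩
  · change r (φ x) ∈ A
    rw [hrφ x hxV]
    exact ⟨hxs, hxO⟩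
  · intro p hp
    have h1 := (hhA (r p) hp.2).comp p (hr.contMDiffAt (hV.mem_nhds hp.1))
    exact (Real.contDiff_exp.contMDiff.contMDiffAt.comp p h1).contMDiffWithinAt
  · intro y hy
    have := hy.2
    rw [Set.mem_preimage, hrφ y hy.1] at this
    exact hhA y this
  · intro y hy
    rw [hrφ y hy.1]
  · intro y hy
    have hyA := hy.2
    rw [Set.mem_preimage, hrφ y hy.1] at hyA
    have hhy := hhA y hyA
    have hO' := hO _ hyA.2
    obtain ⟨z, hz, rfl⟩ := exists_coord hyA.1
    have hD := mvfderiv_fr hz (hhy.mdifferentiableAt (by simp)) (vec ν x z)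
    have hev : (fun w => h (extChartAt (𝓡 (d + 1)) x ((extChartAt (𝓡 (d + 1)) x).symm w)))
        =ᶠ[𝓝 z] h := by
      filter_upwards [target_mem_nhds' hz] with w hw
      rw [(extChartAt (𝓡 (d + 1)) x).right_inv hw]
    rw [fr_vec ν hz, hev.fderiv_eq] at hD
    rw [(extChartAt (𝓡 (d + 1)) x).right_inv hz] at hO'
    rw [diff, hD, hO'.1.2]
    ring

end KillingFactor

end NullPullback
end

noncomputable section

namespace NullPullback

/-! ### Smooth primitives along the lines of a product. -/

section Primitive

/-- The segment from `(x, 0)` to `(x, t)`. -/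
def fibreSegment {E : Type} [NormedAddCommGroup E] [NormedSpace ℝ E] :
    E × ℝ →L[ℝ] C(unitInterval, E × ℝ) :=
  LinearMap.mkContinuous
    { toFun := fun p => ⟨fun s => (p.1, p.2 * s),
        continuous_const.prodMk (continuous_const.mul continuous_subtype_val)⟩
      map_add' := fun p q => by
        ext s
        · rfl
        · exact add_mul _ _ _
      map_smul' := fun c p => by
        ext s
        · rfl
        · exact mul_assoc _ _ _ } 1
    (fun p => by
      rw [one_mul]
      refine (ContinuousMap.norm_le _ (norm_nonneg _)).2 fun s => ?_
      refine max_le (norm_fst_le p) (le_trans ?_ (norm_snd_le p))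
      change ‖p.2 * (s : ℝ)‖ ≤ ‖p.2‖
      rw [norm_mul]
      refine mul_le_of_le_one_right (norm_nonneg _) ?_
      rw [Real.norm_eq_abs, abs_le]
      constructor <;> linarith [s.2.1, s.2.2])

/-- Rescaling t = p.2 · s turns the integral into p.2 times one over the unit interval. The latter
is a composite of smooth maps between path spaces: a linear family of segments, superposition by G,
integration and evaluation. -/
theorem contDiff_primitive {E : Type} [NormedAddCommGroup E] [NormedSpace ℝ E] {G : E × ℝ → ℝ}
    (hG : ContDiff ℝ ∞ G) : ContDiff ℝ ∞ fun p : E × ℝ => ∫ t in (0 : ℝ)..p.2, G (p.1, t) := by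
  have h1 : ContDiff ℝ ∞ fun p : E × ℝ =>
      p.2 * integ (F := ℝ) (superpos G hG.continuous (fibreSegment p)) 0 :=
    contDiff_snd.mul ((ContinuousMap.evalCLM ℝ (0 : unitInterval)).contDiff.comp
      ((integ (F := ℝ)).contDiff.comp ((contDiff_superpos hG).comp fibreSegment.contDiff)))
  convert h1 using 2 with p
  have h2 : integ (F := ℝ) (superpos G hG.continuous (fibreSegment p)) 0
      = ∫ s in (0 : ℝ)..1, G (p.1, p.2 * s) := by
    rw [integ_apply, Set.Icc.coe_zero]
    refine intervalIntegral.integral_congr fun s hs => ?_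
    rw [Set.uIcc_of_le zero_le_one] at hs
    exact ext01_coe _ (⟨s, hs⟩ : unitInterval)
  rw [h2, intervalIntegral.mul_integral_comp_mul_left (f := fun t => G (p.1, t)), mul_zero, mul_one]

variable {d : ℕ} {S : Type*} [TopologicalSpace S] [ChartedSpace (Model d) S]
  [IsManifold (𝓡 d) ∞ S]

/-- The cutoff acts only in a chart of S and leaves the whole line in t untouched, so the integral
is unaffected near s. -/
theorem contMDiff_primitive {G : S × ℝ → ℝ}
    (hG : ContMDiff ((𝓡 d).prod 𝓘(ℝ, ℝ)) 𝓘(ℝ, ℝ) ∞ G) :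
    ContMDiff ((𝓡 d).prod 𝓘(ℝ, ℝ)) 𝓘(ℝ, ℝ) ∞
      fun p : S × ℝ => ∫ t in (0 : ℝ)..p.2, G (p.1, t) := by
  rintro ⟨s, t⟩
  have hz := mem_extChartAt_target (I := 𝓡 d) s
  obtain ⟨R, hR, hRt⟩ := Metric.mem_nhds_iff.1 (target_mem_nhds' hz)
  let χ : ContDiffBump (extChartAt (𝓡 d) s s) := ⟨R / 4, R / 2, by linarith, by linarith⟩
  let K : Model d × ℝ → ℝ := fun q => χ q.1 * G ((extChartAt (𝓡 d) s).symm q.1, q.2)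
  have hGs : ∀ q : Model d × ℝ, q.1 ∈ (extChartAt (𝓡 d) s).target →
      ContDiffAt ℝ ∞ (fun q : Model d × ℝ => G ((extChartAt (𝓡 d) s).symm q.1, q.2)) q := by
    intro q hq
    have h1 : ContMDiffAt 𝓘(ℝ, Model d) (𝓡 d) ∞ (extChartAt (𝓡 d) s).symm q.1 :=
      (contMDiffOn_extChartAt_symm s).contMDiffAt (target_mem_nhds' hq)
    have h2 : ContMDiffAt 𝓘(ℝ, Model d × ℝ) (𝓡 d) ∞
        (fun q : Model d × ℝ => (extChartAt (𝓡 d) s).symm q.1) q :=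
      h1.comp q contDiff_fst.contMDiff.contMDiffAt
    exact (hG.contMDiffAt.comp q (h2.prodMk contDiff_snd.contMDiff.contMDiffAt)).contDiffAt
  have hK : ContDiff ℝ ∞ K := by
    rw [contDiff_iff_contDiffAt]
    intro q
    by_cases hq : q.1 ∈ Metric.ball (extChartAt (𝓡 d) s s) R
    · exact (χ.contDiff.contDiffAt.comp q contDiff_fst.contDiffAt).mul (hGs q (hRt hq))
    · have h0 : K =ᶠ[𝓝 q] fun _ => 0 := by
        have h1 : ∀ᶠ q' : Model d × ℝ in 𝓝 q, R / 2 < dist q'.1 (extChartAt (𝓡 d) s s) := by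
          refine (continuous_fst.dist continuous_const).continuousAt.eventually_const_lt ?_
          rw [Metric.mem_ball, not_lt] at hq
          linarith
        filter_upwards [h1] with q' hq'
        have h2 : χ q'.1 = 0 := χ.zero_of_le_dist hq'.le
        change χ q'.1 * _ = 0
        rw [h2, zero_mul]
      exact contDiffAt_const.congr_of_eventuallyEq h0
  have h1 : ContMDiffAt ((𝓡 d).prod 𝓘(ℝ, ℝ)) 𝓘(ℝ, Model d × ℝ) ∞
      (fun p : S × ℝ => (extChartAt (𝓡 d) s p.1, p.2)) (s, t) := by
    have h3 : ContMDiffAt ((𝓡 d).prod 𝓘(ℝ, ℝ)) 𝓘(ℝ, Model d) ∞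
        (fun p : S × ℝ => extChartAt (𝓡 d) s p.1) (s, t) :=
      (contMDiffAt_extChartAt (I := 𝓡 d) (n := ∞) (x := s)).comp (s, t) contMDiffAt_fst
    exact h3.prodMk_space contMDiffAt_snd
  refine ((contDiff_primitive hK).contMDiff.contMDiffAt.comp (s, t) h1).congr_of_eventuallyEq ?_
  have h3 : ∀ᶠ p : S × ℝ in 𝓝 (s, t), p.1 ∈ (extChartAt (𝓡 d) s).source ∧
      extChartAt (𝓡 d) s p.1 ∈ Metric.ball (extChartAt (𝓡 d) s s) (R / 4) := by
    have hf : ContinuousAt (Prod.fst : S × ℝ → S) (s, t) := continuous_fst.continuousAt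
    have hs : ∀ᶠ s' in 𝓝 s, s' ∈ (extChartAt (𝓡 d) s).source := extChartAt_source_mem_nhds (I := 𝓡 d) s
    exact hf.eventually (hs.and
      ((continuousAt_extChartAt (I := 𝓡 d) s).eventually (Metric.ball_mem_nhds _ (by linarith))))
  filter_upwards [h3] with p hp
  refine intervalIntegral.integral_congr fun t' _ => ?_
  change G (p.1, t') = χ (extChartAt (𝓡 d) s p.1)
    * G ((extChartAt (𝓡 d) s).symm (extChartAt (𝓡 d) s p.1), t')
  rw [χ.one_of_mem_closedBall (Metric.ball_subset_closedBall hp.2), one_mul,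
    (extChartAt (𝓡 d) s).left_inv hp.1]

end Primitive

end NullPullback
end

noncomputable section

namespace NullPullback

/-! ### A global conformal factor on a product along the null generators. -/

section Product

set_option synthInstance.maxHeartbeats 200000

variable {d : ℕ} {M : Type*} [TopologicalSpace M] [ChartedSpace (Model (d + 2)) M]
  [IsManifold (𝓡 (d + 2)) ∞ M]
  {N : Type*} [TopologicalSpace N] [ChartedSpace (Model (d + 1)) N] [IsManifold (𝓡 (d + 1)) ∞ N]
  {g : LorentzMetric (d + 2) M} {u : M → ℝ} {φ : N → M}

theorem contMDiff_diff_apply {n : ℕ} {P : Type*} [TopologicalSpace P] [ChartedSpace (Model n) P]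
    [IsManifold (𝓡 n) ∞ P] {τ : P → ℝ} (hτ : ContMDiff (𝓡 n) 𝓘(ℝ, ℝ) ∞ τ) {X : VField n P}
    (hX : SmoothVField X) : ContMDiff (𝓡 n) 𝓘(ℝ, ℝ) ∞ fun x => diff (n := n) τ x (X x) := by
  intro x
  have hz := mem_extChartAt_target (I := 𝓡 n) x
  have h0 := contMDiffAt_iff_coord (f := fun x => diff (n := n) τ x (X x)) hz
  rw [extChartAt_to_inv] at h0
  rw [h0]
  refine ((contDiffAt_form_diff hτ hz).clm_apply
    ((contMDiffAt_vec_iff X hz).1 (hX _))).congr_of_eventuallyEq ?_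
  filter_upwards [target_mem_nhds' hz] with z hz
  rw [form_apply, fr_vec X hz]

theorem hasDerivAt_along {P : Type*} [TopologicalSpace P] [ChartedSpace (Model (d + 1)) P]
    {γ : ℝ → P} {t c : ℝ} {v : TangentSpace (𝓡 (d + 1)) (γ t)}
    (hγ : MDifferentiableAt 𝓘(ℝ, ℝ) (𝓡 (d + 1)) γ t)
    (hv : mfderiv 𝓘(ℝ, ℝ) (𝓡 (d + 1)) γ t ((NormedSpace.fromTangentSpace t).symm (1 : ℝ)) = c • v)
    {h : P → ℝ} (hh : MDifferentiableAt (𝓡 (d + 1)) 𝓘(ℝ, ℝ) h (γ t)) :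
    HasDerivAt (fun t' => h (γ t')) (c * diff (n := d + 1) h (γ t) v) t := by
  have h1 := mfderiv_comp t hh hγ
  have h2 := (hh.comp t hγ).differentiableAt.hasDerivAt
  rw [mfderiv_eq_fderiv] at h1
  have h3 : fderiv ℝ (h ∘ γ) t 1 = diff (n := d + 1) h (γ t)
      (mfderiv 𝓘(ℝ, ℝ) (𝓡 (d + 1)) γ t ((NormedSpace.fromTangentSpace t).symm (1 : ℝ))) :=
    DFunLike.congr_fun h1 (1 : ℝ)
  rw [hv, map_smul, smul_eq_mul] at h3
  rw [← h3]
  exact h2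

/-- On a product along curves tangent to `ν`, the equation `ν h = -f / 2` has a global solution. -/
theorem exists_log_of_product {ν : VField (d + 1) N} (hν : SmoothVField ν)
    {f : N → ℝ} (hf : ContMDiff (𝓡 (d + 1)) 𝓘(ℝ, ℝ) ∞ f)
    {S : Type*} [TopologicalSpace S] [ChartedSpace (Model d) S] [IsManifold (𝓡 d) ∞ S]
    (Φ : Diffeomorph ((𝓡 d).prod 𝓘(ℝ, ℝ)) (𝓡 (d + 1)) (S × ℝ) N ∞)
    (hΦ : ∀ (s : S) (t : ℝ), ∃ c : ℝ,
      mfderiv 𝓘(ℝ, ℝ) (𝓡 (d + 1)) (fun t' : ℝ => Φ (s, t')) t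
        ((NormedSpace.fromTangentSpace t).symm (1 : ℝ)) = c • ν (Φ (s, t))) :
    ∃ h : N → ℝ, ContMDiff (𝓡 (d + 1)) 𝓘(ℝ, ℝ) ∞ h ∧
      ∀ x, 2 * diff (n := d + 1) h x (ν x) = -f x := by
  have hτ : ContMDiff (𝓡 (d + 1)) 𝓘(ℝ, ℝ) ∞ fun x => (Φ.symm x).2 :=
    contMDiff_snd.comp Φ.symm.contMDiff
  have hβ := contMDiff_diff_apply hτ hν
  -- The lines have velocity c ν with a c about which no regularity is given. Applying ν to the line
  -- coordinate gives a smooth β with c β = 1.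
  set β : N → ℝ := fun x => diff (n := d + 1) (fun x => (Φ.symm x).2) x (ν x) with hβdef
  have hγ : ∀ s t, MDifferentiableAt 𝓘(ℝ, ℝ) (𝓡 (d + 1)) (fun t' : ℝ => Φ (s, t')) t :=
    fun s t => (Φ.contMDiff.comp (contMDiff_const.prodMk contMDiff_id)).mdifferentiableAt (by simp)
  have hcβ : ∀ (s : S) (t c : ℝ), mfderiv 𝓘(ℝ, ℝ) (𝓡 (d + 1)) (fun t' : ℝ => Φ (s, t')) t
        ((NormedSpace.fromTangentSpace t).symm (1 : ℝ)) = c • ν (Φ (s, t)) →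
      c * β (Φ (s, t)) = 1 := by
    intro s t c hc
    have h1 := hasDerivAt_along (hγ s t) hc (hτ.mdifferentiableAt (by simp))
    simp only [Diffeomorph.symm_apply_apply] at h1
    exact h1.unique (hasDerivAt_id t)
  have hβ0 : ∀ x, β x ≠ 0 := by
    intro x
    obtain ⟨c, hc⟩ := hΦ (Φ.symm x).1 (Φ.symm x).2
    have h1 := hcβ _ _ c hc
    rw [Prod.mk.eta, Diffeomorph.apply_symm_apply] at h1
    exact right_ne_zero_of_mul_eq_one h1
  have hF : ContMDiff (𝓡 (d + 1)) 𝓘(ℝ, ℝ) ∞ fun x => -f x / 2 * (β x)⁻¹ := by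
    intro x
    have h1 : ContMDiffAt (𝓡 (d + 1)) 𝓘(ℝ, ℝ) ∞ (fun x => (β x)⁻¹) x :=
      (contDiffAt_inv ℝ (hβ0 x)).contMDiffAt.comp x (hβ x)
    have h2 : ContMDiffAt (𝓡 (d + 1)) 𝓘(ℝ, ℝ) ∞ (fun x => -f x / 2) x :=
      (contDiff_neg.div_const 2).contMDiff.contMDiffAt.comp x (hf x)
    exact h2.mul h1
  have hG := hF.comp Φ.contMDiff
  have hH := contMDiff_primitive hG
  -- Along a line, the derivative of H is c ν(H), so the integrand must be c (-f / 2), that is (-f /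
  -- 2) / β.
  let H : N → ℝ := fun x =>
    ∫ t in (0 : ℝ)..(Φ.symm x).2, -f (Φ ((Φ.symm x).1, t)) / 2 * (β (Φ ((Φ.symm x).1, t)))⁻¹
  have hh : ContMDiff (𝓡 (d + 1)) 𝓘(ℝ, ℝ) ∞ H := hH.comp Φ.symm.contMDiff
  refine ⟨H, hh, fun x => ?_⟩
  obtain ⟨⟨s, t⟩, hst⟩ : ∃ p, Φ p = x := Φ.surjective x
  subst hst
  obtain ⟨c, hc⟩ := hΦ s t
  have h1 := hasDerivAt_along (hγ s t) hc (hh.mdifferentiableAt (by simp))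
  have hHΦ : (fun t' => H (Φ (s, t')))
      = fun t' => ∫ t in (0 : ℝ)..t', -f (Φ (s, t)) / 2 * (β (Φ (s, t)))⁻¹ := by
    funext t'
    simp only [H, Diffeomorph.symm_apply_apply]
  rw [hHΦ] at h1
  have hGc : Continuous fun t' : ℝ => -f (Φ (s, t')) / 2 * (β (Φ (s, t')))⁻¹ :=
    hG.continuous.comp (continuous_const.prodMk continuous_id)
  have h2 := intervalIntegral.integral_hasDerivAt_right (hGc.intervalIntegrable 0 t)
    (hGc.stronglyMeasurableAtFilter _ _) hGc.continuousAt
  have h3 := h1.unique h2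
  have h4 := hcβ s t c hc
  have h5 := hβ0 (Φ (s, t))
  have hc0 : c ≠ 0 := left_ne_zero_of_mul_eq_one h4
  refine mul_left_cancel₀ hc0 ?_
  rw [mul_left_comm, h3, eq_inv_of_mul_eq_one_right h4]
  field_simp

/-- Being positive and equal to exp h on the hypersurface is a convex condition on the value at each
point. It is met locally by exp(h ∘ r) near the hypersurface and by 1 off it, so a partition of
unity glues. -/
theorem IsNullSurface.exists_isKillingFactor_of_log [T2Space M] [SecondCountableTopology M]
    (hφ : IsNullSurface (m := d + 1) g u φ)
    (hu : ContMDiff (𝓡 (d + 2)) 𝓘(ℝ, ℝ) ∞ u) {ν : VField (d + 1) N} (hν : IsNormalField g u φ ν)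
    {f : N → ℝ} (hf : LieProportional ν (pullTensor φ g.val) f Set.univ)
    {h : N → ℝ} (hh : ContMDiff (𝓡 (d + 1)) 𝓘(ℝ, ℝ) ∞ h)
    (hνh : ∀ x, 2 * diff (n := d + 1) h x (ν x) = -f x) :
    ∃ ρ : M → ℝ, IsKillingFactor g φ ν Set.univ ρ := by
  have : LocallyCompactSpace M := ChartedSpace.locallyCompactSpace (Model (d + 2)) M
  let t : M → Set ℝ := fun p => {y | 0 < y ∧ ∀ x, φ x = p → y = Real.exp (h x)}
  have ht : ∀ p, Convex ℝ (t p) := by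
    rintro p y₁ ⟨h1, h1'⟩ y₂ ⟨h2, h2'⟩ a b ha hb hab
    refine ⟨convex_Ioi (0 : ℝ) h1 h2 ha hb hab, fun x hx => ?_⟩
    rw [h1' x hx, h2' x hx, ← add_smul, hab, one_smul]
  obtain ⟨ρ, hρ⟩ := exists_contMDiffMap_forall_mem_convex_of_local (n := (⊤ : ℕ∞)) (𝓡 (d + 2)) ht (by
    intro p
    by_cases hp : u p = 0
    · have hp' : p ∈ Set.range φ := by rw [hφ.range_eq]; exact hp
      obtain ⟨x, rfl⟩ := hp'
      obtain ⟨r, V, hV, hxV, hr, hrφ⟩ := exists_left_inverse hφ.embedding x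
      refine ⟨V, hV.mem_nhds hxV, fun p => Real.exp (h (r p)), ?_, fun p hp => ⟨Real.exp_pos _, ?_⟩⟩
      · exact Real.contDiff_exp.contMDiff.comp_contMDiffOn (hh.comp_contMDiffOn hr)
      · rintro y rfl
        exact congrArg (fun x => Real.exp (h x)) (hrφ y hp)
    · refine ⟨{p | u p ≠ 0}, (isOpen_ne_fun hu.continuous continuous_const).mem_nhds hp,
        fun _ => 1, contMDiffOn_const, fun p hp => ⟨one_pos, ?_⟩⟩
      rintro y rfl
      exact absurd (hφ.apply_eq_zero y) hp)
  exact ⟨ρ, hφ.isKillingFactor_of_exp hu hν hf isOpen_univ ρ.contMDiff.contMDiffOn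
    (fun p _ => (hρ p).1) (fun x _ => hh x) (fun x _ => (hρ (φ x)).2 x rfl) fun x _ => hνh x⟩

end Product

end NullPullback
end

noncomputable section

namespace NullPullback

/-! ### Extending 1-forms from the hypersurface. -/

section LeftInverse

set_option synthInstance.maxHeartbeats 200000

variable {n m : ℕ} {M : Type*} [TopologicalSpace M] [ChartedSpace (Model n) M]
  {N : Type*} [TopologicalSpace N] [ChartedSpace (Model m) N]

theorem OneForm.congr_point (w : OneForm m N) {x y : N} (h : x = y) (v : Model m) :
    w x v = w y v := by
  subst h
  rfl

theorem push_left_inverse {φ : N → M} {r : M → N} {V : Set M} (hV : IsOpen V) {y : N}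
    (hφ : MDifferentiableAt (𝓡 m) (𝓡 n) φ y) (hy : φ y ∈ V)
    (hr : MDifferentiableAt (𝓡 n) (𝓡 m) r (φ y)) (hrφ : ∀ y, φ y ∈ V → r (φ y) = y)
    (v : Model m) :
    (push (n := m) (m := n) r (φ y) (push (n := n) (m := m) φ y v) : Model m) = v := by
  have h1 := mfderiv_comp y hr hφ
  have h2 : r ∘ φ =ᶠ[𝓝 y] id := by
    filter_upwards [hφ.continuousAt.eventually (hV.mem_nhds hy)] with z hz
    exact hrφ z hz
  rw [h2.mfderiv_eq, mfderiv_id] at h1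
  exact (DFunLike.congr_fun h1 v).symm

theorem pullForm_left_inverse {φ : N → M} {r : M → N} {V : Set M} (hV : IsOpen V) {y : N}
    (hφ : MDifferentiableAt (𝓡 m) (𝓡 n) φ y) (hy : φ y ∈ V)
    (hr : MDifferentiableAt (𝓡 n) (𝓡 m) r (φ y)) (hrφ : ∀ y, φ y ∈ V → r (φ y) = y)
    (w : OneForm m N) : pullForm φ (pullForm (n := m) (m := n) r w) y = w y := by
  ext v
  have h1 := push_left_inverse hV hφ hy hr hrφ v
  refine Eq.trans ?_ (OneForm.congr_point w (hrφ y hy) v)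
  exact congrArg (fun z : Model m => w (r (φ y)) z) h1

variable [IsManifold (𝓡 n) ∞ M] [IsManifold (𝓡 m) ∞ N]

/-- Every 1-form on an embedded submanifold extends, differentiably at a given point. -/
theorem exists_pullForm_eq {φ : N → M} (hφ : IsSmoothEmbedding (𝓡 m) (𝓡 n) ∞ φ) (x : N)
    {w : OneForm m N} (hw : OneFormDiffAt w x) :
    ∃ W : OneForm n M, OneFormDiffAt W (φ x) ∧ pullForm φ W = w := by
  classical
  choose r V hV hxV hr hrφ using exists_left_inverse hφ
  have : Nonempty N := ⟨x⟩
  have hφs := hφ.isImmersion.contMDiff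
  let j : M → N := fun p => if p ∈ V x then x else Function.invFun φ p
  have hj : ∀ y, φ y ∈ V (j (φ y)) := by
    intro y
    by_cases h : φ y ∈ V x
    · simpa only [j, if_pos h] using h
    · simpa only [j, if_neg h, Function.leftInverse_invFun hφ.isEmbedding.injective y] using hxV y
  refine ⟨fun p => pullForm (n := m) (m := n) (r (j p)) w p, ?_, ?_⟩
  · have h0 : OneFormDiffAt (pullForm (n := m) (m := n) (r x) w) (φ x) := by
      refine oneFormDiffAt_pullForm (hV x) (hr x) (hxV x) ?_
      rwa [hrφ x x (hxV x)]
    refine MDifferentiableAt.congr_of_eventuallyEq h0 ?_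
    filter_upwards [(hV x).mem_nhds (hxV x)] with p hp
    simp only [j, if_pos hp]
  · funext y
    exact pullForm_left_inverse (hV _) ((hφs y).mdifferentiableAt (by simp)) (hj y)
      (((hr _).contMDiffAt ((hV _).mem_nhds (hj y))).mdifferentiableAt (by simp)) (hrφ _) w

end LeftInverse

section NablaTensor

set_option synthInstance.maxHeartbeats 200000

variable {n : ℕ} {M : Type*} [TopologicalSpace M] [ChartedSpace (Model n) M]

/-- The Levi-Civita derivative of a 1-form as a 2-tensor field. -/
def nablaTensor (h : TwoTensor n M) (W : OneForm n M) : TwoTensor n M := fun p =>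
  ∑ i, ∑ j, ((EuclideanSpace.proj i).comp (cofr p p)).smulRight
    ((pd i (formComp W p j) (extChartAt (𝓡 n) p p) - ∑ k, christoffel h p k i j
      (extChartAt (𝓡 n) p p) * formComp W p k (extChartAt (𝓡 n) p p)) •
        (EuclideanSpace.proj j).comp (cofr (n := n) p p))

theorem nablaTensor_apply (h : TwoTensor n M) (W : OneForm n M) (p : M)
    (X Y : TangentSpace (𝓡 n) p) : nablaTensor h W p X Y = nablaForm h W p X Y := by
  rw [nablaTensor, nablaForm]
  simp only [sum_apply]
  refine Finset.sum_congr rfl fun i _ => Finset.sum_congr rfl fun j _ => ?_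
  change coord p X i * (_ * coord p Y j) = _
  ring

end NablaTensor

/-! ### The Gauss formula for 1-forms. -/

section SecondFundamentalForm

set_option synthInstance.maxHeartbeats 200000

variable {d : ℕ} {M : Type*} [TopologicalSpace M] [ChartedSpace (Model (d + 2)) M]
  [IsManifold (𝓡 (d + 2)) ∞ M]
  {N : Type*} [TopologicalSpace N] [ChartedSpace (Model (d + 1)) N] [IsManifold (𝓡 (d + 1)) ∞ N]
  {g : LorentzMetric (d + 2) M} {u : M → ℝ} {φ : N → M}

/-- Substituting the chain rule for φ^*W into the coordinate formula separates an intrinsic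
derivative of φ^*W from the value of W on a vector that does not involve W. Whether this vector is
tangent decides if a connection is induced. -/
theorem nablaForm_push {h : TwoTensor (d + 2) M} {U : Set M} (hh : IsMetricOn h U)
    (hU : IsOpen U) (hφ : ContMDiff (𝓡 (d + 1)) (𝓡 (d + 2)) ∞ φ) {x : N} (hx : φ x ∈ U)
    {W : OneForm (d + 2) M} (hW : OneFormDiffAt W (φ x)) (X Y : TangentSpace (𝓡 (d + 1)) x) :
    nablaForm h W (φ x) (push φ x X) (push φ x Y)
      = fderiv ℝ (form (n := d + 1) (pullForm φ W) x) (extChartAt (𝓡 (d + 1)) x x)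
          (cofr x x X) (cofr x x Y)
        - form W (φ x) (extChartAt (𝓡 (d + 2)) (φ x) (φ x))
          (fderiv ℝ (fderiv ℝ (loc (n := d + 2) (m := d + 1) φ x (φ x)))
              (extChartAt (𝓡 (d + 1)) x x) (cofr x x X) (cofr x x Y)
            + gam (tens h (φ x)) (extChartAt (𝓡 (d + 2)) (φ x) (φ x))
                (cofr (φ x) (φ x) (push φ x X)) (cofr (φ x) (φ x) (push φ x Y))) := by
  have hz := mem_extChartAt_target (I := 𝓡 (d + 1)) x
  have hxs := mem_extChartAt_source (I := 𝓡 (d + 1)) x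
  have hcs := mem_extChartAt_source (I := 𝓡 (d + 2)) (φ x)
  have hy := mem_extChartAt_target (I := 𝓡 (d + 2)) (φ x)
  have hsz : (extChartAt (𝓡 (d + 1)) x).symm (extChartAt (𝓡 (d + 1)) x x) = x :=
    extChartAt_to_inv x
  have hc : φ ((extChartAt (𝓡 (d + 1)) x).symm (extChartAt (𝓡 (d + 1)) x x))
      ∈ (extChartAt (𝓡 (d + 2)) (φ x)).source := by rwa [hsz]
  have hWd : DifferentiableAt ℝ (form W (φ x))
      (loc (n := d + 2) (m := d + 1) φ x (φ x) (extChartAt (𝓡 (d + 1)) x x)) := by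
    rw [loc_center, ← oneFormDiffAt_iff W hy, extChartAt_to_inv]
    exact hW
  have hψ := contDiffAt_loc hz (hφ _) hc
  have h1 := fderiv_pull₁ hWd
    (differentiableAt_form_pullForm isOpen_univ hφ.contMDiffOn hz trivial hc hWd)
    (hψ.of_le two_le_infty)
    (form_pullForm_eventuallyEq isOpen_univ hφ.contMDiffOn W hz trivial hc)
    (cofr x x X) (cofr x x Y)
  rw [fderiv_loc_cofr hφ x hxs hcs, fderiv_loc_cofr hφ x hxs hcs, loc_center] at h1
  rw [nablaForm_center hh hU hx hW, nab, h1, map_add]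
  ring

/-- If the Hessian of `u` vanishes on the hypersurface, the tangential part of the Levi-Civita
derivative of a 1-form depends only on its pullback. -/
theorem IsNullSurface.exists_nablaForm_push (hφ : IsNullSurface (m := d + 1) g u φ)
    (hu : ContMDiff (𝓡 (d + 2)) 𝓘(ℝ, ℝ) ∞ u) {h : TwoTensor (d + 2) M} {U : Set M}
    (hh : IsMetricOn h U) (hU : IsOpen U) {x : N} (hx : φ x ∈ U) (X Y : TangentSpace (𝓡 (d + 1)) x)
    (hess : nablaForm h (diff u) (φ x) (push φ x X) (push φ x Y) = 0) :
    ∃ Z : TangentSpace (𝓡 (d + 1)) x, ∀ W : OneForm (d + 2) M, OneFormDiffAt W (φ x) →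
      nablaForm h W (φ x) (push φ x X) (push φ x Y)
        = fderiv ℝ (form (n := d + 1) (pullForm φ W) x) (extChartAt (𝓡 (d + 1)) x x)
            (cofr x x X) (cofr x x Y) - pullForm φ W x Z := by
  have hcs := mem_extChartAt_source (I := 𝓡 (d + 2)) (φ x)
  obtain ⟨v, hv⟩ := cofr_surjective (n := d + 2) hcs
    (fderiv ℝ (fderiv ℝ (loc (n := d + 2) (m := d + 1) φ x (φ x)))
        (extChartAt (𝓡 (d + 1)) x x) (cofr x x X) (cofr x x Y)
      + gam (tens h (φ x)) (extChartAt (𝓡 (d + 2)) (φ x) (φ x))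
          (cofr (φ x) (φ x) (push φ x X)) (cofr (φ x) (φ x) (push φ x Y)))
  have hW := fun (W : OneForm (d + 2) M) (hW : OneFormDiffAt W (φ x)) =>
    nablaForm_push hh hU hφ.contMDiff hx hW X Y
  simp only [← hv] at hW
  -- Testing with W = du, whose pullback is 0, shows that the Hessian is -du(v). Its vanishing makes
  -- v tangent, v = push Z.
  have h0 : form (n := d + 1) (pullForm φ (diff (n := d + 2) u)) x = fun _ => 0 := by
    funext z
    ext v
    exact diff_push hφ.contMDiff hu hφ.apply_eq_zero _ _
  have h1 := hW _ (oneFormDiffAt_diff hu (φ x))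
  rw [hess, h0, form_cofr _ hcs] at h1
  simp only [fderiv_fun_const, Pi.zero_apply, zero_apply, zero_sub] at h1
  obtain ⟨Z, rfl⟩ := hφ.exists_push_eq hu x (v := v) (by linarith)
  refine ⟨Z, fun W hWd => ?_⟩
  rw [hW W hWd, form_cofr _ hcs]
  rfl

end SecondFundamentalForm

end NullPullback
end

noncomputable section

namespace NullPullback

/-! ### Admissibility kills the Hessian of u for the rescaled metric. -/

section Hessian

set_option synthInstance.maxHeartbeats 200000

variable {d : ℕ} {M : Type*} [TopologicalSpace M] [ChartedSpace (Model (d + 2)) M]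
  [IsManifold (𝓡 (d + 2)) ∞ M]
  {N : Type*} [TopologicalSpace N] [ChartedSpace (Model (d + 1)) N] [IsManifold (𝓡 (d + 1)) ∞ N]
  {g : LorentzMetric (d + 2) M} {u : M → ℝ} {φ : N → M}

/-- For the rescaled metric, the Hessian of `u` vanishes on the hypersurface. -/
theorem IsKillingFactor.hess_eq_zero {ν : VField (d + 1) N} {U : Set M} {ρ : M → ℝ}
    (hρ : IsKillingFactor g φ ν U ρ) (hφ : IsNullSurface (m := d + 1) g u φ)
    (hu : ContMDiff (𝓡 (d + 2)) 𝓘(ℝ, ℝ) ∞ u) (hν : IsNormalField g u φ ν) (hU : IsOpen U)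
    {x : N} (hx : φ x ∈ U) (X Y : TangentSpace (𝓡 (d + 1)) x) :
    nablaForm (conformal ρ g.val) (diff u) (φ x) (push φ x X) (push φ x Y) = 0 := by
  have hm : IsMetricOn (conformal ρ g.val) U :=
    isMetricOn_conformal (g.isMetricOn.mono (Set.subset_univ _)) hU hρ.smooth
      fun p hp => (hρ.pos p hp).ne'
  have hz := mem_extChartAt_target (I := 𝓡 (d + 1)) x
  have hsz : (extChartAt (𝓡 (d + 1)) x).symm (extChartAt (𝓡 (d + 1)) x x) = x :=
    extChartAt_to_inv x
  have hs : DifferentiableAt ℝ (fun z => (ρ (φ ((extChartAt (𝓡 (d + 1)) x).symm z)))⁻¹)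
      (extChartAt (𝓡 (d + 1)) x x) := by
    refine DifferentiableAt.inv ?_ (by rw [hsz]; exact (hρ.pos _ hx).ne')
    rw [← mdifferentiableAt_iff_coord (f := fun x => ρ (φ x)) hz, hsz]
    exact ((hρ.smooth.contMDiffAt (hU.mem_nhds hx)).comp x (hφ.contMDiff x)).mdifferentiableAt
      (by simp)
  have hqd := differentiableAt_tens_pullTensor hφ.contMDiff hm hx
  have hk := (lieProportional_iff (V := φ ⁻¹' U)
    fun x hx => differentiableAt_tens_pullTensor hφ.contMDiff hm hx).1 hρ.killing x hx
    (cofr x x X) (cofr x x Y)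
  have hνd : DifferentiableAt ℝ (vec (fun x => (ρ (φ x))⁻¹ • ν x) x)
      (extChartAt (𝓡 (d + 1)) x x) := by
    rw [vec_smul (fun x => (ρ (φ x))⁻¹) ν]
    exact hs.smul (hν.differentiableAt hz)
  have hq0 : ∀ e, tens (pullTensor (m := d + 1) φ (conformal ρ g.val)) x
      (extChartAt (𝓡 (d + 1)) x x)
      (vec (fun x => (ρ (φ x))⁻¹ • ν x) x (extChartAt (𝓡 (d + 1)) x x)) e = 0 := by
    intro e
    rw [tens_pullTensor_conformal, vec_smul (fun x => (ρ (φ x))⁻¹) ν]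
    simp only [smul_apply, map_smul]
    rw [tens_apply, fr_vec ν hz, hφ.pullTensor_normal hu hν]
    simp
  have hq0' : ∀ e, tens (pullTensor (m := d + 1) φ (conformal ρ g.val)) x
      (extChartAt (𝓡 (d + 1)) x x) e
      (vec (fun x => (ρ (φ x))⁻¹ • ν x) x (extChartAt (𝓡 (d + 1)) x x)) = 0 := by
    intro e
    rw [← hq0 e]
    exact hm.symm _ (by rw [hsz]; exact hx) _ _
  -- Admissibility concerns ρ⁻¹ n, but the gradient of u for ρ² g is ρ⁻² n. The further factor ρ⁻¹
  -- is harmless because n is in the kernel of the induced tensor.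
  have h1 := lieF_rescale (t := fun _ => 1) hqd hνd hs (differentiableAt_const _) hq0 hq0'
    (cofr x x X) (cofr x x Y)
  simp only [one_smul, fderiv_fun_const, Pi.zero_apply, zero_apply, hk, zero_mul, mul_zero,
    add_zero] at h1
  rw [← vec_smul (fun x => (ρ (φ x))⁻¹) (fun x => (ρ (φ x))⁻¹ • ν x)] at h1
  rw [lieF_center hm hU hφ.contMDiff hu _ hx] at h1
  · linarith
  · rw [vec_smul (fun x => (ρ (φ x))⁻¹) (fun x => (ρ (φ x))⁻¹ • ν x)]
    exact hs.smul hνd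
  · intro y hy w
    have h0 := (hρ.pos _ hy).ne'
    rw [map_smul, map_smul, smul_apply, map_smul, map_smul, smul_apply, ← hν.val_push]
    change _ * (_ * (ρ (φ y) ^ 2 * g.val (φ y) (push φ y (ν y)) w)) = _
    field_simp

end Hessian

/-! ### Existence, smoothness and uniqueness of the pullback connection. -/

section Connection

set_option synthInstance.maxHeartbeats 200000

variable {d : ℕ} {M : Type*} [TopologicalSpace M] [ChartedSpace (Model (d + 2)) M]
  [IsManifold (𝓡 (d + 2)) ∞ M]
  {N : Type*} [TopologicalSpace N] [ChartedSpace (Model (d + 1)) N] [IsManifold (𝓡 (d + 1)) ∞ N]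
  {g : LorentzMetric (d + 2) M} {u : M → ℝ} {φ : N → M}

omit [IsManifold (𝓡 (d + 1)) ∞ N] in
theorem form_eventuallyEq {w w' : OneForm (d + 1) N} {x : N} (h : ∀ᶠ y in 𝓝 x, w y = w' y) :
    form w x =ᶠ[𝓝 (extChartAt (𝓡 (d + 1)) x x)] form w' x := by
  have h1 := tendsto_symm' (mem_extChartAt_target (I := 𝓡 (d + 1)) x)
  rw [extChartAt_to_inv] at h1
  filter_upwards [h1.eventually h] with z hz
  rw [form, form, hz]

theorem mvfderiv_cofr {s : N → ℝ} {c p : N} (hp : p ∈ (extChartAt (𝓡 (d + 1)) c).source)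
    (hs : MDifferentiableAt (𝓡 (d + 1)) 𝓘(ℝ, ℝ) s p) (X : TangentSpace (𝓡 (d + 1)) p) :
    mvfderiv (𝓡 (d + 1)) s p X = fderiv ℝ (fun z => s ((extChartAt (𝓡 (d + 1)) c).symm z))
      (extChartAt (𝓡 (d + 1)) c p) (cofr c p X) := by
  obtain ⟨z, hz, rfl⟩ := exists_coord hp
  rw [(extChartAt (𝓡 (d + 1)) c).right_inv hz, ← mvfderiv_fr hz hs, fr_cofr hz]

/-- Extend w locally by a retraction, differentiate on M, and pull back. The vanishing Hessian makes
the result independent of the extension, and every form is a pullback, so nothing else is possible.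
-/
theorem IsNullSurface.pullbackConnectionWellDefined (hφ : IsNullSurface (m := d + 1) g u φ)
    (hu : ContMDiff (𝓡 (d + 2)) 𝓘(ℝ, ℝ) ∞ u) {h : TwoTensor (d + 2) M} {U : Set M}
    (hh : IsMetricOn h U) (hU : IsOpen U)
    (hess : ∀ x, φ x ∈ U → ∀ X Y : TangentSpace (𝓡 (d + 1)) x,
      nablaForm h (diff u) (φ x) (push φ x X) (push φ x Y) = 0) :
    PullbackConnectionWellDefined (m := d + 1) h φ (φ ⁻¹' U) := by
  choose r V hV hxV hr hrφ using exists_left_inverse hφ.embedding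
  have hpull : ∀ (x y : N), φ y ∈ V x → ∀ w : OneForm (d + 1) N,
      pullForm φ (pullForm (n := d + 1) (m := d + 2) (r x) w) y = w y := fun x y hy w =>
    pullForm_left_inverse (hV x) ((hφ.contMDiff y).mdifferentiableAt (by simp)) hy
      (((hr x).contMDiffAt ((hV x).mem_nhds hy)).mdifferentiableAt (by simp)) (hrφ x) w
  have hpullDiff : ∀ (x y : N), φ y ∈ V x → ∀ w : OneForm (d + 1) N, OneFormDiffAt w y →
      OneFormDiffAt (pullForm (n := d + 1) (m := d + 2) (r x) w) (φ y) := fun x y hy w hw =>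
    oneFormDiffAt_pullForm (hV x) (hr x) hy (by rwa [hrφ x y hy])
  have hev : ∀ (x y : N), φ y ∈ V x → ∀ᶠ y' in 𝓝 y, φ y' ∈ V x := fun x y hy =>
    hφ.contMDiff.continuous.continuousAt.eventually ((hV x).mem_nhds hy)
  -- Z depends only on x, X and Y, neither on w nor on its extension W; it plays the role of the
  -- Christoffel symbols of the induced connection.
  have hZ : ∀ x, φ x ∈ U → ∀ X Y : TangentSpace (𝓡 (d + 1)) x,
      ∃ Z : TangentSpace (𝓡 (d + 1)) x, ∀ (w : OneForm (d + 1) N) (W : OneForm (d + 2) M),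
        OneFormDiffAt W (φ x) → (∀ᶠ y in 𝓝 x, pullForm φ W y = w y) →
        nablaForm h W (φ x) (push φ x X) (push φ x Y)
          = fderiv ℝ (form w x) (extChartAt (𝓡 (d + 1)) x x) (cofr x x X) (cofr x x Y)
            - w x Z := by
    intro x hx X Y
    obtain ⟨Z, hZ⟩ := hφ.exists_nablaForm_push hu hh hU hx X Y (hess x hx X Y)
    refine ⟨Z, fun w W hW hWw => ?_⟩
    rw [hZ W hW, (form_eventuallyEq hWw).fderiv_eq, hWw.self_of_nhds]
  -- The value at x uses the retraction attached to x, so D is defined pointwise and smoothness is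
  -- not immediate.
  let D : OneForm (d + 1) N →
      (x : N) → TangentSpace (𝓡 (d + 1)) x →L[ℝ] TangentSpace (𝓡 (d + 1)) x →L[ℝ] ℝ := fun w x =>
    pullTensor φ (nablaTensor h (pullForm (n := d + 1) (m := d + 2) (r x) w)) x
  have hD : ∀ (w : OneForm (d + 1) N) (x : N) (X Y : TangentSpace (𝓡 (d + 1)) x), D w x X Y
      = nablaForm h (pullForm (n := d + 1) (m := d + 2) (r x) w) (φ x) (push φ x X)
        (push φ x Y) := fun w x X Y => nablaTensor_apply h _ (φ x) _ _
  have hDZ : ∀ x, φ x ∈ U → ∀ X Y : TangentSpace (𝓡 (d + 1)) x,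
      ∃ Z : TangentSpace (𝓡 (d + 1)) x, ∀ w : OneForm (d + 1) N, OneFormDiffAt w x →
        D w x X Y = fderiv ℝ (form w x) (extChartAt (𝓡 (d + 1)) x x) (cofr x x X) (cofr x x Y)
            - w x Z := by
    intro x hx X Y
    obtain ⟨Z, hZ⟩ := hZ x hx X Y
    refine ⟨Z, fun w hw => ?_⟩
    rw [hD]
    exact hZ w _ (hpullDiff x x (hxV x) w hw) ((hev x x (hxV x)).mono fun y hy => hpull x y hy w)
  -- Any local extension computes D. This is the tool for changing retractions.
  have hDW : ∀ x, φ x ∈ U → ∀ X Y : TangentSpace (𝓡 (d + 1)) x, ∀ (w : OneForm (d + 1) N)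
      (W : OneForm (d + 2) M), OneFormDiffAt w x → OneFormDiffAt W (φ x) →
      (∀ᶠ y in 𝓝 x, pullForm φ W y = w y) →
      D w x X Y = nablaForm h W (φ x) (push φ x X) (push φ x Y) := by
    intro x hx X Y w W hw hW hWw
    obtain ⟨Z, hZ⟩ := hZ x hx X Y
    rw [hZ w W hW hWw, hD]
    exact hZ w _ (hpullDiff x x (hxV x) w hw) ((hev x x (hxV x)).mono fun y hy => hpull x y hy w)
  have hform : ∀ {x : N} {w : OneForm (d + 1) N}, OneFormDiffAt w x →
      DifferentiableAt ℝ (form w x) (extChartAt (𝓡 (d + 1)) x x) := by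
    intro x w hw
    rw [← oneFormDiffAt_iff w (mem_extChartAt_target x), extChartAt_to_inv]
    exact hw
  have hpb : ∀ x ∈ φ ⁻¹' U, ∀ W : OneForm (d + 2) M, OneFormDiffAt W (φ x) →
      ∀ X Y : TangentSpace (𝓡 (d + 1)) x,
        D (pullForm φ W) x X Y = nablaForm h W (φ x) (push φ x X) (push φ x Y) :=
    fun x hx W hW X Y => hDW x hx X Y _ W
      (oneFormDiffAt_pullForm isOpen_univ hφ.contMDiff.contMDiffOn trivial hW) hW
      (Filter.Eventually.of_forall fun _ => rfl)
  refine ⟨D, ⟨⟨?_, ?_⟩, ⟨?_⟩, hpb⟩, ?_⟩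
  · intro w w' x hw hw' hx
    ext X Y
    obtain ⟨Z, hZ⟩ := hDZ x hx X Y
    have hadd : OneFormDiffAt (w + w') x := mdifferentiableAt_add_section hw hw'
    have h1 : fderiv ℝ (form (w + w') x) (extChartAt (𝓡 (d + 1)) x x)
        = fderiv ℝ (form w x) (extChartAt (𝓡 (d + 1)) x x)
          + fderiv ℝ (form w' x) (extChartAt (𝓡 (d + 1)) x x) :=
      ((hform hw).hasFDerivAt.add (hform hw').hasFDerivAt).fderiv
    have h2 : (w + w') x Z = w x Z + w' x Z := rfl
    rw [add_apply, add_apply, hZ _ hadd, hZ w hw, hZ w' hw', h1, h2]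
    simp only [add_apply]
    ring
  · intro w s x hw hs hx
    ext X Y
    obtain ⟨Z, hZ⟩ := hDZ x hx X Y
    have hz := mem_extChartAt_target (I := 𝓡 (d + 1)) x
    have hxs := mem_extChartAt_source (I := 𝓡 (d + 1)) x
    have hsz : (extChartAt (𝓡 (d + 1)) x).symm (extChartAt (𝓡 (d + 1)) x x) = x :=
      extChartAt_to_inv x
    have hsm : OneFormDiffAt (s • w) x := MDifferentiableAt.smul_section hs hw
    have hs' : DifferentiableAt ℝ (fun z => s ((extChartAt (𝓡 (d + 1)) x).symm z))
        (extChartAt (𝓡 (d + 1)) x x) := by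
      rw [← mdifferentiableAt_iff_coord hz, hsz]
      exact hs
    have h1 : fderiv ℝ (form (s • w) x) (extChartAt (𝓡 (d + 1)) x x) (cofr x x X)
        = s x • fderiv ℝ (form w x) (extChartAt (𝓡 (d + 1)) x x) (cofr x x X)
          + fderiv ℝ (fun z => s ((extChartAt (𝓡 (d + 1)) x).symm z)) (extChartAt (𝓡 (d + 1)) x x)
            (cofr x x X) • form w x (extChartAt (𝓡 (d + 1)) x x) := by
      have h2 := fderiv_smul_apply (f := form w x) hs' (hform hw) (cofr x x X)
      simp only [hsz] at h2
      exact h2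
    have h2 : (s • w) x Z = s x * w x Z := rfl
    have h3 : fderiv ℝ (fun z => s ((extChartAt (𝓡 (d + 1)) x).symm z))
        (extChartAt (𝓡 (d + 1)) x x) (cofr x x X) = mvfderiv (𝓡 (d + 1)) s x X :=
      (mvfderiv_cofr hxs hs X).symm
    rw [add_apply, add_apply, smul_apply, smul_apply, hZ _ hsm, hZ w hw, h1, h2, h3]
    simp only [add_apply, smul_apply, smul_eq_mul, form_cofr w hxs,
      ContinuousLinearMap.smulRight_apply]
    ring
  · intro w hw x hx
    have hz := mem_extChartAt_target (I := 𝓡 (d + 1)) x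
    have hsz : (extChartAt (𝓡 (d + 1)) x).symm (extChartAt (𝓡 (d + 1)) x x) = x :=
      extChartAt_to_inv x
    have hVo : IsOpen (φ ⁻¹' U) := hU.preimage hφ.contMDiff.continuous
    have hc : φ ((extChartAt (𝓡 (d + 1)) x).symm (extChartAt (𝓡 (d + 1)) x x))
        ∈ (extChartAt (𝓡 (d + 2)) (φ x)).source := by
      rw [hsz]; exact mem_extChartAt_source (I := 𝓡 (d + 2)) (φ x)
    have hws : ∀ y ∈ φ ⁻¹' U, ContMDiffAt (𝓡 (d + 1))
        ((𝓡 (d + 1)).prod 𝓘(ℝ, Model (d + 1) →L[ℝ] ℝ)) ∞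
        (fun p => TotalSpace.mk' (Model (d + 1) →L[ℝ] ℝ) p (w p)) y := fun y hy =>
      (hw.contMDiffAt (hVo.mem_nhds hy)).of_le (by simp)
    refine ContMDiffAt.contMDiffWithinAt ?_
    have h0 := contMDiffAt_tensor_iff (D w) hz
    rw [hsz] at h0
    refine h0.2 (contDiffAt_of_apply fun a => contDiffAt_of_apply fun b => ?_)
    have hWs : ContDiffAt ℝ ∞ (form (pullForm (n := d + 1) (m := d + 2) (r x) w) (φ x))
        (loc (n := d + 2) (m := d + 1) φ x (φ x) (extChartAt (𝓡 (d + 1)) x x)) := by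
      have hy := mem_extChartAt_target (I := 𝓡 (d + 2)) (φ x)
      have hsy : (extChartAt (𝓡 (d + 2)) (φ x)).symm (extChartAt (𝓡 (d + 2)) (φ x) (φ x)) = φ x :=
        extChartAt_to_inv (φ x)
      rw [loc_center]
      refine contDiffAt_form_pullForm (n := d + 1) (m := d + 2) (c := x) (hV x) (hr x) hy
        (by rw [hsy]; exact hxV x)
        (by rw [hsy, hrφ x x (hxV x)]; exact mem_extChartAt_source (I := 𝓡 (d + 1)) x) ?_
      rw [loc, hsy, hrφ x x (hxV x), ← contMDiffAt_form_iff w hz, hsz]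
      exact hws x hx
    refine (contDiffAt_nab_loc isOpen_univ hφ.contMDiff.contMDiffOn hh hz trivial
      (by rw [hsz]; exact hx) hc hWs a b).congr_of_eventuallyEq ?_
    -- At points near x the definition of D uses other retractions; `hDW` replaces them all by the
    -- fixed r x, for which smoothness is known.
    filter_upwards [eventually_loc isOpen_univ hφ.contMDiff.contMDiffOn hz trivial hc,
      eventually_mem_of_symm hVo hz (by rwa [hsz]),
      eventually_mem_of_symm ((hV x).preimage hφ.contMDiff.continuous) hz
        (by rw [hsz]; exact hxV x)] with z hz1 hz2 hz3
    have hwz : OneFormDiffAt w ((extChartAt (𝓡 (d + 1)) x).symm z) :=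
      (hws _ hz2.2).mdifferentiableAt (by simp)
    have hWz := hpullDiff x _ hz3.2 w hwz
    rw [nab_loc hh hU hz1.1 (hz1.2.1.mdifferentiableAt (by simp)) hz2.2 hz1.2.2 hWz, tens_apply]
    exact hDW _ hz2.2 _ _ w _ hwz hWz ((hev x _ hz3.2).mono fun y hy => hpull x y hy w)
  · intro D' hD' x hx w hw
    obtain ⟨W, hW, rfl⟩ := exists_pullForm_eq hφ.embedding x hw
    ext X Y
    rw [hD'.pullback x hx W hW, hpb x hx W hW]

end Connection

end NullPullback
end

/-! ### The main theorem. -/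

theorem theorem4 {d : ℕ}
    {M : Type*} [TopologicalSpace M] [T2Space M] [SecondCountableTopology M]
    [ChartedSpace (Model (d + 2)) M] [IsManifold (𝓡 (d + 2)) ∞ M]
    {N : Type*} [TopologicalSpace N] [ChartedSpace (Model (d + 1)) N]
    [IsManifold (𝓡 (d + 1)) ∞ N]
    (g : LorentzMetric (d + 2) M)
    (u : M → ℝ) (hu : ContMDiff (𝓡 (d + 2)) 𝓘(ℝ, ℝ) ∞ u)
    (φ : N → M) (hφ : IsNullSurface (m := d + 1) g u φ)
    (T : TwoTensor (d + 2) M) (hT : IsRicciDifference g u T)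
    (k : N → ℝ)
    (hk : ∀ (x : N) (X Y : TangentSpace (𝓡 (d + 1)) x),
      pullTensor φ T x X Y = k x * pullTensor φ g.val x X Y) :
    ∃ ν : VField (d + 1) N, IsNormalField g u φ ν ∧
      -- the Lie derivative of the induced metric is proportional to the induced metric
      (∃ f : N → ℝ, ContMDiff (𝓡 (d + 1)) 𝓘(ℝ, ℝ) ∞ f ∧
        LieProportional ν (pullTensor φ g.val) f Set.univ) ∧
      -- near every point of the surface there is a conformal factor
      (∀ x : N, ∃ (U : Set M) (ρ : M → ℝ), IsOpen U ∧ φ x ∈ U ∧ IsKillingFactor g φ ν U ρ) ∧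
      -- there is a global one if the surface is a product along its null generators
      (∀ {S : Type*} [TopologicalSpace S] [ChartedSpace (Model d) S] [IsManifold (𝓡 d) ∞ S]
        (Φ : Diffeomorph ((𝓡 d).prod 𝓘(ℝ, ℝ)) (𝓡 (d + 1)) (S × ℝ) N ∞),
        (∀ (s : S) (t : ℝ), ∃ c : ℝ,
          mfderiv 𝓘(ℝ, ℝ) (𝓡 (d + 1)) (fun t' : ℝ => Φ (s, t')) t
            ((NormedSpace.fromTangentSpace t).symm (1 : ℝ)) = c • ν (Φ (s, t))) →
        ∃ ρ : M → ℝ, IsKillingFactor g φ ν Set.univ ρ) ∧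
      -- for every conformal factor the pullback connection is well-defined
      (∀ (U : Set M) (ρ : M → ℝ), IsOpen U → IsKillingFactor g φ ν U ρ →
        PullbackConnectionWellDefined (m := d + 1) (conformal ρ g.val) φ (φ ⁻¹' U)) := by
  obtain ⟨ν, hν⟩ := hφ.exists_normal hu
  obtain ⟨f, hfs, hess⟩ := hφ.exists_hess_eq hu hν hT hk
  have hf := lieProportional_of_hess hφ hu hν hess
  refine ⟨ν, hν, ⟨f, hfs, hf⟩, hφ.exists_isKillingFactor_near hu hν hf hfs, ?_, ?_⟩
  · intro S _ _ _ Φ hΦ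
    obtain ⟨h, hh, hνh⟩ := exists_log_of_product hν.smooth hfs Φ hΦ
    exact hφ.exists_isKillingFactor_of_log hu hν hf hh hνh
  · intro U ρ hU hρ
    exact hφ.pullbackConnectionWellDefined hu
      (isMetricOn_conformal (g.isMetricOn.mono (Set.subset_univ _)) hU hρ.smooth
        fun p hp => (hρ.pos p hp).ne') hU fun x hx => hρ.hess_eq_zero hφ hu hν hU hx
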